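/- Let $k$ be a field. A variety is an irreducible reduced separated scheme of finite type over $k$. For a birational map $\phi\colon V\dashrightarrow W$ of varieties let $\mathrm{Ex}(\phi)\subset V$ be the closed set of points at which $\phi$ is not an isomorphism onto an open subscheme of $W$, and put $$c(\phi)=\sum_{y\in \mathrm{Ex}(\phi^{-1}),\ \operatorname{codim} y=1}[k(y)]-\sum_{x\in \mathrm{Ex}(\phi),\ \operatorname{codim} x=1}[k(x)]\in\mathbb Z[\mathrm{Bir}/k],$$ where $\mathbb Z[\mathrm{Bir}/k]$ is the free abelian group on birational classes of varieties over $k$, and $[k(x)]$ is the class of the closure of $x$ with its reduced structure. Varieties $V,W$ are strongly birational if there is a birational map $\gamma\colon V\dashrightarrow W$ with $c(\gamma)=0$, and stably birational if $V\times\mathbb P^a$ and $W\times\mathbb P^b$ are birational for some $a,b\ge 0$. Write $\mathbb L=[\mathbb A^1]$ in the Grothendieck ring $K_0(\mathrm{Var}/k)$. An L-link with centers $X$ and $Y$ consists of geometrically reduced varieties $X,Y$, varieties $\mathcal X,\mathcal X'$ that are smooth in codimension one, closed embeddings $X\hookrightarrow\mathcal X$ and $Y\hookrightarrow\mathcal X'$,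 and a scheme $T$ with morphisms $\mathrm{Bl}_X\colon T\to\mathcal X$ and $\mathrm{Bl}_Y\colon T\to\mathcal X'$ which are the blow-ups of $X$ and of $Y$, such that $[\mathcal X]=[\mathcal X']$ in $K_0(\mathrm{Var}/k)$, the varieties $\mathcal X$ and $\mathcal X'$ are strongly birational, and the exceptional divisors $\mathrm{Bl}_X^{-1}(X)$ and $\mathrm{Bl}_Y^{-1}(Y)$ are irreducible. Let $\psi=\mathrm{Bl}_Y\circ\mathrm{Bl}_X^{-1}\colon\mathcal X\dashrightarrow\mathcal X'$. The link is smooth if $X,Y,\mathcal X,\mathcal X',T$ are smooth over $k$. Given an L-link, let $m$ and $m'$ be the codimensions of $X$ in $\mathcal X$ and of $Y$ in $\mathcal X'$. Let $\gamma\colon\mathcal X\dashrightarrow\mathcal X'$ be any birational map with $c(\gamma)=0$ and $\phi=\gamma^{-1}\circ\psi\in\mathrm{Bir}(\mathcal X)$. 1. If the link is smooth, then $\mathbb L\,([\mathbb P^{m-2}][X]-[\mathbb P^{m'-2}][Y])=0$ in $K_0(\mathrm{Var}/k)$ (where $\mathbb P^{-1}=\varnothing$). 2. We have $c(\phi)=c(\psi)$;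 in particular $c(\phi)\ne 0$ if $c(\psi)\neq 0$. If moreover $m,m'\ge 2$, and $\mathcal X$ is smooth over $k$ at the generic point of $X$ and $\mathcal X'$ is smooth over $k$ at the generic point of $Y$, then $\mathbb P^{m-1}\times X$ and $\mathbb P^{m'-1}\times Y$ are varieties and $$c(\phi)=c(\psi)=[\mathbb P^{m-1}\times X]-[\mathbb P^{m'-1}\times Y]\quad\text{in }\mathbb Z[\mathrm{Bir}/k];$$ in particular, if $X$ and $Y$ are not stably birational, then $c(\psi)\neq 0$ and $c(\phi)\ne 0$. -/

import Mathlib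

open CategoryTheory AlgebraicGeometry

universe u

namespace Motivic

/-! ### Schemes and varieties over a field -/

/-- Schemes over the field `k`. -/
abbrev Sch (k : Type u) [Field k] := Over (Spec (CommRingCat.of k))

section Basic

variable {k : Type u} [Field k]

/-- `X` is of finite type over `k`. -/
class IsFiniteType (X : Sch k) : Prop where
  locallyOfFiniteType : LocallyOfFiniteType X.hom
  quasiCompact : QuasiCompact X.hom

/-- A variety: an irreducible and reduced separated scheme of finite type over `k`. -/
class IsVariety (X : Sch k) : Prop extends IsFiniteType X where
  isIntegral : IsIntegral X.left
  isSeparated : IsSeparated X.hom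

attribute [instance] IsFiniteType.locallyOfFiniteType IsFiniteType.quasiCompact
  IsVariety.isIntegral IsVariety.isSeparated

/-- The product `X ×ₖ Y`. -/
noncomputable def prod (X Y : Sch k) : Sch k :=
  Over.mk (Limits.pullback.fst X.hom Y.hom ≫ X.hom)

instance prod_isFiniteType (X Y : Sch k) [IsFiniteType X] [IsFiniteType Y] : IsFiniteType (prod X Y) where
  locallyOfFiniteType := by dsimp [prod]; infer_instance
  quasiCompact := by dsimp [prod]; infer_instance

end Basic

section Spaces

variable (k : Type u) [Field k]

/-- The point `Spec k`. -/
noncomputable def pt : Sch k := Over.mk (𝟙 (Spec (CommRingCat.of k)))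

instance pt_isFiniteType : IsFiniteType (pt k) where
  locallyOfFiniteType := by dsimp [pt]; infer_instance
  quasiCompact := by dsimp [pt]; infer_instance

/-- The affine line over `k`. -/
noncomputable def affineLine : Sch k :=
  Over.mk (𝔸(ULift.{u} (Fin 1); Spec (CommRingCat.of k)) ↘ Spec (CommRingCat.of k))

instance affineLine_isFiniteType : IsFiniteType (affineLine k) where
  locallyOfFiniteType := by dsimp [affineLine]; infer_instance
  quasiCompact := by dsimp [affineLine]; infer_instance

section ProjectiveSpace

attribute [local instance] MvPolynomial.gradedAlgebra

/-- Projective space over `k` with `r` homogeneous coordinates, `Proj k[x₀, …, x_{r-1}]`: this is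
`ℙ^(r-1)`, and it is empty for `r = 0`. -/
noncomputable def projSpace (r : ℕ) : Sch k :=
  Over.mk (Proj.toSpecZero (MvPolynomial.homogeneousSubmodule (Fin r) k) ≫
    Spec.map (CommRingCat.ofHom (algebraMap k (MvPolynomial.homogeneousSubmodule (Fin r) k 0))))

instance projSpace_isFiniteType (r : ℕ) : IsFiniteType (projSpace k r) := by
  have h : Function.Surjective
      (algebraMap k (MvPolynomial.homogeneousSubmodule (Fin r) k 0)) := by
    rintro ⟨p, hp⟩
    refine ⟨p.coeff 0, Subtype.ext ?_⟩
    exact (MvPolynomial.totalDegree_eq_zero_iff_eq_C.mp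
      (Nat.le_zero.mp (MvPolynomial.IsHomogeneous.totalDegree_le hp))).symm
  have : IsClosedImmersion (Spec.map (CommRingCat.ofHom
      (algebraMap k (MvPolynomial.homogeneousSubmodule (Fin r) k 0)))) :=
    IsClosedImmersion.spec_of_surjective _ h
  have : IsScalarTower k (MvPolynomial.homogeneousSubmodule (Fin r) k 0)
      (MvPolynomial (Fin r) k) := ⟨fun a x y => smul_mul_assoc a (x : MvPolynomial (Fin r) k) y⟩
  have : Algebra.FiniteType (MvPolynomial.homogeneousSubmodule (Fin r) k 0)
      (MvPolynomial (Fin r) k) :=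
    Algebra.FiniteType.of_restrictScalars_finiteType k _ _
  constructor <;> dsimp [projSpace] <;> infer_instance

end ProjectiveSpace

end Spaces

section Points

variable {k : Type u} [Field k]

/-- The closed subvariety of `X` with generic point `x`, i.e. the closure of `x` with its reduced
structure (the scheme-theoretic image of `Spec κ(x) ⟶ X`). Its function field is `κ(x)`. -/
noncomputable def pointClosure (X : Sch k) (x : X.left) : Sch k :=
  Over.mk ((X.left.fromSpecResidueField x).imageι ≫ X.hom)

instance pointClosure_isVariety (X : Sch k) [IsVariety X] (x : X.left) : IsVariety (pointClosure X x) := by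
  set f := X.left.fromSpecResidueField x
  have : IsIntegral f.image := by
    have h1 : IrreducibleSpace f.image := by
      refine (irreducibleSpace_def _).mpr ?_
      rw [Set.top_eq_univ, ← f.toImage.denseRange.closure_range, ← Set.image_univ]
      exact ((IrreducibleSpace.isIrreducible_univ _).image _
        f.toImage.continuous.continuousOn).closure
    have h2 : IsReduced f.image := by
      refine ⟨fun V => ⟨fun s hs => ?_⟩⟩
      refine f.image.IsSheaf.section_ext fun z hz => ?_
      obtain ⟨_, ⟨_, ⟨U, hU, rfl⟩, rfl⟩, hzU, hUV⟩ :=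
        (X.left.isBasis_affineOpens.of_isInducing
          f.imageι.isEmbedding.isInducing).exists_subset_of_mem_open hz V.isOpen
      refine ⟨f.imageι ⁻¹ᵁ U, hUV, hzU, f.toImage_app_injective ⟨U, hU⟩ ?_⟩
      rw [map_zero, map_zero]
      exact ((hs.map (f.image.presheaf.map (homOfLE hUV).op).hom).map
        (f.toImage.app (f.imageι ⁻¹ᵁ U)).hom).eq_zero
    exact isIntegral_of_irreducibleSpace_of_isReduced _
  exact { 
    isIntegral := this
    isSeparated := by dsimp [pointClosure]; infer_instance
    locallyOfFiniteType := by dsimp [pointClosure]; infer_instance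
    quasiCompact := by dsimp [pointClosure]; infer_instance }

/-- `X` is smooth over `k` at the point `x`. -/
def SmoothAt (X : Sch k) (x : X.left) : Prop :=
  ∃ U : X.left.Opens, x ∈ U ∧ Smooth (U.ι ≫ X.hom)

/-- `X` is smooth over `k` at all points of codimension at most one. -/
def SmoothInCodimOne (X : Sch k) : Prop :=
  ∀ x : X.left, Order.coheight x ≤ 1 → SmoothAt X x

/-- The codimension in `M` of the image of the generic point of the variety `X`. -/
noncomputable def codim {X M : Sch k} [IsVariety X] (i : X ⟶ M) : ℕ∞ :=
  Order.coheight (i.left (genericPoint X.left))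

end Points

/-! ### Birational maps -/

section PartialIso

variable {X Y Z : Scheme.{u}}

lemma isDominant_hom (f : X.PartialIso Y) : IsDominant f.toPartialMap.hom := by
  have := Opens.isDominant_ι f.dense_target
  exact inferInstanceAs (IsDominant (f.iso.hom ≫ f.target.ι))

lemma equiv_of_roof (f g : X.PartialMap Y) {W : Scheme.{u}} (a : W ⟶ f.domain) (b : W ⟶ g.domain)
    (hab : a ≫ f.domain.ι = b ≫ g.domain.ι) (w : W ⟶ X) [IsOpenImmersion w]
    (hw : a ≫ f.domain.ι = w) (hd : Dense (Set.range w)) (h : a ≫ f.hom = b ≫ g.hom) :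
    f.equiv g := by
  have ha : w.opensRange ≤ f.domain := by
    rintro _ ⟨z, rfl⟩
    rw [← hw]
    exact (a z).2
  have hb : w.opensRange ≤ g.domain := by
    rintro _ ⟨z, rfl⟩
    rw [← hw, hab]
    exact (b z).2
  refine ⟨w.opensRange, hd, ha, hb, ?_⟩
  have ea : w.isoOpensRange.hom ≫ X.homOfLE ha = a := by
    rw [← cancel_mono f.domain.ι, hw]; simp
  have eb : w.isoOpensRange.hom ≫ X.homOfLE hb = b := by
    rw [← cancel_mono g.domain.ι, ← hab, hw]; simp
  refine (?_ : X.homOfLE ha ≫ f.hom = X.homOfLE hb ≫ g.hom)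
  rw [← cancel_epi w.isoOpensRange.hom, reassoc_of% ea, reassoc_of% eb, h]

lemma comp_roof [PreirreducibleSpace X] [Nonempty Y] (f : X.PartialMap Y) [IsDominant f.hom]
    (g : Y.PartialMap Z) {W : Scheme.{u}} (s : W ⟶ f.domain) (t : W ⟶ g.domain)
    (hst : s ≫ f.hom = t ≫ g.domain.ι) :
    ∃ b : W ⟶ (f.comp g).domain, b ≫ (f.comp g).domain.ι = s ≫ f.domain.ι ∧
      b ≫ (f.comp g).hom = t ≫ g.hom := by
  let l := (isPullback_morphismRestrict f.hom g.domain).lift t s hst.symm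
  have h1 : l ≫ (f.hom ⁻¹ᵁ g.domain).ι = s := IsPullback.lift_snd _ _ _ _
  have h2 : l ≫ f.hom ∣_ g.domain = t := IsPullback.lift_fst _ _ _ _
  refine ⟨l ≫ (f.domain.ι.isoImage _).hom, ?_, ?_⟩
  · refine (?_ : (l ≫ (f.domain.ι.isoImage _).hom) ≫
      (f.domain.ι ''ᵁ f.hom ⁻¹ᵁ g.domain).ι = _)
    rw [← h1]
    simp
  · refine (?_ : (l ≫ (f.domain.ι.isoImage _).hom) ≫
      (f.domain.ι.isoImage _).inv ≫ f.hom ∣_ g.domain ≫ g.hom = _)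
    rw [← h2]
    simp

lemma restrictSource_hom_ι (f : X.PartialIso Y) (U : X.Opens) (hU : Dense (U : Set X)) (hU' : U ≤ f.source) :
    (f.restrictSource U hU hU').iso.hom ≫ (f.restrictSource U hU hU').target.ι =
      X.homOfLE hU' ≫ f.iso.hom ≫ f.target.ι := by
  have e : (Scheme.Opens.isoOfLE hU').inv ≫ (f.source.ι ⁻¹ᵁ U).ι = X.homOfLE hU' := by
    rw [← cancel_mono f.source.ι]; simp
  rw [← e]
  refine (?_ : ((Scheme.Opens.isoOfLE hU').inv ≫ (f.iso.hom.isoImage (f.source.ι ⁻¹ᵁ U)).hom ≫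
    (f.target.ι.isoImage (f.iso.hom ''ᵁ f.source.ι ⁻¹ᵁ U)).hom) ≫
    (f.target.ι ''ᵁ f.iso.hom ''ᵁ f.source.ι ⁻¹ᵁ U).ι = _)
  simp

lemma symm_equiv {f g : X.PartialIso Y}
    (h : f.toRationalMap = g.toRationalMap) :
    f.symm.toRationalMap = g.symm.toRationalMap := by
  rw [Scheme.PartialMap.toRationalMap_eq_iff] at h ⊢
  obtain ⟨W, hW, hf, hg, e⟩ := h
  have hf' : W ≤ f.source := hf
  have hg' : W ≤ g.source := hg
  have e' : X.homOfLE hf' ≫ f.iso.hom ≫ f.target.ι = X.homOfLE hg' ≫ g.iso.hom ≫ g.target.ι := e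
  refine equiv_of_roof f.symm.toPartialMap g.symm.toPartialMap (W := W)
    (X.homOfLE hf' ≫ f.iso.hom) (X.homOfLE hg' ≫ g.iso.hom) ?_
    (X.homOfLE hf' ≫ f.iso.hom ≫ f.target.ι) (Category.assoc _ _ _) ?_ ?_
  · exact (Category.assoc _ _ _).trans (e'.trans (Category.assoc _ _ _).symm)
  · have := Opens.isDominant_ι f.dense_target
    have := Opens.isDominant_homOfLE hW hf'
    have h : IsDominant (X.homOfLE hf' ≫ f.iso.hom ≫ f.target.ι) := inferInstance
    exact h.denseRange
  · refine (?_ : (X.homOfLE hf' ≫ f.iso.hom) ≫ f.iso.inv ≫ f.source.ι =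
      (X.homOfLE hg' ≫ g.iso.hom) ≫ g.iso.inv ≫ g.source.ι)
    simp

lemma iso_comp_aux {P Q R S : Scheme.{u}} (e : P ≅ Q) (i : P ⟶ P) (hi : i = 𝟙 P) (h : P ⟶ R)
    (l : R ⟶ S) : e.hom ≫ (e.inv ≫ i ≫ h) ≫ l = h ≫ l := by
  simp [hi]

lemma trans_eq_comp [PreirreducibleSpace X] [Nonempty Y] (f : X.PartialIso Y) (g : Y.PartialIso Z) :
    haveI := isDominant_hom f
    (f.trans g).toRationalMap = f.toRationalMap.comp g.toRationalMap := by
  have := isDominant_hom f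
  have hV := f.dense_target.inter_of_isOpen_right g.dense_source g.source.2
  let V := f.target ⊓ g.source
  have hl : V ≤ f.target := inf_le_left
  have hr : V ≤ g.source := inf_le_right
  let A := f.symm.restrictSource V hV hl
  let B := g.restrictSource V hV hr
  have eA : A.iso.hom ≫ A.target.ι = Y.homOfLE hl ≫ f.iso.inv ≫ f.source.ι := restrictSource_hom_ι f.symm V hV hl
  have eB : B.iso.hom ≫ B.target.ι = Y.homOfLE hr ≫ g.iso.hom ≫ g.target.ι := restrictSource_hom_ι g V hV hr
  obtain ⟨b, hb1, hb2⟩ := comp_roof f.toPartialMap g.toPartialMap (W := V)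
    (Y.homOfLE hl ≫ f.iso.inv) (Y.homOfLE hr) <| by
      refine (?_ : (Y.homOfLE hl ≫ f.iso.inv) ≫ f.iso.hom ≫ f.target.ι = Y.homOfLE hr ≫ g.source.ι)
      simp
  have hb1' : b ≫ (f.toPartialMap.comp g.toPartialMap).domain.ι =
    Y.homOfLE hl ≫ f.iso.inv ≫ f.source.ι := hb1.trans (Category.assoc _ _ _)
  rw [Scheme.RationalMap.toRationalMap_comp, Scheme.PartialMap.toRationalMap_eq_iff]
  refine equiv_of_roof (f.trans g).toPartialMap (f.toPartialMap.comp g.toPartialMap)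
    (W := V) A.iso.hom b (eA.trans hb1'.symm) (Y.homOfLE hl ≫ f.iso.inv ≫ f.source.ι) eA ?_ ?_
  · have := Opens.isDominant_ι f.dense_source
    have := Opens.isDominant_homOfLE hV hl
    have h : IsDominant (Y.homOfLE hl ≫ f.iso.inv ≫ f.source.ι) := inferInstance
    exact h.denseRange
  · rw [hb2]
    refine (?_ : A.iso.hom ≫ (A.iso.inv ≫ (Y.isoOfEq rfl).hom ≫ B.iso.hom) ≫ B.target.ι =
      Y.homOfLE hr ≫ g.iso.hom ≫ g.target.ι)
    exact (iso_comp_aux A.iso (Y.isoOfEq rfl).hom (by simp) B.iso.hom B.target.ι).trans eB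
lemma trans_eq_trans [PreirreducibleSpace X] [Nonempty Y] {f f' : X.PartialIso Y}
    {g g' : Y.PartialIso Z} (hf : f.toRationalMap = f'.toRationalMap)
    (hg : g.toRationalMap = g'.toRationalMap) :
    (f.trans g).toRationalMap = (f'.trans g').toRationalMap := by
  have := isDominant_hom f
  have := isDominant_hom f'
  have key : ∀ (a b : X ⤏ Y) [a.IsDominant] [b.IsDominant] (c : Y ⤏ Z), a = b →
      a.comp c = b.comp c := by
    intro a b _ _ c h
    subst h
    rfl
  rw [trans_eq_comp, trans_eq_comp, hg]
  exact key _ _ _ hf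

end PartialIso

section BirMap

variable {k : Type u} [Field k]

/-- Isomorphisms over `k` between dense open subschemes of `X` and `Y`. -/
def OverPartialIso (X Y : Sch k) : Type u :=
  {f : X.left.PartialIso Y.left // f.IsOver X.hom Y.hom}

/-- Two partial isomorphisms are identified if they agree on a dense open subscheme. -/
instance OverPartialIso.setoid (X Y : Sch k) : Setoid (OverPartialIso X Y) where
  r f g := f.1.toRationalMap = g.1.toRationalMap
  iseqv := ⟨fun _ => rfl, fun h => h.symm, fun h h' => h.trans h'⟩

/-- `BirMap X Y` is the set `Bir(X, Y)` of birational maps over `k` from `X` to `Y`. -/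
def BirMap (X Y : Sch k) : Type u := Quotient (OverPartialIso.setoid X Y)

/-- The inverse of a birational map. -/
noncomputable def BirMap.symm {X Y : Sch k} (φ : BirMap X Y) : BirMap Y X :=
  Quotient.map (fun f => (⟨f.1.symm, f.2.symm⟩ : OverPartialIso Y X))
    (fun _ _ h => symm_equiv h) φ

/-- The composition of birational maps, in diagrammatic order: `φ.comp ψ` is `ψ ∘ φ`. -/
noncomputable def BirMap.comp {X Y Z : Sch k} [IsVariety X] [IsVariety Y]
    (φ : BirMap X Y) (ψ : BirMap Y Z) : BirMap X Z :=
  Quotient.map₂ (fun f g => (⟨f.1.trans g.1, f.2.trans g.2⟩ : OverPartialIso X Z))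
    (fun _ _ h _ _ h' => trans_eq_trans h h') φ ψ

/-- The exceptional set `Ex(φ)`: the points of `X` at which `φ` is not an isomorphism onto an
open subscheme of `Y`. -/
def BirMap.exceptionalSet {X Y : Sch k} (φ : BirMap X Y) : Set X.left :=
  {x | ¬ ∃ f : OverPartialIso X Y, Quotient.mk _ f = φ ∧ x ∈ f.1.source}

end BirMap

/-! ### The group `ℤ[Bir/k]` and the invariant `c` -/

section Invariant

variable (k : Type u) [Field k]

/-- Varieties over `k` up to birational equivalence over `k`. -/
instance birSetoid : Setoid {X : Sch k // IsVariety X} where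
  r X Y := Scheme.BirationalOver X.1.hom Y.1.hom
  iseqv := ⟨fun _ => .refl _, fun h => h.symm, fun h h' => h.trans h'⟩

/-- The set `Bir/k` of birational classes of varieties over `k`. -/
def BirClass : Type (u + 1) := Quotient (birSetoid k)

/-- The free abelian group `ℤ[Bir/k]` on the birational classes of varieties over `k`. -/
abbrev BirGroup : Type (u + 1) := FreeAbelianGroup (BirClass k)

variable {k}

/-- The birational class of a variety in `ℤ[Bir/k]`. -/
def birClass (X : Sch k) [h : IsVariety X] : BirGroup k :=
  FreeAbelianGroup.of (Quotient.mk _ ⟨X, h⟩)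

/-- The points of codimension one in the exceptional set of `φ`. -/
def BirMap.exceptionalDivisors {X Y : Sch k} (φ : BirMap X Y) : Set X.left :=
  {x | x ∈ φ.exceptionalSet ∧ Order.coheight x = 1}

/-- The sums in the definition of `BirMap.c` are finite. -/
theorem BirMap.finite_exceptionalDivisors {X Y : Sch k} [IsVariety X] (φ : BirMap X Y) :
    φ.exceptionalDivisors.Finite := by
  have hc : IsClosed φ.exceptionalSet := by
    rw [← isOpen_compl_iff, isOpen_iff_forall_mem_open]
    intro x hx
    obtain ⟨f, hf, hxf⟩ := not_not.mp hx
    exact ⟨f.1.source, fun y hy => not_not.mpr ⟨f, hf, hy⟩, f.1.source.2, hxf⟩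
  have hη : genericPoint X.left ∉ φ.exceptionalSet := by
    obtain ⟨f, hf⟩ := Quotient.exists_rep φ
    exact not_not.mpr ⟨f, hf, ((genericPoint_specializes _).mem_open f.1.source.2
      f.1.dense_source.nonempty.choose_spec)⟩
  have : IsLocallyNoetherian X.left := LocallyOfFiniteType.isLocallyNoetherian X.hom
  have : CompactSpace X.left := QuasiCompact.compactSpace_of_compactSpace X.hom
  have : IsNoetherian X.left := {}
  obtain ⟨S, hS, hSc, hSi, hU⟩ :=
    TopologicalSpace.NoetherianSpace.exists_finite_set_isClosed_irreducible hc
  have : Finite S := hS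
  refine (Set.finite_range fun C : S => (hSi C.1 C.2).genericPoint).subset ?_
  rintro x ⟨hxE, hx⟩
  rw [hU] at hxE
  obtain ⟨C, hC, hxC⟩ := hxE
  refine ⟨⟨C, hC⟩, ?_⟩
  have hz : (hSi C hC).genericPoint ∈ C := by
    have h := (hSi C hC).genericPoint_closure_eq
    rw [(hSc C hC).closure_eq] at h
    exact h.subset (subset_closure rfl)
  have hzx : (hSi C hC).genericPoint ⤳ x := by
    rw [specializes_iff_mem_closure, (hSi C hC).genericPoint_closure_eq, (hSc C hC).closure_eq]
    exact hxC
  by_contra hne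
  have hne' : ¬ x ⤳ (hSi C hC).genericPoint := fun h => hne (hzx.antisymm h).eq
  have h1 : x < (hSi C hC).genericPoint := ⟨hzx, hne'⟩
  have h2 : (hSi C hC).genericPoint < genericPoint X.left := by
    refine ⟨genericPoint_specializes _, fun h => hη ?_⟩
    rw [hU]
    exact ⟨C, hC, h.mem_closed (hSc C hC) hz⟩
  have h3 := Order.coheight_add_one_le h1
  have h4 := Order.coheight_add_one_le h2
  rw [hx] at h3
  have h5 : (1 : ℕ∞) + 1 ≤ 1 :=
    (add_le_add_left ((self_le_add_left 1 _).trans h4) 1).trans h3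
  exact absurd h5 (by decide)

/-- The invariant `c(φ) = ∑ [k(y)] - ∑ [k(x)]`, where `y` runs over the points of codimension one
in `Ex(φ⁻¹)` and `x` over those in `Ex(φ)`. -/
noncomputable def BirMap.c {X Y : Sch k} [IsVariety X] [IsVariety Y] (φ : BirMap X Y) :
    BirGroup k :=
  (∑ᶠ y ∈ φ.symm.exceptionalDivisors, birClass (pointClosure Y y)) -
    ∑ᶠ x ∈ φ.exceptionalDivisors, birClass (pointClosure X x)

/-- `X` and `Y` are strongly birational. -/
def StronglyBirational (X Y : Sch k) [IsVariety X] [IsVariety Y] : Prop :=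
  ∃ γ : BirMap X Y, γ.c = 0

/-- `X` and `Y` are stably birational: `X × ℙ^a` and `Y × ℙ^b` are birational for some `a, b`. -/
def StablyBirational (X Y : Sch k) : Prop :=
  ∃ a b : ℕ, Scheme.BirationalOver (prod X (projSpace k (a + 1))).hom
    (prod Y (projSpace k (b + 1))).hom

end Invariant

/-! ### The Grothendieck ring of varieties -/

section Grothendieck

variable (k : Type u) [Field k]

/-- The free commutative ring on schemes of finite type over `k`. -/
abbrev PreK0 : Type (u + 1) := FreeCommRing {X : Sch k // IsFiniteType X}

variable {k} in
/-- The generator of `PreK0 k` given by `X`. -/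
def PreK0.gen (X : Sch k) [h : IsFiniteType X] : PreK0 k := FreeCommRing.of ⟨X, h⟩

/-- The relations of the Grothendieck ring: isomorphic schemes have equal classes,
`[X] = [U] + [Z]` for `U` open in `X` with closed complement `Z`, `[X × Y] = [X] [Y]`,
and `[Spec k] = 1`. -/
inductive K0Rel : PreK0 k → Prop
  | iso (X Y : Sch k) [IsFiniteType X] [IsFiniteType Y] (e : X ≅ Y) :
      K0Rel (PreK0.gen X - PreK0.gen Y)
  | cut (X U Z : Sch k) [IsFiniteType X] [IsFiniteType U] [IsFiniteType Z]
      (j : U ⟶ X) (i : Z ⟶ X) (hj : IsOpenImmersion j.left) (hi : IsClosedImmersion i.left)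
      (h : Set.range j.left = (Set.range i.left)ᶜ) :
      K0Rel (PreK0.gen X - (PreK0.gen U + PreK0.gen Z))
  | prod (X Y : Sch k) [IsFiniteType X] [IsFiniteType Y] :
      K0Rel (PreK0.gen (prod X Y) - PreK0.gen X * PreK0.gen Y)
  | one : K0Rel (PreK0.gen (pt k) - 1)

/-- The Grothendieck ring `K₀(Var/k)` of varieties over `k`. -/
abbrev K0 : Type (u + 1) := PreK0 k ⧸ Ideal.span {r : PreK0 k | K0Rel k r}

variable {k} in
/-- The class of a scheme of finite type in `K₀(Var/k)`. -/
noncomputable def k0Class (X : Sch k) [IsFiniteType X] : K0 k := Ideal.Quotient.mk _ (PreK0.gen X)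

/-- The Lefschetz class `𝕃`, the class of the affine line. -/
noncomputable def lefschetz : K0 k := k0Class (affineLine k)

end Grothendieck

/-! ### Blow-ups and L-links -/

/-- The closed subscheme with ideal sheaf `I` is an effective Cartier divisor: locally, `I` is
generated by one nonzerodivisor. -/
def IsEffectiveCartier {S : Scheme.{u}} (I : S.IdealSheafData) : Prop :=
  ∀ s : S, ∃ U : S.affineOpens, s ∈ U.1 ∧
    ∃ f ∈ nonZeroDivisors Γ(S, U.1), I.ideal U = Ideal.span {f}

/-- `p : B ⟶ S` is the blow-up of `S` in the closed subscheme with ideal sheaf `I`: the inverse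
image of that subscheme in `B` is an effective Cartier divisor, and `p` is universal for this. -/
structure IsBlowUp {B S : Scheme.{u}} (p : B ⟶ S) (I : S.IdealSheafData) : Prop where
  cartier : IsEffectiveCartier (I.comap p)
  existsUnique_lift : ∀ {W : Scheme.{u}} (g : W ⟶ S), IsEffectiveCartier (I.comap g) →
    ∃! h : W ⟶ B, h ≫ p = g

section LLink

variable (k : Type u) [Field k]

/-- An L-link over `k`, with centers `X ⊂ 𝒳` and `Y ⊂ 𝒳'`. -/
structure LLink where
  /-- The center of the first blow-up. -/
  X : Sch k
  /-- The center of the second blow-up. -/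
  Y : Sch k
  /-- The source of the link. -/
  𝒳 : Sch k
  /-- The target of the link. -/
  𝒳' : Sch k
  /-- The common blow-up. -/
  T : Sch k
  [isVariety_X : IsVariety X]
  [isVariety_Y : IsVariety Y]
  [isVariety_source : IsVariety 𝒳]
  [isVariety_target : IsVariety 𝒳']
  geometricallyReduced_X : GeometricallyReduced X.hom
  geometricallyReduced_Y : GeometricallyReduced Y.hom
  /-- The inclusion of the first center. -/
  i : X ⟶ 𝒳
  /-- The inclusion of the second center. -/
  j : Y ⟶ 𝒳'
  isClosedImmersion_i : IsClosedImmersion i.left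
  isClosedImmersion_j : IsClosedImmersion j.left
  /-- The blow-up morphism with center `X`. -/
  p : T ⟶ 𝒳
  /-- The blow-up morphism with center `Y`. -/
  q : T ⟶ 𝒳'
  isBlowUp_p : IsBlowUp p.left i.left.ker
  isBlowUp_q : IsBlowUp q.left j.left.ker
  /-- The birational map of the link. -/
  ψ : BirMap 𝒳 𝒳'
  /-- The triangle commutes: `ψ ∘ p = q` wherever a representative of `ψ` is defined. -/
  comm : ∃ f : OverPartialIso 𝒳 𝒳', Quotient.mk _ f = ψ ∧
    p.left ∣_ f.1.source ≫ f.1.iso.hom ≫ f.1.target.ι = (p.left ⁻¹ᵁ f.1.source).ι ≫ q.left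
  smooth_source : SmoothInCodimOne 𝒳
  smooth_target : SmoothInCodimOne 𝒳'
  class_eq : k0Class 𝒳 = k0Class 𝒳'
  stronglyBirational : StronglyBirational 𝒳 𝒳'
  irreducible_p : IsIrreducible (p.left ⁻¹' Set.range i.left)
  irreducible_q : IsIrreducible (q.left ⁻¹' Set.range j.left)

attribute [instance] LLink.isVariety_X LLink.isVariety_Y LLink.isVariety_source
  LLink.isVariety_target

variable {k}

/-- The link is smooth: `X`, `Y`, `𝒳`, `𝒳'` and `T` are smooth over `k`. -/
structure LLink.IsSmooth (L : LLink k) : Prop where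
  X : Smooth L.X.hom
  Y : Smooth L.Y.hom
  source : Smooth L.𝒳.hom
  target : Smooth L.𝒳'.hom
  T : Smooth L.T.hom

end LLink

end Motivic

open Motivic

/-! Everything rests on the local shape of a blow-up `T → S` along `X` near a point where `X` and
`S` are both smooth. There `X` is cut out by a quasi-regular sequence `f`
(`exists_quasiRegular_frame`), whose length is the codimension `m`. The part of `T` above such a
neighbourhood is covered by the spectra of the rings `R[f_j / f_i]` (`IsBlowUp.exists_chart`), and
quasi-regularity is what makes such a ring modulo `f_i` a polynomial ring in `m - 1` variables over
the coordinate ring of `X` (`blowUpChart.exists_fibre_hom`). So the exceptional divisor is, locally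
on `X`, a product with `ℙ^(m-1)`, while the blow-up is an isomorphism off the center.

For a smooth link, cutting the exceptional divisor into affine cells gives `[T] = [S] - [X] +
[ℙ^(m-1)][X] = [S] + 𝕃[ℙ^(m-2)][X]` (`IsBlowUp.k0Class_add`). Comparing the two expressions for
`[T]`, with `[𝒳] = [𝒳']`, is the first claim.

The invariant `c` is additive under composition (`BirMap.c_comp`) and changes sign under inversion,
so composing with the inverse of a map with `c = 0` does not affect it. Additivity comes from
`BirMap.c_eq_of_subset`: the exceptional divisors may be enlarged by divisors that the map matches
with each other, since matched divisors have the same birational class and cancel.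

To compute `c(ψ)` (`LLink.c_eq`), let `e`, `e'` be the generic points of the exceptional divisors of
`p` and `q`. Since both codimensions are at least two, a codimension-one point of `𝒳` or `𝒳'` avoids
the center and so comes from a codimension-one point of `T`. Where the latter is neither `e` nor
`e'`, `ψ` matches its two images. If `e ≠ e'`, only `q(e)` and `p(e')` remain, with the classes of
`ℙ^(m-1) × X` and `ℙ^(m'-1) × Y`; if `e = e'`, nothing remains and these two classes agree. The
local picture is needed only at the generic points of the centers, where geometric reducedness gives
smoothness through separable generation (`smoothAt_genericPoint`). If `c(ψ) = 0`, the two basis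
elements coincide, so the products are birational and the centers stably birational. -/

namespace Motivic

/-! ### Quasi-regular sequences from formal smoothness -/

section QuasiRegular

open MvPolynomial

/-- A family `f` is quasi-regular: a form of degree `N` over `R` whose value at `f` lies in
`(f)^(N+1)` has all its coefficients in `(f)`. -/
def IsQuasiRegular {σ R : Type*} [CommRing R] (f : σ → R) : Prop :=
  ∀ (N : ℕ) (F : MvPolynomial σ R), F.IsHomogeneous N →
    eval f F ∈ Ideal.span (Set.range f) ^ (N + 1) → ∀ s, F.coeff s ∈ Ideal.span (Set.range f)

/-- A polynomial is congruent to its linear part modulo the square of the ideal of variables. -/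
lemma exists_sub_linear_mem_idealOfVars_sq {σ A : Type*} [CommRing A] [Fintype σ]
    (p : MvPolynomial σ A) :
    ∃ a : σ → A, p - (C (constantCoeff p) + ∑ i, C (a i) * X i) ∈ idealOfVars σ A ^ 2 := by
  classical
  have h1 : p - C (constantCoeff p) ∈ idealOfVars σ A ^ 1 := by
    rw [mem_pow_idealOfVars_iff']
    intro x hx
    have : x = 0 := by
      have := Nat.lt_one_iff.mp hx
      exact (Finsupp.degree_eq_zero_iff x).mp this
    subst this
    simp [constantCoeff_eq]
  rw [pow_one, idealOfVars, Ideal.mem_span_range_iff_exists_fun] at h1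
  obtain ⟨c, hc⟩ := h1
  refine ⟨fun i => constantCoeff (c i), ?_⟩
  rw [← sub_sub, ← hc, ← Finset.sum_sub_distrib]
  refine Ideal.sum_mem _ fun i _ => ?_
  rw [← sub_mul, pow_two]
  refine Ideal.mul_mem_mul ?_ (Ideal.subset_span ⟨i, rfl⟩)
  rw [← pow_one (idealOfVars σ A), mem_pow_idealOfVars_iff']
  intro x hx
  have : x = 0 := (Finsupp.degree_eq_zero_iff x).mp (Nat.lt_one_iff.mp hx)
  subst this
  simp [constantCoeff_eq]

lemma prod_pow_mem_pow_degree {σ Q : Type*} [CommRing Q] [Fintype σ] (M : Ideal Q) {z : σ → Q}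
    (hz : ∀ i, z i ∈ M) (t : σ →₀ ℕ) : ∏ i, z i ^ t i ∈ M ^ t.degree := by
  rw [Finsupp.degree_eq_sum, ← Finset.prod_pow_eq_pow_sum]
  exact Ideal.prod_mem_prod fun i _ => Ideal.pow_mem_pow (hz i) _

lemma pow_sub_pow_mem {Q : Type*} [CommRing Q] (M : Ideal Q) {y z : Q}
    (hz : z ∈ M) (h : y - z ∈ M ^ 2) (n : ℕ) : y ^ n - z ^ n ∈ M ^ (n + 1) := by
  have hy : y ∈ M := by
    rw [← sub_add_cancel y z]
    exact M.add_mem (Ideal.pow_le_self two_ne_zero h) hz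
  induction n with
  | zero => simp
  | succ n ih =>
    have : y ^ (n + 1) - z ^ (n + 1) = (y ^ n - z ^ n) * y + z ^ n * (y - z) := by ring
    rw [this]
    refine Ideal.add_mem _ ?_ ?_
    · rw [pow_succ M]; exact Ideal.mul_mem_mul ih hy
    · rw [add_assoc, pow_add]; exact Ideal.mul_mem_mul (Ideal.pow_mem_pow hz n) h

/-- A monomial of degree `d` changes only in order `d + 1` when its arguments move by second-order
terms: replace the factors one at a time. -/
lemma prod_pow_sub_prod_pow_mem {σ Q : Type*} [CommRing Q] [Fintype σ] (M : Ideal Q) {y z : σ → Q}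
    (hz : ∀ i, z i ∈ M) (h : ∀ i, y i - z i ∈ M ^ 2) (t : σ →₀ ℕ) :
    (∏ i, y i ^ t i) - ∏ i, z i ^ t i ∈ M ^ (t.degree + 1) := by
  classical
  have hy : ∀ i, y i ∈ M := fun i => by
    rw [← sub_add_cancel (y i) (z i)]
    exact M.add_mem (Ideal.pow_le_self two_ne_zero (h i)) (hz i)
  induction t using Finsupp.induction_linear with
  | zero => simp
  | single i n =>
    have e1 : ∀ y : σ → Q, ∏ j, y j ^ (Finsupp.single i n) j = y i ^ n := by
      intro y
      rw [Finset.prod_eq_single i] <;> simp +contextual [eq_comm]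
    rw [e1, e1, Finsupp.degree_single]
    exact pow_sub_pow_mem M (hz i) (h i) n
  | add a b ha hb =>
    have e1 : ∀ y : σ → Q, ∏ j, y j ^ (a + b) j = (∏ j, y j ^ a j) * ∏ j, y j ^ b j := by
      intro y
      simp [pow_add, Finset.prod_mul_distrib]
    have : (∏ i, y i ^ (a + b) i) - ∏ i, z i ^ (a + b) i =
        ((∏ i, y i ^ a i) - ∏ i, z i ^ a i) * (∏ i, y i ^ b i) +
        (∏ i, z i ^ a i) * ((∏ i, y i ^ b i) - ∏ i, z i ^ b i) := by
      rw [e1, e1]; ring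
    rw [this, map_add]
    refine Ideal.add_mem _ ?_ ?_
    · rw [show a.degree + b.degree + 1 = (a.degree + 1) + b.degree by ring, pow_add]
      exact Ideal.mul_mem_mul ha (prod_pow_mem_pow_degree M hy b)
    · rw [add_assoc, pow_add]
      exact Ideal.mul_mem_mul (prod_pow_mem_pow_degree M hz a) hb

variable {k R A σ : Type*} [CommRing k] [CommRing R] [CommRing A] [Algebra k R] [Algebra k A]

/-- With `I = (f)`, formal smoothness of `A` splits `R / I² → A`, and so yields a surjection `A[X] →
R / I²`, `X_i ↦ f_i`, whose kernel is the square of the ideal of variables because the `f_i` are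
independent in `I / I²`. Formal smoothness of `R` lifts `R → R / I²` to a truncation of `A[X]`. The
lift sends `f_i` to `X_i` up to second order, so it sends `F(f)` to the reduction of the form `F` up
to terms of higher degree; when `F(f) ∈ I^(N+1)`, that reduction must vanish. -/
lemma isQuasiRegular_of_formallySmooth [Fintype σ] [Algebra.FormallySmooth k R]
    [Algebra.FormallySmooth k A] (φ : R →ₐ[k] A) (hφ : Function.Surjective φ) (f : σ → R)
    (hker : RingHom.ker φ = Ideal.span (Set.range f))
    (hind : ∀ a : σ → R, ∑ i, a i * f i ∈ Ideal.span (Set.range f) ^ 2 →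
      ∀ i, a i ∈ Ideal.span (Set.range f)) : IsQuasiRegular f := by
  classical
  set I := Ideal.span (Set.range f) with hI
  have hker' : RingHom.ker φ.toRingHom = I := hker
  have mem_I : ∀ x, x ∈ I ↔ φ x = 0 := fun x => by rw [← hker]; rfl
  have hfI : ∀ i, f i ∈ I := fun i => Ideal.subset_span ⟨i, rfl⟩
  -- A multiplicative section of `R / I² → A`.
  obtain ⟨g, hg⟩ := (Algebra.FormallySmooth.iff_split_surjection φ hφ).mp inferInstance
  let J : Ideal R := RingHom.ker φ.toRingHom ^ 2
  have hJ : J = I ^ 2 := by simp only [J, hker']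
  have hmk : ∀ x y : R, Ideal.Quotient.mk J x = Ideal.Quotient.mk J y ↔ x - y ∈ I ^ 2 := by
    intro x y; rw [← hJ]; exact Ideal.Quotient.eq
  have hsec : ∀ (a : A) (x : R), Ideal.Quotient.mk J x = g a → φ x = a := by
    intro a x hx
    have := DFunLike.congr_fun hg a
    simp only [AlgHom.comp_apply, AlgHom.id_apply] at this
    rw [← this, ← hx]
    rfl
  let h : MvPolynomial σ A →ₐ[k] R ⧸ J :=
    { eval₂Hom (g : A →+* R ⧸ J) (fun i => Ideal.Quotient.mk J (f i)) with
      commutes' := fun r => by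
        rw [MvPolynomial.algebraMap_apply]
        exact (eval₂Hom_C _ _ _).trans (g.commutes r) }
  have hC : ∀ a, h (C a) = g a := fun a => eval₂Hom_C _ _ _
  have hX : ∀ i, h (X i) = Ideal.Quotient.mk J (f i) := fun i => eval₂Hom_X' _ _ _
  have hconst : ∀ (p : MvPolynomial σ A) (x : R), h p = Ideal.Quotient.mk J x →
      φ x = constantCoeff p := by
    intro p x hp
    have e : (φ.kerSquareLift.comp h).toRingHom = constantCoeff := by
      refine MvPolynomial.ringHom_ext ?_ ?_
      · intro a
        change φ.kerSquareLift (h (C a)) = _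
        rw [hC, constantCoeff_C]
        exact DFunLike.congr_fun hg a
      · intro i
        change φ.kerSquareLift (h (X i)) = _
        rw [hX, constantCoeff_X]
        exact (mem_I _).mp (hfI i)
    rw [← e]
    change _ = φ.kerSquareLift (h p)
    rw [hp]; rfl
  have hsq : ∀ p ∈ idealOfVars σ A ^ 2, h p = 0 := by
    intro p hp
    have h0 : (idealOfVars σ A).map (h : MvPolynomial σ A →+* R ⧸ J) ≤ I.map (Ideal.Quotient.mk J) := by
      rw [idealOfVars, Ideal.map_span, Ideal.span_le]
      rintro _ ⟨_, ⟨i, rfl⟩, rfl⟩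
      exact (hX i).symm ▸ Ideal.mem_map_of_mem _ (hfI i)
    have h1 := Ideal.mem_map_of_mem (h : MvPolynomial σ A →+* R ⧸ J) hp
    rw [Ideal.map_pow] at h1
    have h2 := Ideal.pow_right_mono h0 2 h1
    rw [← Ideal.map_pow, ← hJ, Ideal.map_quotient_self] at h2
    exact h2
  -- The converse of `hsq`. This is the only place where independence in `I / I²` enters: it kills
  -- the linear part of `p`.
  have hlin : ∀ (p : MvPolynomial σ A), h p = 0 → p ∈ idealOfVars σ A ^ 2 := by
    intro p hp
    obtain ⟨a, ha⟩ := exists_sub_linear_mem_idealOfVars_sq p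
    have hc : constantCoeff p = 0 := by rw [← hconst p 0 (by simpa using hp), map_zero]
    have := hsq _ ha
    rw [hc, C_0, zero_add] at ha
    rw [hc, C_0, zero_add, map_sub, hp, zero_sub, neg_eq_zero, map_sum] at this
    choose b hb using fun i => Ideal.Quotient.mk_surjective (I := J) (g (a i))
    have hb' : Ideal.Quotient.mk J (∑ i, b i * f i) = Ideal.Quotient.mk J 0 := by
      rw [map_zero, ← this, map_sum]
      refine Finset.sum_congr rfl fun i _ => ?_
      rw [map_mul, map_mul, hC, hX, hb]
    rw [hmk, sub_zero] at hb'
    have ha0 : ∀ i, a i = 0 := fun i => by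
      rw [← hsec (a i) (b i) (hb i)]; exact (mem_I _).mp (hind b hb' i)
    simpa [ha0] using ha
  have hsurj : Function.Surjective h := by
    intro y
    obtain ⟨x, rfl⟩ := Ideal.Quotient.mk_surjective y
    obtain ⟨z, hz⟩ := Ideal.Quotient.mk_surjective (I := J) (g (φ x))
    have hxz : x - z ∈ I := by rw [mem_I, map_sub, hsec _ _ hz, sub_self]
    obtain ⟨c, hc⟩ := Ideal.mem_span_range_iff_exists_fun.mp hxz
    refine ⟨C (φ x) + ∑ i, C (φ (c i)) * X i, ?_⟩
    rw [map_add, hC, ← hz, map_sum, eq_comm, ← sub_eq_iff_eq_add', ← map_sub, ← hc, map_sum]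
    refine Finset.sum_congr rfl fun i _ => ?_
    rw [map_mul h, hC, hX, map_mul]
    obtain ⟨w, hw⟩ := Ideal.Quotient.mk_surjective (I := J) (g (φ (c i)))
    rw [← hw, ← map_mul, ← map_mul, hmk, ← sub_mul, pow_two]
    refine Ideal.mul_mem_mul ?_ (hfI i)
    rw [mem_I, map_sub, hsec _ _ hw, sub_self]
  intro N F hF hFI s
  let 𝔪 := idealOfVars σ A
  -- The exponent is at least 2 even for `N = 0`, so that `h` factors through the quotient, and at
  -- least `N + 1`, so that degree `N` coefficients survive.
  let K : Ideal (MvPolynomial σ A) := 𝔪 ^ (N + 2)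
  have hK : ∀ p ∈ K, h p = 0 := fun p hp => hsq p (Ideal.pow_le_pow_right (by omega) hp)
  let h' : (MvPolynomial σ A ⧸ K) →ₐ[k] R ⧸ J := Ideal.Quotient.liftₐ K h hK
  have hh' : ∀ p, h' (Ideal.Quotient.mk K p) = h p := fun p => rfl
  have hs' : Function.Surjective h' := fun y => by
    obtain ⟨p, rfl⟩ := hsurj y
    exact ⟨Ideal.Quotient.mk K p, hh' p⟩
  have hn : IsNilpotent (RingHom.ker (h' : (MvPolynomial σ A ⧸ K) →+* R ⧸ J)) := by
    refine ⟨N + 2, ?_⟩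
    rw [Ideal.zero_eq_bot, eq_bot_iff]
    have : RingHom.ker (h' : (MvPolynomial σ A ⧸ K) →+* R ⧸ J) ≤ 𝔪.map (Ideal.Quotient.mk K) := by
      intro y hy
      obtain ⟨p, rfl⟩ := Ideal.Quotient.mk_surjective y
      exact Ideal.mem_map_of_mem _ (Ideal.pow_le_self (two_ne_zero) (hlin p hy))
    refine (Ideal.pow_right_mono this _).trans ?_
    rw [← Ideal.map_pow, Ideal.map_quotient_self]
  let G : R →ₐ[k] MvPolynomial σ A ⧸ K :=
    Algebra.FormallySmooth.liftOfSurjective (Ideal.Quotient.mkₐ k J) h' hs' hn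
  have hG : ∀ x, h' (G x) = Ideal.Quotient.mk J x := fun x =>
    Algebra.FormallySmooth.liftOfSurjective_apply _ _ _ _ x
  have hGc : ∀ x, G x - Ideal.Quotient.mk K (C (φ x)) ∈ 𝔪.map (Ideal.Quotient.mk K) := by
    intro x
    obtain ⟨p, hp⟩ := Ideal.Quotient.mk_surjective (G x)
    rw [← hp, ← map_sub]
    refine Ideal.mem_map_of_mem _ ?_
    rw [hconst p x (by rw [← hG, ← hp, hh']), ← pow_one 𝔪, mem_pow_idealOfVars_iff']
    intro x hx
    have : x = 0 := (Finsupp.degree_eq_zero_iff x).mp (Nat.lt_one_iff.mp hx)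
    subst this
    simp [constantCoeff_eq]
  have hGf : ∀ i, G (f i) - Ideal.Quotient.mk K (X i) ∈ (𝔪.map (Ideal.Quotient.mk K)) ^ 2 := by
    intro i
    obtain ⟨p, hp⟩ := Ideal.Quotient.mk_surjective (G (f i))
    rw [← hp, ← map_sub, ← Ideal.map_pow]
    refine Ideal.mem_map_of_mem _ (hlin _ ?_)
    rw [map_sub, hX, ← hG, ← hp, hh', sub_self]
  set M := 𝔪.map (Ideal.Quotient.mk K) with hM
  have hXM : ∀ i, Ideal.Quotient.mk K (X i) ∈ M := fun i =>
    Ideal.mem_map_of_mem _ (Ideal.subset_span ⟨i, rfl⟩)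
  have hGM : ∀ i, G (f i) ∈ M := fun i => by
    rw [← sub_add_cancel (G (f i)) (Ideal.Quotient.mk K (X i))]
    exact M.add_mem (Ideal.pow_le_self two_ne_zero (hGf i)) (hXM i)
  have hmon := prod_pow_sub_prod_pow_mem M hXM hGf
  have hGI : ∀ x ∈ I, G x ∈ M := fun x hx => by
    have := hGc x
    rwa [(mem_I x).mp hx, C_0, map_zero, sub_zero] at this
  have hGF : G (eval f F) ∈ M ^ (N + 1) := by
    have h1 : I.map (G : R →+* _) ≤ M := Ideal.map_le_iff_le_comap.mpr hGI
    have h2 := Ideal.mem_map_of_mem (G : R →+* MvPolynomial σ A ⧸ K) hFI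
    rw [Ideal.map_pow] at h2
    exact Ideal.pow_right_mono h1 _ h2
  -- Each term is off by at most order `N + 1`: its coefficient is correct up to first order, its
  -- monomial up to order `N + 1`.
  have hdiff : G (eval f F) - Ideal.Quotient.mk K (MvPolynomial.map (φ : R →+* A) F) ∈ M ^ (N + 1) := by
    have e2 : MvPolynomial.map (φ : R →+* A) F =
        ∑ t ∈ F.support, C (φ (F.coeff t)) * ∏ i, X i ^ t i := by
      conv_lhs => rw [F.as_sum]
      rw [map_sum]
      refine Finset.sum_congr rfl fun t _ => ?_
      rw [map_monomial, monomial_eq, Finsupp.prod_fintype _ _ (by simp)]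
      rfl
    rw [eval_eq', e2, map_sum, map_sum, ← Finset.sum_sub_distrib]
    refine Ideal.sum_mem _ fun t ht => ?_
    have hdeg : t.degree = N := by
      by_contra hne
      exact (mem_support_iff.mp ht) (hF.coeff_eq_zero hne)
    have hXt := hdeg ▸ prod_pow_mem_pow_degree M hXM t
    have : G (F.coeff t * ∏ i, f i ^ t i) - Ideal.Quotient.mk K (C (φ (F.coeff t)) * ∏ i, X i ^ t i) =
        G (F.coeff t) * ((∏ i, G (f i) ^ t i) - ∏ i, Ideal.Quotient.mk K (X i) ^ t i) +
        (G (F.coeff t) - Ideal.Quotient.mk K (C (φ (F.coeff t)))) *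
          ∏ i, Ideal.Quotient.mk K (X i) ^ t i := by
      simp only [map_mul, map_prod, map_pow]; ring
    rw [this]
    refine Ideal.add_mem _ (Ideal.mul_mem_left _ _ (hdeg ▸ hmon t)) ?_
    rw [pow_succ' M]
    exact Ideal.mul_mem_mul (hGc _) hXt
  have hfin : Ideal.Quotient.mk K (MvPolynomial.map (φ : R →+* A) F) ∈ M ^ (N + 1) := by
    have := Ideal.sub_mem _ hGF hdiff
    rwa [sub_sub_cancel] at this
  rw [hM, ← Ideal.map_pow, Ideal.mem_quotient_iff_mem (Ideal.pow_le_pow_right (by omega))] at hfin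
  rw [mem_I]
  by_cases hs : s.degree = N
  · have := (mem_pow_idealOfVars_iff' _ _).mp hfin s (by omega)
    rwa [coeff_map] at this
  · rw [hF.coeff_eq_zero hs, map_zero]

end QuasiRegular

end Motivic

namespace Motivic

/-! ### Height of a prime generated by a quasi-regular sequence -/

section Height

open MvPolynomial

/-- The class of `f i` is a nonzerodivisor in the associated graded ring. If `a = G(f)` with `G` of
degree `t < s`, the form `X_i G` takes a value in `(f)^(t+2)`, so the coefficients of `G`, which are
those of `X_i G`, lie in `(f)`; hence `a` gains one order. -/
lemma IsQuasiRegular.coeff_mem_of_X_mul {σ R : Type*} [CommRing R] {f : σ → R}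
    (hf : IsQuasiRegular f) (i : σ) {s t : ℕ} (hts : t ≤ s) {a : R}
    (ha : f i * a ∈ Ideal.span (Set.range f) ^ (s + 1)) : a ∈ Ideal.span (Set.range f) ^ t := by
  classical
  induction t with
  | zero => simp
  | succ t ih =>
    obtain ⟨G, hG, rfl⟩ := (Ideal.mem_span_pow_iff_exists_isHomogeneous f a).mp (ih (by omega))
    have h1 := hf (1 + t) (X i * G) ((isHomogeneous_X R i).mul hG) (by
      rw [eval_mul, eval_X]
      exact Ideal.pow_le_pow_right (by omega) ha)
    have h2 : ∀ u, G.coeff u ∈ Ideal.span (Set.range f) := fun u => by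
      have := h1 (Finsupp.single i 1 + u)
      rwa [coeff_X_mul] at this
    rw [G.as_sum, map_sum]
    refine Ideal.sum_mem _ fun u hu => ?_
    rw [eval_monomial, pow_succ']
    refine Ideal.mul_mem_mul (h2 u) ?_
    have hdeg : u.degree = t := by
      by_contra hne
      exact (mem_support_iff.mp hu) (hG.coeff_eq_zero hne)
    rw [← hdeg, Finsupp.prod, Finsupp.degree_apply, ← Finset.prod_pow_eq_pow_sum]
    exact Ideal.prod_mem_prod fun j _ => Ideal.pow_mem_pow (Ideal.subset_span (Set.mem_range_self j)) _

/-- An annihilated element lies in all powers of the ideal, hence vanishes by Krull's intersection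
theorem. -/
lemma IsQuasiRegular.isSMulRegular {σ R : Type*} [CommRing R] [IsLocalRing R] [IsNoetherianRing R]
    {f : σ → R} (hf : IsQuasiRegular f) (hI : Ideal.span (Set.range f) ≠ ⊤) (i : σ) :
    f i ∈ nonZeroDivisors R := by
  rw [mem_nonZeroDivisors_iff]
  suffices h : ∀ a, f i * a = 0 → a = 0 from
    And.intro (fun a ha => h a ha) (fun a ha => h a (by rwa [mul_comm]))
  intro a ha
  have : a ∈ (⨅ n : ℕ, Ideal.span (Set.range f) ^ n) := by
    rw [Ideal.mem_iInf]
    exact fun n => hf.coeff_mem_of_X_mul i le_rfl (by rw [ha]; exact zero_mem _)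
  rwa [Ideal.iInf_pow_eq_bot_of_isLocalRing _ hI] at this

lemma span_range_tail {R : Type*} [CommRing R] {n : ℕ} (f : Fin (n + 1) → R) :
    Ideal.span (Set.range fun i : Fin n => Ideal.Quotient.mk (Ideal.span {f 0}) (f i.succ)) =
      (Ideal.span (Set.range f)).map (Ideal.Quotient.mk (Ideal.span {f 0})) := by
  apply le_antisymm
  · rw [Ideal.span_le]
    rintro _ ⟨i, rfl⟩
    exact Ideal.mem_map_of_mem _ (Ideal.subset_span ⟨i.succ, rfl⟩)
  · rw [Ideal.map_span, Ideal.span_le]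
    rintro _ ⟨_, ⟨i, rfl⟩, rfl⟩
    refine Fin.cases ?_ (fun i => ?_) i
    · rw [Ideal.Quotient.eq_zero_iff_mem.mpr (Ideal.mem_span_singleton_self _)]
      exact zero_mem _
    · exact Ideal.subset_span ⟨i, rfl⟩

/-- Lift a form in the tail to `F` over `R`. Its value is `f 0 * a` up to higher order, and the
graded nonzerodivisor property makes `a` itself the value of a form `G` of degree one less.
Quasi-regularity of `f` applies to `F - X_0 G`, whose coefficients at monomials free of `X_0` are
those of `F`. -/
lemma IsQuasiRegular.quotient_tail {R : Type*} [CommRing R] {n : ℕ} {f : Fin (n + 1) → R}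
    (hf : IsQuasiRegular f) :
    IsQuasiRegular (fun i : Fin n => Ideal.Quotient.mk (Ideal.span {f 0}) (f i.succ)) := by
  classical
  let x := f 0
  let I := Ideal.span (Set.range f)
  let π := Ideal.Quotient.mk (Ideal.span {x})
  have hxI : x ∈ I := Ideal.subset_span ⟨0, rfl⟩
  have hmap : Ideal.span (Set.range fun i : Fin n => π (f i.succ)) = I.map π := span_range_tail f
  have hker : ∀ {J : Ideal R} {y : R}, π y ∈ J.map π → ∃ a, y - x * a ∈ J := by
    intro J y hy
    obtain ⟨z, hz, hzy⟩ := (Ideal.mem_map_iff_of_surjective π Ideal.Quotient.mk_surjective).mp hy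
    obtain ⟨a, ha⟩ := Ideal.mem_span_singleton'.mp (Ideal.Quotient.eq.mp hzy.symm)
    refine ⟨a, ?_⟩
    rw [mul_comm, ha]
    simpa using hz
  intro N F' hF' hmem s
  change _ ∈ Ideal.span (Set.range fun i : Fin n => π (f i.succ)) ^ (N + 1) at hmem
  change _ ∈ Ideal.span (Set.range fun i : Fin n => π (f i.succ))
  rw [hmap] at hmem ⊢
  obtain ⟨F0, hF0⟩ := MvPolynomial.map_surjective π Ideal.Quotient.mk_surjective F'
  let F := homogeneousComponent N F0
  have hF : F.IsHomogeneous N := homogeneousComponent_isHomogeneous N F0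
  have hFF' : MvPolynomial.map π F = F' := by
    ext t
    rw [coeff_map, coeff_homogeneousComponent]
    split_ifs with h
    · rw [← coeff_map, hF0]
    · rw [map_zero, hF'.coeff_eq_zero h]
  suffices F.coeff s ∈ I by
    rw [← hFF', coeff_map]; exact Ideal.mem_map_of_mem _ this
  have hev : eval (fun i : Fin n => π (f i.succ)) F' = π (eval (fun i => f i.succ) F) := by
    rw [← hFF', MvPolynomial.eval_map, ← MvPolynomial.coe_eval₂Hom, MvPolynomial.eval, map_eval₂Hom]
    simp only [RingHom.comp_id]
  rw [hev, ← Ideal.map_pow] at hmem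
  obtain ⟨a, ha⟩ := hker hmem
  cases N with
  | zero =>
    obtain ⟨c, hc⟩ : ∃ c, F = C c := ⟨F.coeff 0, (totalDegree_eq_zero_iff_eq_C.mp
      (Nat.le_zero.mp hF.totalDegree_le))⟩
    rw [hc, coeff_C]
    split_ifs
    · rw [hc, eval_C, zero_add, pow_one] at ha
      simpa using I.add_mem ha (I.mul_mem_right a hxI)
    · exact zero_mem _
  | succ N =>
    have hFmem : eval (fun i => f i.succ) F ∈ I ^ (N + 1) := by
      have h1 := (Ideal.mem_span_pow_iff_exists_isHomogeneous (fun i : Fin n => f i.succ) _).mpr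
        ⟨F, hF, rfl⟩
      refine Ideal.pow_right_mono (Ideal.span_mono ?_) _ h1
      rintro _ ⟨i, rfl⟩
      exact ⟨i.succ, rfl⟩
    have hxa : x * a ∈ I ^ (N + 1) := by
      have := Ideal.sub_mem _ hFmem (Ideal.pow_le_pow_right (Nat.le_succ _) ha)
      rwa [sub_sub_cancel] at this
    obtain ⟨G, hG, rfl⟩ := (Ideal.mem_span_pow_iff_exists_isHomogeneous f a).mp
      (hf.coeff_mem_of_X_mul 0 le_rfl hxa)
    have hH : (rename Fin.succ F - X 0 * G).IsHomogeneous (N + 1) :=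
      ((hF.rename_isHomogeneous).sub (add_comm 1 N ▸ (isHomogeneous_X R (0 : Fin (n + 1))).mul hG))
    have := hf (N + 1) _ hH (by
      rw [eval_sub, eval_rename, eval_mul, eval_X]
      exact ha) (s.mapDomain Fin.succ)
    rw [coeff_sub, coeff_rename_mapDomain _ (Fin.succ_injective n), coeff_X_mul',
      if_neg, sub_zero] at this
    · exact this
    · rw [Finsupp.mem_support_iff, not_not]
      exact Finsupp.mapDomain_of_notMem_range _ _ (by simp)

/-- Dividing by the nonzerodivisor `f 0` lowers the dimension by one and leaves a quasi-regular tail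
generating the maximal ideal. -/
lemma ringKrullDim_eq_of_isQuasiRegular {n : ℕ} : ∀ {R : Type u} [CommRing R] [IsLocalRing R]
    [IsNoetherianRing R] {f : Fin n → R}, IsQuasiRegular f →
    IsLocalRing.maximalIdeal R = Ideal.span (Set.range f) → ringKrullDim R = n := by
  induction n with
  | zero =>
    intro R _ _ _ f hf hm
    rw [Set.range_eq_empty, Ideal.span_empty] at hm
    exact ringKrullDim_eq_zero_of_isField (IsLocalRing.isField_iff_maximalIdeal_eq.mpr hm)
  | succ n ih =>
    intro R _ _ _ f hf hm
    have hx : f 0 ∈ IsLocalRing.maximalIdeal R := hm ▸ Ideal.subset_span ⟨0, rfl⟩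
    have hreg := hf.isSMulRegular (hm ▸ (IsLocalRing.maximalIdeal.isMaximal R).ne_top) 0
    have hne : Ideal.span {f 0} ≠ ⊤ := by
      rw [Ne, Ideal.span_singleton_eq_top]
      exact hx
    have : Nontrivial (R ⧸ Ideal.span {f 0}) := Ideal.Quotient.nontrivial_iff.mpr hne
    have hsurj := Ideal.Quotient.mk_surjective (I := Ideal.span {f 0})
    have : IsLocalRing (R ⧸ Ideal.span {f 0}) := IsLocalRing.of_surjective' _ hsurj
    rw [← ringKrullDim_quotient_span_singleton_succ_eq_ringKrullDim_of_mem_nonZeroDivisors hreg hx,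
      ih hf.quotient_tail, Nat.cast_succ]
    rw [← IsLocalRing.map_maximalIdeal_of_surjective _ hsurj, hm, span_range_tail]

/-- Multiplying by a common denominator of the coefficients, and by a further one witnessing
membership of the value, brings the form back to `R`. -/
lemma IsQuasiRegular.isLocalization {σ R S : Type*} [CommRing R] [CommRing S] [Algebra R S]
    (M : Submonoid R) [IsLocalization M S] {f : σ → R} (hf : IsQuasiRegular f) :
    IsQuasiRegular (algebraMap R S ∘ f) := by
  intro N F hF hmem s
  rw [Set.range_comp, ← Ideal.map_span] at hmem ⊢
  obtain ⟨b, hb⟩ := IsLocalization.exist_integer_multiples M F.support F.coeff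
  choose c hc using hb
  classical
  let G : MvPolynomial σ R := ∑ t ∈ F.support.attach, monomial t.1 (c t.1 t.2)
  have hGF : MvPolynomial.map (algebraMap R S) G = C (algebraMap R S b) * F := by
    conv_rhs => rw [F.as_sum]
    rw [map_sum, Finset.mul_sum, ← Finset.sum_attach F.support]
    refine Finset.sum_congr rfl fun t _ => ?_
    rw [map_monomial, hc, C_mul_monomial, Algebra.smul_def]
  have hG : G.IsHomogeneous N := by
    refine IsHomogeneous.sum _ _ _ fun t _ => isHomogeneous_monomial _ ?_
    by_contra hne
    exact (mem_support_iff.mp t.2) (hF.coeff_eq_zero hne)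
  have hev : algebraMap R S (MvPolynomial.eval f G) =
      algebraMap R S b * MvPolynomial.eval (algebraMap R S ∘ f) F := by
    rw [← eval_C (f := algebraMap R S ∘ f) (algebraMap R S b), ← eval_mul, ← hGF, MvPolynomial.eval_map]
    exact MvPolynomial.eval₂_comp_left (algebraMap R S) (RingHom.id R) f G
  have h1 : algebraMap R S (MvPolynomial.eval f G) ∈
      (Ideal.span (Set.range f) ^ (N + 1)).map (algebraMap R S) := by
    rw [hev, Ideal.map_pow]
    exact Ideal.mul_mem_left _ _ hmem
  obtain ⟨d, hd, hdG⟩ := (IsLocalization.algebraMap_mem_map_algebraMap_iff M S _ _).mp h1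
  have h2 := hf N (C d * G) (by simpa using (isHomogeneous_C σ d).mul hG)
    (by rw [eval_mul, eval_C]; exact hdG) s
  rw [coeff_C_mul] at h2
  have h3 := Ideal.mem_map_of_mem (algebraMap R S) h2
  rw [map_mul, ← coeff_map, hGF, coeff_C_mul, ← mul_assoc, ← map_mul] at h3
  exact (Ideal.unit_mul_mem_iff_mem _ (IsLocalization.map_units S ((⟨d, hd⟩ : M) * b))).mp h3

lemma height_eq_of_isQuasiRegular {n : ℕ} {R : Type u} [CommRing R] [IsNoetherianRing R]
    {f : Fin n → R} (hf : IsQuasiRegular f) (hp : (Ideal.span (Set.range f)).IsPrime) :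
    (Ideal.span (Set.range f)).height = n := by
  have h := IsLocalization.AtPrime.ringKrullDim_eq_height (Ideal.span (Set.range f))
    (Localization.AtPrime (Ideal.span (Set.range f)))
  rw [ringKrullDim_eq_of_isQuasiRegular
    (hf.isLocalization (S := Localization.AtPrime (Ideal.span (Set.range f)))
      (Ideal.span (Set.range f)).primeCompl) (by
      rw [← Localization.AtPrime.map_eq_maximalIdeal, Set.range_comp, ← Ideal.map_span])] at h
  exact_mod_cast h.symm

end Height

end Motivic

namespace Motivic

/-! ### Local frames of the conormal module -/

section Frame

variable {k R A : Type u} [CommRing k] [CommRing R] [CommRing A] [Algebra k R] [Algebra k A]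

/-- The product of the multipliers for finitely many generators works for all elements, and
primality keeps it outside `P`. -/
lemma exists_notMem_forall_smul_mem {R M : Type*} [CommRing R] [AddCommGroup M] [Module R M]
    (P : Ideal R) [hP : P.IsPrime] {N N' : Submodule R M} (hN : N.FG)
    (h : ∀ y ∈ N, ∃ t ∉ P, t • y ∈ N') : ∃ t ∉ P, ∀ y ∈ N, t • y ∈ N' := by
  classical
  obtain ⟨s, rfl⟩ := hN
  choose! t ht htN using fun y (hy : y ∈ s) => h y (Submodule.subset_span hy)
  refine ⟨∏ y ∈ s, t y, fun hmem => ?_, fun y hy => ?_⟩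
  · obtain ⟨y, hy, hyt⟩ := hP.prod_mem_iff.mp hmem
    exact ht y hy hyt
  · induction hy using Submodule.span_induction with
    | mem y hy =>
      rw [← Finset.prod_erase_mul _ _ hy, mul_smul]
      exact N'.smul_mem _ (htN y hy)
    | zero => simp
    | add y z _ _ hy hz => rw [smul_add]; exact N'.add_mem hy hz
    | smul a y _ hy => rw [smul_comm]; exact N'.smul_mem _ hy

/-- For `I = ker φ`, smoothness of both algebras makes `I / I²` a direct summand of a projective
module, hence finite projective, hence free at `P`. A basis lifts to elements `f` of `I`; they
generate `I` at `P` by Nakayama. Finite generation allows a single `h ∉ P` to clear the denominators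
both in generation and in independence modulo `I²`. -/
lemma exists_conormal_frame [IsNoetherianRing R] [Algebra.FormallySmooth k R]
    [Algebra.FormallySmooth k A] (φ : R →ₐ[k] A) (hφ : Function.Surjective φ)
    (P : Ideal R) [P.IsPrime] (hP : RingHom.ker φ ≤ P) :
    ∃ h ∉ P, ∃ (n : ℕ) (f : Fin n → R), (∀ i, f i ∈ RingHom.ker φ) ∧
      (∀ y ∈ RingHom.ker φ, h * y ∈ Ideal.span (Set.range f)) ∧
      ∀ a : Fin n → R, ∑ i, a i * f i ∈ RingHom.ker φ ^ 2 → ∀ i, h * a i ∈ RingHom.ker φ := by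
  classical
  let : Algebra R A := φ.toRingHom.toAlgebra
  have : IsScalarTower k R A := IsScalarTower.of_algebraMap_eq fun x => (φ.commutes x).symm
  let E : Algebra.Extension k A :=
    { Ring := R, σ := _, algebraMap_σ := Function.surjInv_eq hφ }
  have : Algebra.FormallySmooth k E.Ring := ‹Algebra.FormallySmooth k R›
  have hsurj : Function.Surjective (algebraMap R A) := hφ
  have : IsNoetherianRing A := isNoetherianRing_of_surjective R A φ.toRingHom hφ
  -- The Jacobian criterion: the map from `I / I²` to the differentials is split injective.
  obtain ⟨l, hl⟩ := E.formallySmooth_iff_split_injection.mp ‹Algebra.FormallySmooth k A›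
  have : Module.Projective E.Ring (Ω[E.Ring⁄k]) := inferInstance
  have : Module.Projective A E.CotangentSpace := inferInstance
  have : Module.Projective A E.Cotangent := Module.Projective.of_split _ l hl
  let I : Ideal R := RingHom.ker φ
  have : IsNoetherianRing E.Ring := ‹IsNoetherianRing R›
  have mk0 : ∀ x : E.ker, Algebra.Extension.Cotangent.mk x = 0 ↔ (x : R) ∈ I ^ 2 := fun x =>
    Algebra.Extension.Cotangent.mk_eq_zero_iff x
  have : Module.Finite A E.Cotangent := by
    have : Module.Finite E.Ring E.Cotangent :=
      Module.Finite.of_surjective Algebra.Extension.Cotangent.mk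
        Algebra.Extension.Cotangent.mk_surjective
    exact Module.Finite.of_restrictScalars_finite E.Ring A E.Cotangent
  let Q : Ideal A := P.map φ.toRingHom
  have hcQ : ∀ x, φ x ∈ Q ↔ x ∈ P := fun x => by
    have := Ideal.comap_map_of_surjective φ.toRingHom hφ P
    change x ∈ Ideal.comap φ.toRingHom (P.map φ.toRingHom) ↔ _
    rw [this, sup_eq_left.mpr]
    exact hP
  have : Q.IsPrime := Ideal.map_isPrime_of_surjective hφ hP
  let B := Localization.AtPrime Q
  let mkM := LocalizedModule.mkLinearMap Q.primeCompl E.Cotangent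
  have : Module.Projective B (LocalizedModule Q.primeCompl E.Cotangent) :=
    Module.projective_of_isLocalizedModule Q.primeCompl mkM
  have : Module.Finite B (LocalizedModule Q.primeCompl E.Cotangent) :=
    Module.Finite.of_isLocalizedModule Q.primeCompl mkM
  have : Module.FinitePresentation B (LocalizedModule Q.primeCompl E.Cotangent) :=
    Module.finitePresentation_of_projective B _
  have hspan : Submodule.span B (Set.range mkM) = ⊤ := by
    have := span_eq_top_of_isLocalizedModule B Q.primeCompl mkM (v := Set.univ) (by simp)
    rwa [Set.image_univ] at this
  -- Over the local ring a basis can be selected from a spanning set, here from the images of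
  -- elements of `I / I²`, so that it lifts to `I` without denominators.
  obtain ⟨κ, a, b, hb⟩ := Module.exists_basis_of_span_of_flat mkM hspan
  have : Finite κ := Module.Finite.finite_basis b
  obtain ⟨n, ⟨e⟩⟩ := Finite.exists_equiv_fin κ
  choose g hg using fun i => Algebra.Extension.Cotangent.mk_surjective (a (e.symm i))
  let f : Fin n → R := fun i => (g i : R)
  have hfI : ∀ i, f i ∈ I := fun i => (g i).2
  let b' := b.reindex e
  have hb' : ∀ i, b' i = mkM (Algebra.Extension.Cotangent.mk (g i)) := fun i => by
    rw [hg, ← hb, Module.Basis.reindex_apply]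
  let J := Ideal.span (Set.range f)
  have hIP : I ≤ P := hP
  have hJI : J ≤ I := Ideal.span_le.mpr (by rintro _ ⟨i, rfl⟩; exact hfI i)
  let lc : (Fin n → R) → E.ker := fun d => ∑ i, (d i : E.Ring) • g i
  have hlc : ∀ d, (lc d : R) = ∑ i, d i * f i := fun d => by
    change ((∑ i, (d i : E.Ring) • g i : E.ker) : E.Ring) = _
    rw [AddSubmonoidClass.coe_finsetSum]
    rfl
  have hsm : ∀ (r : R) (x : E.ker), Algebra.Extension.Cotangent.mk ((r : E.Ring) • x) =
      φ r • Algebra.Extension.Cotangent.mk x := fun r x => by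
    rw [map_smul]
    exact (algebraMap_smul A (r : E.Ring) (Algebra.Extension.Cotangent.mk x)).symm
  have hmk : ∀ d, Algebra.Extension.Cotangent.mk (lc d) =
      ∑ i, φ (d i) • Algebra.Extension.Cotangent.mk (g i) := fun d => by
    simp only [lc, map_sum, hsm]
  have hM : ∀ d, mkM (Algebra.Extension.Cotangent.mk (lc d)) =
      ∑ i, algebraMap A B (φ (d i)) • b' i := fun d => by
    rw [hmk, map_sum]
    refine Finset.sum_congr rfl fun i _ => ?_
    rw [map_smul, hb', algebraMap_smul]
  have hI : ∀ y ∈ I, ∃ t ∉ P, t • y ∈ J := by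
    have key : ∀ y ∈ I, ∃ t ∉ P, t * y ∈ J ⊔ I ^ 2 := by
      intro y hy
      let y' : E.ker := ⟨y, hy⟩
      obtain ⟨s, hs⟩ := IsLocalization.exist_integer_multiples_of_finite Q.primeCompl
        (fun i => b'.repr (mkM (Algebra.Extension.Cotangent.mk y')) i)
      choose d hd using hs
      obtain ⟨t, ht⟩ := hφ (s : A)
      choose d' hd' using fun i => hφ (d i)
      have h1 : mkM (φ t • Algebra.Extension.Cotangent.mk y') =
          mkM (Algebra.Extension.Cotangent.mk (lc d')) := by
        rw [hM, map_smul, ← b'.sum_repr (mkM (Algebra.Extension.Cotangent.mk y')),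
          Finset.smul_sum]
        refine Finset.sum_congr rfl fun i _ => ?_
        rw [hd', hd, ht, smul_assoc]
      obtain ⟨c, hc⟩ := IsLocalizedModule.exists_of_eq (S := Q.primeCompl) h1
      obtain ⟨t', ht'⟩ := hφ (c : A)
      refine ⟨t' * t, fun hmem => ?_, ?_⟩
      · rw [← hcQ, map_mul, ht, ht'] at hmem
        exact (Q.primeCompl.mul_mem c.2 s.2) hmem
      · have h2 : (t' • (t • y' - lc d') : E.ker).1 ∈ I ^ 2 := by
          rw [← mk0, hsm, map_sub, hsm, ht', smul_sub]
          exact sub_eq_zero.mpr hc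
        have h3 : t' * (t * y - ∑ i, d' i * f i) ∈ I ^ 2 := by
          rw [← hlc]; exact h2
        rw [show t' * t * y = t' * (∑ i, d' i * f i) + t' * (t * y - ∑ i, d' i * f i) by ring]
        refine Ideal.add_mem _ (Ideal.mem_sup_left (J.mul_mem_left _ (J.sum_mem fun i _ =>
          J.mul_mem_left _ (Ideal.subset_span ⟨i, rfl⟩)))) (Ideal.mem_sup_right h3)
    let RP := Localization.AtPrime P
    -- Nakayama at `P`, from `I ≤ J + I²` after localization.
    have hle : I.map (algebraMap R RP) ≤ J.map (algebraMap R RP) := by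
      refine Submodule.le_of_le_smul_of_le_jacobson_bot (I := I.map (algebraMap R RP))
        (IsNoetherian.noetherian _) ?_ ?_
      · rw [IsLocalRing.jacobson_eq_maximalIdeal _ bot_ne_top, ← Localization.AtPrime.map_eq_maximalIdeal]
        exact Ideal.map_mono hIP
      · rw [smul_eq_mul, ← pow_two, ← Ideal.map_pow]
        change _ ≤ J.map (algebraMap R RP) ⊔ (I ^ 2).map (algebraMap R RP)
        rw [← Ideal.map_sup, Ideal.map_le_iff_le_comap]
        intro y hy
        obtain ⟨t, ht, hty⟩ := key y hy
        exact (IsLocalization.algebraMap_mem_map_algebraMap_iff P.primeCompl RP _ _).mpr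
          ⟨t, ht, hty⟩
    intro y hy
    obtain ⟨t, ht, hty⟩ := (IsLocalization.algebraMap_mem_map_algebraMap_iff P.primeCompl RP _ _).mp
      (hle (Ideal.mem_map_of_mem _ hy))
    exact ⟨t, ht, hty⟩
  obtain ⟨h1, hh1, h1I⟩ := exists_notMem_forall_smul_mem P (IsNoetherian.noetherian I) hI
  -- The relations among the `f i` modulo `I²`; this module is finitely generated, so one multiplier
  -- `h2` serves for all of them.
  let K : Submodule R (Fin n → R) :=
    Submodule.comap (∑ i, (LinearMap.mulRight R (f i)) ∘ₗ LinearMap.proj i) (I ^ 2)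
  have hK : ∀ d, d ∈ K ↔ ∑ i, d i * f i ∈ I ^ 2 := fun d => by
    simp [K]
  obtain ⟨h2, hh2, h2K⟩ := exists_notMem_forall_smul_mem P (IsNoetherian.noetherian K)
    (N' := Submodule.pi Set.univ fun _ => I) (by
    intro d hd
    rw [hK, ← hlc, ← mk0] at hd
    have h1 := hM d
    rw [hd, map_zero] at h1
    have h2 : ∀ i, ∃ t ∉ P, t * d i ∈ I := by
      intro i
      have h3 := Fintype.linearIndependent_iff.mp b'.linearIndependent _ h1.symm i
      obtain ⟨c, hc⟩ := (IsLocalization.map_eq_zero_iff Q.primeCompl B _).mp h3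
      obtain ⟨t, ht⟩ := hφ (c : A)
      refine ⟨t, ?_, ?_⟩
      · rw [← hcQ, ht]
        exact c.2
      · rw [RingHom.mem_ker, map_mul, ht, hc]
    choose t ht hti using h2
    refine ⟨∏ i, t i, fun hmem => ?_, fun i _ => ?_⟩
    · obtain ⟨i, -, hi⟩ := (Ideal.IsPrime.prod_mem_iff (p := P)).mp hmem
      exact ht i hi
    · change (∏ i, t i) * d i ∈ I
      rw [← Finset.prod_erase_mul _ _ (Finset.mem_univ i), mul_assoc]
      exact I.mul_mem_left _ (hti i))
  refine ⟨h1 * h2, fun h => (Ideal.IsPrime.mem_or_mem ‹_› h).elim hh1 hh2, n, f, hfI,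
    fun y hy => ?_, fun d hd i => ?_⟩
  · rw [mul_comm h1, mul_assoc]
    exact J.mul_mem_left _ (h1I y hy)
  · rw [mul_assoc]
    exact I.mul_mem_left _ (h2K d ((hK d).mpr hd) i trivial)

/-- After inverting `h` the frame generates the ideal and is independent modulo its square.
Localization preserves formal smoothness, so `isQuasiRegular_of_formallySmooth` applies to the
localized surjection. -/
lemma isQuasiRegular_of_conormal_frame [IsNoetherianRing R] [Algebra.FormallySmooth k R]
    [Algebra.FormallySmooth k A] (φ : R →ₐ[k] A) (hφ : Function.Surjective φ) {h : R} {n : ℕ}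
    {f : Fin n → R} (hfI : ∀ i, f i ∈ RingHom.ker φ)
    (h1 : ∀ y ∈ RingHom.ker φ, h * y ∈ Ideal.span (Set.range f))
    (h2 : ∀ a : Fin n → R, ∑ i, a i * f i ∈ RingHom.ker φ ^ 2 → ∀ i, h * a i ∈ RingHom.ker φ)
    (S : Type u) [CommRing S] [Algebra R S] [IsLocalization.Away h S] :
    (RingHom.ker φ).map (algebraMap R S) = Ideal.span (Set.range (algebraMap R S ∘ f)) ∧
      IsQuasiRegular (algebraMap R S ∘ f) := by
  classical
  let I := RingHom.ker φ
  have hunit : IsUnit (algebraMap R S h) := IsLocalization.Away.algebraMap_isUnit h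
  have hspan : I.map (algebraMap R S) = Ideal.span (Set.range (algebraMap R S ∘ f)) := by
    apply le_antisymm
    · rw [Ideal.map_le_iff_le_comap]
      intro y hy
      have := Ideal.mem_map_of_mem (algebraMap R S) (h1 y hy)
      rw [map_mul, Ideal.unit_mul_mem_iff_mem _ hunit, Ideal.map_span, ← Set.range_comp] at this
      exact this
    · rw [Ideal.span_le]
      rintro _ ⟨i, rfl⟩
      exact Ideal.mem_map_of_mem _ (hfI i)
  refine ⟨hspan, ?_⟩
  let : Algebra k S := ((algebraMap R S).comp (algebraMap k R)).toAlgebra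
  have : IsScalarTower k R S := IsScalarTower.of_algebraMap_eq fun _ => rfl
  let A' := Localization.Away (φ h)
  have : Algebra.FormallySmooth R S := Algebra.FormallySmooth.of_isLocalization (Submonoid.powers h)
  have : Algebra.FormallySmooth k S := Algebra.FormallySmooth.comp k R S
  have : Algebra.FormallySmooth A A' :=
    Algebra.FormallySmooth.of_isLocalization (Submonoid.powers (φ h))
  have : Algebra.FormallySmooth k A' := Algebra.FormallySmooth.comp k A A'
  have hle : Submonoid.powers h ≤ (Submonoid.powers (φ h)).comap φ.toRingHom := by
    rw [Submonoid.powers_le]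
    exact Submonoid.mem_powers _
  let ψ₀ : S →+* A' := IsLocalization.map A' φ.toRingHom hle
  have hψ₀ : ∀ x, ψ₀ (algebraMap R S x) = algebraMap A A' (φ x) := IsLocalization.map_eq hle
  let ψ : S →ₐ[k] A' := ⟨ψ₀, fun x => by
    change ψ₀ (algebraMap R S (algebraMap k R x)) = _
    rw [hψ₀, φ.commutes]
    exact (IsScalarTower.algebraMap_apply k A A' x).symm⟩
  have hψ : Function.Surjective ψ := by
    intro y
    obtain ⟨a, ⟨_, m, rfl⟩, rfl⟩ := IsLocalization.exists_mk'_eq (Submonoid.powers (φ h)) y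
    obtain ⟨x, rfl⟩ := hφ a
    refine ⟨IsLocalization.mk' S x (⟨h ^ m, m, rfl⟩ : Submonoid.powers h), ?_⟩
    refine (IsLocalization.map_mk' hle _ _).trans ?_
    congr 1
    exact Subtype.ext (map_pow φ h m)
  have hmap : Submonoid.map φ.toRingHom (Submonoid.powers h) = Submonoid.powers (φ h) :=
    Submonoid.map_powers _ _
  have hker : RingHom.ker ψ = I.map (algebraMap R S) := by
    ext y
    constructor
    · intro hy
      obtain ⟨x, ⟨_, m, rfl⟩, rfl⟩ := IsLocalization.exists_mk'_eq (Submonoid.powers h) y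
      have h3 : ψ₀ (IsLocalization.mk' S x (⟨h ^ m, m, rfl⟩ : Submonoid.powers h)) = 0 := hy
      have h4 : algebraMap A A' (φ x) = 0 := by
        rw [← hψ₀, ← IsLocalization.mk'_spec S x (⟨h ^ m, m, rfl⟩ : Submonoid.powers h), map_mul,
          h3, zero_mul]
      obtain ⟨⟨_, c, rfl⟩, hc⟩ := (IsLocalization.map_eq_zero_iff (Submonoid.powers (φ h)) A' _).mp h4
      rw [IsLocalization.mk'_mem_map_algebraMap_iff (Submonoid.powers h) S]
      refine ⟨h ^ c, ⟨c, rfl⟩, ?_⟩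
      rw [RingHom.mem_ker, map_mul, map_pow]
      exact hc
    · intro hy
      have : I.map (algebraMap R S) ≤ RingHom.ker ψ := by
        rw [Ideal.map_le_iff_le_comap]
        intro x hx
        change ψ₀ (algebraMap R S x) = 0
        rw [hψ₀, RingHom.mem_ker.mp hx, map_zero]
      exact this hy
  refine isQuasiRegular_of_formallySmooth ψ hψ _ (hker.trans hspan) ?_
  rw [← hspan, ← Ideal.map_pow]
  intro a ha i
  obtain ⟨s, hs⟩ := IsLocalization.exist_integer_multiples_of_finite (Submonoid.powers h) a
  choose d hd using hs
  have h3 : algebraMap R S (∑ i, d i * f i) ∈ (I ^ 2).map (algebraMap R S) := by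
    rw [map_sum]
    have : ∑ i, algebraMap R S (d i * f i) = algebraMap R S s * ∑ i, a i * (algebraMap R S ∘ f) i := by
      rw [Finset.mul_sum]
      refine Finset.sum_congr rfl fun i _ => ?_
      rw [map_mul, hd, Algebra.smul_def, mul_assoc]
      rfl
    rw [this]
    exact Ideal.mul_mem_left _ _ ha
  obtain ⟨c, hc, hcd⟩ := (IsLocalization.algebraMap_mem_map_algebraMap_iff (Submonoid.powers h) S _ _).mp h3
  have h4 := h2 (fun i => c * d i) (by
    rw [Finset.mul_sum] at hcd
    simpa only [mul_assoc] using hcd) i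
  have h5 := Ideal.mem_map_of_mem (algebraMap R S) h4
  rw [map_mul, Ideal.unit_mul_mem_iff_mem _ hunit, map_mul, hd, Algebra.smul_def,
    Ideal.unit_mul_mem_iff_mem _ (IsLocalization.map_units S (⟨c, hc⟩ : Submonoid.powers h)),
    Ideal.unit_mul_mem_iff_mem _ (IsLocalization.map_units S s)] at h5
  exact h5

end Frame

end Motivic

namespace Motivic

/-! ### Coordinate rings of blow-up charts -/

section Chart

open MvPolynomial

variable {σ : Type*} {R : Type u} [CommRing R]

lemma isHomogeneous_aeval_mul {B : Type*} [CommRing B] [Algebra R B] {F : MvPolynomial σ R} {N : ℕ}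
    (hF : F.IsHomogeneous N) (u : B) (z : σ → B) :
    aeval (fun j => u * z j) F = u ^ N * aeval z F := by
  conv_lhs => rw [F.as_sum]
  conv_rhs => rw [F.as_sum]
  rw [map_sum, map_sum, Finset.mul_sum]
  refine Finset.sum_congr rfl fun s hs => ?_
  rw [aeval_monomial, aeval_monomial, hF.degree_eq_sum_deg_support hs, ← Finset.prod_pow_eq_pow_sum,
    Finsupp.prod, Finsupp.prod]
  simp only [mul_pow, Finset.prod_mul_distrib]
  ring

/-- The coordinate ring of the `i`-th standard chart of the blow-up of `Spec R` in the ideal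
generated by the family `f`. -/
def blowUpChart (f : σ → R) (i : σ) : Subalgebra R (Localization.Away (f i)) :=
  Algebra.adjoin R (Set.range fun j =>
    IsLocalization.mk' (Localization.Away (f i)) (f j) (⟨f i, 1, pow_one _⟩ : Submonoid.powers (f i)))

variable (f : σ → R) (i : σ)

/-- The element `f j / f i` of the `i`-th chart ring. -/
noncomputable def blowUpChart.frac (j : σ) : blowUpChart f i :=
  ⟨_, Algebra.subset_adjoin ⟨j, rfl⟩⟩

lemma blowUpChart.mul_frac (j : σ) : algebraMap R (blowUpChart f i) (f i) * blowUpChart.frac f i j =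
    algebraMap R (blowUpChart f i) (f j) := by
  apply Subtype.ext
  exact IsLocalization.mk'_spec' (Localization.Away (f i)) (f j)
    (⟨f i, 1, pow_one _⟩ : Submonoid.powers (f i))

lemma blowUpChart.isUnit_coe : IsUnit (algebraMap R (Localization.Away (f i)) (f i)) :=
  IsLocalization.Away.algebraMap_isUnit (f i)

lemma blowUpChart.mem_nonZeroDivisors :
    algebraMap R (blowUpChart f i) (f i) ∈ nonZeroDivisors (blowUpChart f i) := by
  rw [mem_nonZeroDivisors_iff]
  suffices h : ∀ a, algebraMap R (blowUpChart f i) (f i) * a = 0 → a = 0 from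
    And.intro (fun a ha => h a ha) (fun a ha => h a (by rwa [mul_comm]))
  intro a ha
  apply Subtype.ext
  exact ((blowUpChart.isUnit_coe f i).mul_right_eq_zero).mp (congrArg Subtype.val ha)

lemma blowUpChart.frac_self : blowUpChart.frac f i i = 1 := by
  have h := blowUpChart.mul_frac f i i
  have h2 : algebraMap R (blowUpChart f i) (f i) * (blowUpChart.frac f i i - 1) = 0 := by
    rw [mul_sub, h, mul_one, sub_self]
  exact sub_eq_zero.mp ((mem_nonZeroDivisors_iff.mp (blowUpChart.mem_nonZeroDivisors f i)).1 _ h2)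

lemma blowUpChart.algebraMap_eval {F : MvPolynomial σ R} {N : ℕ} (hF : F.IsHomogeneous N) :
    algebraMap R (blowUpChart f i) (eval f F) =
      algebraMap R (blowUpChart f i) (f i) ^ N * aeval (blowUpChart.frac f i) F := by
  rw [← isHomogeneous_aeval_mul hF]
  simp only [blowUpChart.mul_frac]
  exact MvPolynomial.eval₂_comp_left (algebraMap R (blowUpChart f i)) (RingHom.id R) f F

/-- A normal form: every element is `a / f_i^N` with `a ∈ (f)^N`. Both the universal property of the
chart and the description of its exceptional fibre are checked on such fractions. -/
lemma blowUpChart.exists_mul_pow_eq (x : blowUpChart f i) : ∃ N, ∃ a ∈ Ideal.span (Set.range f) ^ N,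
    x * algebraMap R (blowUpChart f i) (f i) ^ N = algebraMap R (blowUpChart f i) a := by
  have hi : f i ∈ Ideal.span (Set.range f) := Ideal.subset_span (Set.mem_range_self i)
  obtain ⟨x, hx⟩ := x
  induction hx using Algebra.adjoin_induction with
  | mem x hx =>
    obtain ⟨j, rfl⟩ := hx
    refine ⟨1, f j, by rw [pow_one]; exact Ideal.subset_span (Set.mem_range_self j), ?_⟩
    rw [pow_one, mul_comm]
    exact blowUpChart.mul_frac f i j
  | algebraMap r => exact ⟨0, r, by simp, by rw [pow_zero, mul_one]; rfl⟩
  | add x y hx hy ihx ihy =>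
    obtain ⟨N, a, ha, hxa⟩ := ihx
    obtain ⟨M, b, hb, hyb⟩ := ihy
    refine ⟨N + M, a * f i ^ M + f i ^ N * b, ?_, ?_⟩
    · rw [pow_add]
      exact Ideal.add_mem _ (Ideal.mul_mem_mul ha (Ideal.pow_mem_pow hi M))
        (Ideal.mul_mem_mul (Ideal.pow_mem_pow hi N) hb)
    · rw [map_add, map_mul, map_mul, ← hxa, ← hyb, map_pow, map_pow]
      change (⟨x, hx⟩ + ⟨y, hy⟩ : blowUpChart f i) * _ = _
      ring
  | mul x y hx hy ihx ihy =>
    obtain ⟨N, a, ha, hxa⟩ := ihx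
    obtain ⟨M, b, hb, hyb⟩ := ihy
    refine ⟨N + M, a * b, ?_, ?_⟩
    · rw [pow_add]
      exact Ideal.mul_mem_mul ha hb
    · rw [map_mul, ← hxa, ← hyb]
      change (⟨x, hx⟩ * ⟨y, hy⟩ : blowUpChart f i) * _ = _
      ring

lemma blowUpChart.exists_eq_aeval {N : ℕ} {a : R} (ha : a ∈ Ideal.span (Set.range f) ^ N) :
    ∃ F : MvPolynomial σ R, F.IsHomogeneous N ∧ eval f F = a ∧
      algebraMap R (blowUpChart f i) a =
        algebraMap R (blowUpChart f i) (f i) ^ N * aeval (blowUpChart.frac f i) F := by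
  obtain ⟨F, hF, rfl⟩ := (Ideal.mem_span_pow_iff_exists_isHomogeneous f a).mp ha
  exact ⟨F, hF, rfl, blowUpChart.algebraMap_eval f i hF⟩

lemma blowUpChart.aeval_frac_surjective :
    Function.Surjective (aeval (R := R) (blowUpChart.frac f i)) := by
  intro x
  obtain ⟨N, a, ha, hx⟩ := blowUpChart.exists_mul_pow_eq f i x
  obtain ⟨F, -, -, h⟩ := blowUpChart.exists_eq_aeval f i ha
  refine ⟨F, ?_⟩
  rw [h, mul_comm] at hx
  exact ((mem_nonZeroDivisors_iff_right.mp
    (pow_mem (blowUpChart.mem_nonZeroDivisors f i) N)) _ (by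
      rw [mul_comm, mul_sub, hx, sub_self]) |> sub_eq_zero.mp).symm

instance blowUpChart.finiteType [Finite σ] : Algebra.FiniteType R (blowUpChart f i) :=
  Algebra.FiniteType.of_surjective (aeval (R := R) (blowUpChart.frac f i))
    (blowUpChart.aeval_frac_surjective f i)

lemma blowUpChart.map_span : (Ideal.span (Set.range f)).map (algebraMap R (blowUpChart f i)) =
    Ideal.span {algebraMap R (blowUpChart f i) (f i)} := by
  apply le_antisymm
  · rw [Ideal.map_span, Ideal.span_le]
    rintro _ ⟨_, ⟨j, rfl⟩, rfl⟩
    rw [SetLike.mem_coe, ← blowUpChart.mul_frac f i j]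
    exact Ideal.mul_mem_right _ _ (Ideal.mem_span_singleton_self _)
  · rw [Ideal.span_singleton_le_iff_mem]
    exact Ideal.mem_map_of_mem (algebraMap R (blowUpChart f i))
      (Ideal.subset_span (Set.mem_range_self i))

section Lift

variable {B : Type u} [CommRing B] (ρ : R →+* B)

lemma blowUpChart.hom_ext (hb : ρ (f i) ∈ nonZeroDivisors B) {τ₁ τ₂ : blowUpChart f i →+* B}
    (h₁ : τ₁.comp (algebraMap R (blowUpChart f i)) = ρ) (h₂ : τ₂.comp (algebraMap R (blowUpChart f i)) = ρ) : τ₁ = τ₂ := by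
  ext x
  obtain ⟨N, a, ha, hx⟩ := blowUpChart.exists_mul_pow_eq f i x
  have e₁ := congrArg τ₁ hx
  have e₂ := congrArg τ₂ hx
  have g₁ : ∀ r, τ₁ (algebraMap R _ r) = ρ r := fun r => congrArg (fun t => t r) h₁
  have g₂ : ∀ r, τ₂ (algebraMap R _ r) = ρ r := fun r => congrArg (fun t => t r) h₂
  rw [map_mul, map_pow, g₁, g₁] at e₁
  rw [map_mul, map_pow, g₂, g₂, ← e₁] at e₂
  exact (mul_cancel_right_mem_nonZeroDivisors (pow_mem hb N)).mp e₂.symm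

/-- The map exists into the localization of `B` at `ρ (f i)`, which contains `B`. Its values stay in
`B`: for `a ∈ (f)^N` the element `ρ a` is divisible by `ρ (f i) ^ N`. -/
lemma blowUpChart.exists_lift (hb : ρ (f i) ∈ nonZeroDivisors B)
    (hI : (Ideal.span (Set.range f)).map ρ ≤ Ideal.span {ρ (f i)}) :
    ∃ τ : blowUpChart f i →+* B, τ.comp (algebraMap R (blowUpChart f i)) = ρ := by
  let B' := Localization.Away (ρ (f i))
  have hinj : Function.Injective (algebraMap B B') :=
    IsLocalization.injective B' (Submonoid.powers_le.mpr hb)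
  let ρ' : Localization.Away (f i) →+* B' :=
    IsLocalization.Away.lift (f i) (g := (algebraMap B B').comp ρ)
      (IsLocalization.Away.algebraMap_isUnit (ρ (f i)))
  have hρ' : ∀ r, ρ' (algebraMap R _ r) = algebraMap B B' (ρ r) := fun r =>
    IsLocalization.Away.lift_eq _ _ r
  have hmem : ∀ x : blowUpChart f i, ρ' x ∈ (algebraMap B B').range := by
    intro x
    obtain ⟨N, a, ha, hx⟩ := blowUpChart.exists_mul_pow_eq f i x
    have h1 : ρ a ∈ Ideal.span {ρ (f i) ^ N} := by
      rw [← Ideal.span_singleton_pow]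
      refine Ideal.pow_right_mono hI N ?_
      rw [← Ideal.map_pow]
      exact Ideal.mem_map_of_mem ρ ha
    obtain ⟨b, hb⟩ := Ideal.mem_span_singleton'.mp h1
    refine ⟨b, ?_⟩
    have h2 : ρ' x * ρ' (algebraMap R _ (f i)) ^ N = ρ' (algebraMap R _ a) := by
      rw [← map_pow, ← map_mul]
      exact congrArg ρ' (congrArg Subtype.val hx)
    rw [hρ', hρ', ← hb, map_mul, map_pow] at h2
    exact ((((IsLocalization.Away.algebraMap_isUnit (S := B') (ρ (f i))).pow N).mul_left_inj).mp h2).symm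
  let e : B ≃+* (algebraMap B B').range :=
    RingEquiv.ofBijective (algebraMap B B').rangeRestrict
      ⟨fun x y h => hinj (congrArg Subtype.val h), (algebraMap B B').rangeRestrict_surjective⟩
  let τ' : blowUpChart f i →+* (algebraMap B B').range :=
    (ρ'.comp (blowUpChart f i).val.toRingHom).codRestrict _ hmem
  refine ⟨e.symm.toRingHom.comp τ', RingHom.ext fun r => ?_⟩
  change e.symm (τ' (algebraMap R _ r)) = ρ r
  rw [RingEquiv.symm_apply_eq]
  exact Subtype.ext (hρ' r)

end Lift

section Fibre

/-- Homogenize `P` with powers of `X_i`, using `f_i / f_i = 1`. If the value of `P` is a multiple of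
`f_i`, then the resulting form of degree `N` takes a value in `(f)^(N+1)`, and quasi-regularity
bounds its coefficients, which are those of `P`. -/
lemma blowUpChart.coeff_mem_of_aeval_mem (hf : IsQuasiRegular f) (hi : f i ∈ nonZeroDivisors R)
    {P : MvPolynomial {j // j ≠ i} R}
    (hP : aeval (fun j : {j // j ≠ i} => blowUpChart.frac f i j) P ∈
      Ideal.span {algebraMap R (blowUpChart f i) (f i)}) (s : {j // j ≠ i} →₀ ℕ) :
    P.coeff s ∈ Ideal.span (Set.range f) := by
  classical
  have hinj : Function.Injective (algebraMap R (blowUpChart f i)) := fun x y h =>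
    IsLocalization.injective (Localization.Away (f i)) (Submonoid.powers_le.mpr hi)
      (congrArg Subtype.val h)
  obtain ⟨y, hy⟩ := Ideal.mem_span_singleton'.mp hP
  obtain ⟨M, a, ha, hya⟩ := blowUpChart.exists_mul_pow_eq f i y
  -- Large enough both to homogenize `P` and to absorb the denominator `f_i^M` of the quotient `y`;
  -- the truncated subtractions below are then genuine.
  let N := P.totalDegree + M
  let e : ({j // j ≠ i} →₀ ℕ) → σ →₀ ℕ := fun s =>
    s.mapDomain Subtype.val + Finsupp.single i (N - s.degree)
  have he : ∀ s (j : {j // j ≠ i}), e s j = s j := fun s j => by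
    simp only [e, Finsupp.add_apply]
    rw [Finsupp.mapDomain_apply Subtype.val_injective, Finsupp.single_eq_of_ne j.2, add_zero]
  have hei : Function.Injective e := fun s t h => Finsupp.ext fun j => by
    rw [← he, h, he]
  let F : MvPolynomial σ R := ∑ t ∈ P.support, monomial (e t) (P.coeff t)
  have hle : ∀ t ∈ P.support, t.degree ≤ N := fun t ht =>
    (MvPolynomial.le_totalDegree ht).trans (Nat.le_add_right _ _)
  have hF : F.IsHomogeneous N := by
    refine IsHomogeneous.sum _ _ _ fun t ht => isHomogeneous_monomial _ ?_
    simp only [e, map_add, Finsupp.degree_single, Finsupp.degree_mapDomain]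
    have := hle t ht
    omega
  have hev : aeval (blowUpChart.frac f i) F =
      aeval (fun j : {j // j ≠ i} => blowUpChart.frac f i j) P := by
    conv_rhs => rw [P.as_sum]
    rw [map_sum, map_sum]
    refine Finset.sum_congr rfl fun t _ => ?_
    rw [aeval_monomial, aeval_monomial]
    congr 1
    simp only [e]
    rw [Finsupp.prod_add_index' (by simp) (fun _ _ _ => pow_add _ _ _),
      Finsupp.prod_mapDomain_index (by simp) (fun _ _ _ => pow_add _ _ _),
      Finsupp.prod_single_index (by simp), blowUpChart.frac_self, one_pow, mul_one]
  have h1 : eval f F = f i ^ (N + 1 - M) * a := by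
    apply hinj
    have hp : algebraMap R (blowUpChart f i) (f i) ^ (N + 1) =
        algebraMap R (blowUpChart f i) (f i) ^ (N + 1 - M) *
          algebraMap R (blowUpChart f i) (f i) ^ M := by
      rw [← pow_add]; congr 1; omega
    rw [blowUpChart.algebraMap_eval f i hF, hev, ← hy, map_mul, ← hya, map_pow]
    linear_combination y * hp
  have h2 := hf N F hF (by
    rw [h1]
    have hNM : Ideal.span (Set.range f) ^ (N + 1) =
        Ideal.span (Set.range f) ^ (N + 1 - M) * Ideal.span (Set.range f) ^ M := by
      rw [← pow_add]; congr 1; omega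
    rw [hNM]
    exact Ideal.mul_mem_mul (Ideal.pow_mem_pow (Ideal.subset_span (Set.mem_range_self i)) _)
      ha) (e s)
  have h3 : F.coeff (e s) = P.coeff s := by
    simp only [F, coeff_sum, coeff_monomial, hei.eq_iff]
    rw [Finset.sum_ite_eq']
    split_ifs with h
    · rfl
    · exact (notMem_support_iff.mp h).symm
  rwa [h3] at h2

/-- This identifies the exceptional divisor in a chart with an affine space over the center. The
chart ring is a quotient of `R[X_j : j ≠ i]`. A polynomial reduces to zero over `A` exactly when its
value in the chart is a multiple of `f_i`, so coefficient reduction descends to the chart with the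
expected kernel. -/
lemma blowUpChart.exists_fibre_hom (hf : IsQuasiRegular f) (hi : f i ∈ nonZeroDivisors R)
    {A : Type u} [CommRing A] (φ : R →+* A) (hφ : Function.Surjective φ)
    (hker : RingHom.ker φ = Ideal.span (Set.range f)) :
    ∃ π : blowUpChart f i →+* MvPolynomial {j // j ≠ i} A, Function.Surjective π ∧
      RingHom.ker π = Ideal.span {algebraMap R (blowUpChart f i) (f i)} ∧
      (∀ r, π (algebraMap R _ r) = C (φ r)) ∧
      ∀ j : {j // j ≠ i}, π (blowUpChart.frac f i j) = X j := by
  classical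
  let θ : MvPolynomial {j // j ≠ i} R →ₐ[R] blowUpChart f i :=
    aeval (fun j : {j // j ≠ i} => blowUpChart.frac f i j)
  have hθ : Function.Surjective θ := by
    let Ψ : MvPolynomial σ R →ₐ[R] MvPolynomial {j // j ≠ i} R :=
      aeval fun j => if h : j ≠ i then X ⟨j, h⟩ else 1
    have hΨ : θ.comp Ψ = aeval (blowUpChart.frac f i) := by
      ext j
      simp only [AlgHom.comp_apply, Ψ, aeval_X]
      split_ifs with h
      · simp [θ]
      · obtain rfl := not_not.mp h
        rw [map_one, blowUpChart.frac_self]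
    intro x
    obtain ⟨F, rfl⟩ := blowUpChart.aeval_frac_surjective f i x
    exact ⟨Ψ F, congrArg (fun t => t F) hΨ⟩
  let Θ : MvPolynomial {j // j ≠ i} R →+* MvPolynomial {j // j ≠ i} A := MvPolynomial.map φ
  have hΘ : ∀ P, Θ P = 0 ↔ ∀ s, P.coeff s ∈ Ideal.span (Set.range f) := fun P => by
    rw [← hker, MvPolynomial.ext_iff]
    simp [Θ, coeff_map, RingHom.mem_ker]
  have hΘθ : ∀ P, Θ P = 0 ↔ θ P ∈ Ideal.span {algebraMap R (blowUpChart f i) (f i)} := fun P => by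
    rw [hΘ]
    refine ⟨fun h => ?_, fun h => blowUpChart.coeff_mem_of_aeval_mem f i hf hi h⟩
    rw [P.as_sum, map_sum]
    refine Ideal.sum_mem _ fun s _ => ?_
    rw [aeval_monomial, ← blowUpChart.map_span]
    exact Ideal.mul_mem_right _ _ (Ideal.mem_map_of_mem _ (h s))
  have hle : RingHom.ker (θ : MvPolynomial {j // j ≠ i} R →+* blowUpChart f i) ≤ RingHom.ker Θ :=
    fun P hP => (hΘθ P).mpr (by
      rw [show θ P = 0 from hP]; exact zero_mem _)
  let π := RingHom.liftOfSurjective (θ : MvPolynomial {j // j ≠ i} R →+* blowUpChart f i) hθ ⟨Θ, hle⟩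
  have hπ : ∀ P, π (θ P) = Θ P := fun P =>
    RingHom.liftOfRightInverse_comp_apply _ _ _ ⟨Θ, hle⟩ P
  refine ⟨π, fun y => ?_, ?_, fun r => ?_, fun j => ?_⟩
  · obtain ⟨P, rfl⟩ := MvPolynomial.map_surjective φ hφ y
    exact ⟨θ P, hπ P⟩
  · ext x
    obtain ⟨P, rfl⟩ := hθ x
    rw [RingHom.mem_ker, hπ, hΘθ]
  · rw [← θ.commutes r, hπ, algebraMap_eq]
    exact map_C φ r
  · have : θ (X j) = blowUpChart.frac f i j := aeval_X _ _
    rw [← this, hπ]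
    exact map_X φ j

end Fibre

end Chart

end Motivic

namespace Motivic

/-! ### Pullback of ideal sheaves on affine opens -/

section IdealComap

/-- Both inclusions come from the adjunction between pullback and pushforward of ideal sheaves,
since pushforward along an affine morphism is contraction of ideals. -/
lemma comap_ideal_top {X Y : Scheme.{u}} [IsAffine X] [IsAffine Y] (f : X ⟶ Y) (I : Y.IdealSheafData) :
    (I.comap f).ideal ⟨⊤, isAffineOpen_top X⟩ =
      (I.ideal ⟨⊤, isAffineOpen_top Y⟩).map f.appTop.hom := by
  apply le_antisymm
  · let J := Scheme.IdealSheafData.ofIdealTop ((I.ideal ⟨⊤, isAffineOpen_top Y⟩).map f.appTop.hom)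
    have hJ : J.ideal ⟨⊤, isAffineOpen_top X⟩ =
        (I.ideal ⟨⊤, isAffineOpen_top Y⟩).map f.appTop.hom := by
      simp [J]
    have h : I.comap f ≤ J := by
      rw [← Scheme.IdealSheafData.le_map_iff_comap_le]
      apply Scheme.IdealSheafData.le_of_isAffine
      rw [Scheme.IdealSheafData.ideal_map_of_isAffineHom]
      rw [← Ideal.map_le_iff_le_comap]
      exact hJ.ge
    exact (h _).trans hJ.le
  · rw [Ideal.map_le_iff_le_comap]
    have h := Scheme.IdealSheafData.le_map_comap (J := I) (f := f) ⟨⊤, isAffineOpen_top Y⟩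
    rwa [Scheme.IdealSheafData.ideal_map_of_isAffineHom] at h

lemma map_comap_ι_ideal {X : Scheme.{u}} (J : X.IdealSheafData) (V : X.affineOpens) :
    haveI : IsAffine V.1.toScheme := V.2
    ((J.comap V.1.ι).ideal ⟨⊤, isAffineOpen_top V.1.toScheme⟩).map V.1.topIso.hom.hom = J.ideal V := by
  have : IsAffine V.1.toScheme := V.2
  rw [Scheme.IdealSheafData.ideal_comap_of_isOpenImmersion]
  simp only [Scheme.Opens.ι_appIso, Iso.refl_inv]
  exact J.map_ideal' (U := V) (V := ⟨V.1.ι ''ᵁ ⊤, _⟩) _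

lemma comap_ideal_eq_map_appLE {X Y : Scheme.{u}} (f : X ⟶ Y) (I : Y.IdealSheafData)
    (V : X.affineOpens) (U : Y.affineOpens) (h : V.1 ≤ f ⁻¹ᵁ U.1) :
    (I.comap f).ideal V = (I.ideal U).map (f.appLE U.1 V.1 h).hom := by
  have : IsAffine V.1.toScheme := V.2
  have : IsAffine U.1.toScheme := U.2
  have e : f.resLE U.1 V.1 h ≫ U.1.ι = V.1.ι ≫ f := Scheme.Hom.resLE_comp_ι f h
  rw [← map_comap_ι_ideal (I.comap f) V, ← map_comap_ι_ideal I U, ← Scheme.IdealSheafData.comap_comp,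
    ← e, Scheme.IdealSheafData.comap_comp, comap_ideal_top, Ideal.map_map, Ideal.map_map,
    ← CommRingCat.hom_comp, ← CommRingCat.hom_comp]
  congr 2
  rw [Scheme.Hom.appTop, Scheme.Hom.resLE_app_top, Category.assoc, Category.assoc, Iso.inv_hom_id,
    Category.comp_id]

end IdealComap

/-! ### Flat pullback of Cartier divisors -/

section Flat

lemma appLE_mem_nonZeroDivisors {X Y : Scheme.{u}} (f : X ⟶ Y) [Flat f] {U : Y.Opens} {V : X.Opens}
    (hU : IsAffineOpen U) (hV : IsAffineOpen V) (h : V ≤ f ⁻¹ᵁ U) {a : Γ(Y, U)}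
    (ha : a ∈ nonZeroDivisors Γ(Y, U)) : (f.appLE U V h).hom a ∈ nonZeroDivisors Γ(X, V) := by
  have hfl : (f.appLE U V h).hom.Flat := f.flat_appLE hU hV h
  algebraize [(f.appLE U V h).hom]
  have := Module.Flat.isSMulRegular_of_nonZeroDivisors (M := Γ(X, V)) ha
  rw [mem_nonZeroDivisors_iff]
  suffices h' : ∀ b, (f.appLE U V h).hom a * b = 0 → b = 0 from
    And.intro (fun b hb => h' b hb) (fun b hb => h' b (by rwa [mul_comm]))
  intro b hb
  refine this ?_
  simp only [Algebra.smul_def, mul_zero]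
  exact hb

lemma map_mem_nonZeroDivisors {X : Scheme.{u}} {U V : X.Opens}
    (hU : IsAffineOpen U) (hV : IsAffineOpen V) (h : V ≤ U) {a : Γ(X, U)}
    (ha : a ∈ nonZeroDivisors Γ(X, U)) :
    (X.presheaf.map (homOfLE h).op).hom a ∈ nonZeroDivisors Γ(X, V) := by
  have := appLE_mem_nonZeroDivisors (𝟙 X) hU hV h ha
  have e : (𝟙 X : X ⟶ X).appLE U V h = X.presheaf.map (homOfLE h).op := by
    simp only [Scheme.Hom.appLE, Scheme.Hom.id_app]
    exact Category.id_comp _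
  rwa [e] at this

/-- Flat ring maps preserve nonzerodivisors. Applied to open immersions, this makes the universal
property of a blow-up available on open subschemes of it. -/
lemma IsEffectiveCartier.comap_of_flat {X Y : Scheme.{u}} (f : X ⟶ Y) [Flat f]
    {I : Y.IdealSheafData} (hI : IsEffectiveCartier I) : IsEffectiveCartier (I.comap f) := by
  intro x
  obtain ⟨U, hxU, a, ha, haU⟩ := hI (f x)
  obtain ⟨_, ⟨V, hV, rfl⟩, hxV, hVU⟩ := X.isBasis_affineOpens.exists_subset_of_mem_open
    (show x ∈ f ⁻¹ᵁ U.1 from hxU) (f ⁻¹ᵁ U.1).2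
  refine ⟨⟨V, hV⟩, hxV, _, appLE_mem_nonZeroDivisors f U.2 hV hVU ha, ?_⟩
  rw [comap_ideal_eq_map_appLE f I ⟨V, hV⟩ U hVU, haU, Ideal.map_span, Set.image_singleton]

end Flat

/-! ### The loci where one given generator generates the pulled-back ideal -/

section ChartLocus

variable {S : Scheme.{u}} {U : S.Opens} {σ : Type*}

/-- The locus in `W` where the pullback of the `i`-th section of the family `f` is a nonzerodivisor
dividing the pullbacks of all the others. -/
def chartLocus {W : Scheme.{u}} (w : W ⟶ S) (f : σ → Γ(S, U)) (i : σ) : W.Opens :=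
  sSup {V : W.Opens | IsAffineOpen V ∧ ∃ h : V ≤ w ⁻¹ᵁ U,
    (w.appLE U V h).hom (f i) ∈ nonZeroDivisors Γ(W, V) ∧
      ∀ j, (w.appLE U V h).hom (f i) ∣ (w.appLE U V h).hom (f j)}

lemma mem_chartLocus {W : Scheme.{u}} {w : W ⟶ S} {f : σ → Γ(S, U)} {i : σ} {x : W} :
    x ∈ chartLocus w f i ↔ ∃ (V : W.Opens) (_ : IsAffineOpen V) (_ : x ∈ V) (h : V ≤ w ⁻¹ᵁ U),
      (w.appLE U V h).hom (f i) ∈ nonZeroDivisors Γ(W, V) ∧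
        ∀ j, (w.appLE U V h).hom (f i) ∣ (w.appLE U V h).hom (f j) := by
  simp only [chartLocus, TopologicalSpace.Opens.mem_sSup, Set.mem_ofPred_eq]
  constructor
  · rintro ⟨V, ⟨hV, h, h1, h2⟩, hx⟩
    exact ⟨V, hV, hx, h, h1, h2⟩
  · rintro ⟨V, hV, hx, h, h1, h2⟩
    exact ⟨V, ⟨hV, h, h1, h2⟩, hx⟩

lemma chartLocus_le {W : Scheme.{u}} {w : W ⟶ S} {f : σ → Γ(S, U)} {i : σ} :
    chartLocus w f i ≤ w ⁻¹ᵁ U := by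
  intro x hx
  obtain ⟨V, -, hxV, h, -⟩ := mem_chartLocus.mp hx
  exact h hxV

lemma exists_affine_le {W : Scheme.{u}} {x : W} {O : W.Opens} (hx : x ∈ O) :
    ∃ V : W.Opens, IsAffineOpen V ∧ x ∈ V ∧ V ≤ O := by
  obtain ⟨_, ⟨V, hV, rfl⟩, hxV, hVO⟩ := W.isBasis_affineOpens.exists_subset_of_mem_open hx O.2
  exact ⟨V, hV, hxV, hVO⟩

lemma map_appLE_apply {W : Scheme.{u}} (w : W ⟶ S) {V V' : W.Opens} (h : V ≤ w ⁻¹ᵁ U) (h' : V' ≤ V)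
    (a : Γ(S, U)) : (W.presheaf.map (homOfLE h').op).hom ((w.appLE U V h).hom a) =
      (w.appLE U V' (h'.trans h)).hom a := by
  rw [← w.appLE_map h (homOfLE h').op]
  rfl

/-- If `b` is invertible then a multiple `b * a` that is a nonzerodivisor can replace `a`. -/
lemma mem_chartLocus_of_isUnit {W : Scheme.{u}} {w : W ⟶ S} {f : σ → Γ(S, U)} {i : σ} {x : W}
    {V : W.Opens} (hV : IsAffineOpen V) (h : V ≤ w ⁻¹ᵁ U) {g a : Γ(W, V)}
    (hg : g ∈ nonZeroDivisors Γ(W, V)) (hgf : ∀ j, g ∣ (w.appLE U V h).hom (f j))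
    (ha : (w.appLE U V h).hom (f i) = a * g) (hxa : x ∈ W.basicOpen a) :
    x ∈ chartLocus w f i := by
  have hle := W.basicOpen_le a
  have hu : IsUnit ((W.presheaf.map (homOfLE hle).op).hom a) := W.toRingedSpace.isUnit_res_basicOpen a
  have e : (w.appLE U _ (hle.trans h)).hom (f i) = (W.presheaf.map (homOfLE hle).op).hom a *
      (W.presheaf.map (homOfLE hle).op).hom g := by
    rw [← map_mul, ← ha, map_appLE_apply]
  refine mem_chartLocus.mpr ⟨W.basicOpen a, hV.basicOpen a, hxa, hle.trans h, ?_, fun j => ?_⟩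
  · rw [e]
    exact mul_mem hu.mem_nonZeroDivisors (map_mem_nonZeroDivisors hV (hV.basicOpen a) hle hg)
  · rw [e, hu.mul_left_dvd, ← map_appLE_apply w h hle]
    exact map_dvd _ (hgf j)

/-- Near `x` the pulled-back ideal is generated by one nonzerodivisor `g'`. Writing `f_j = g' a_j`
and `g' = Σ c_j f_j` and cancelling `g'` gives `Σ c_j a_j = 1`, so some `a_i` is invertible at `x`,
and there `f_i` generates too. -/
lemma iSup_chartLocus [Finite σ] {I : S.IdealSheafData} {hU : IsAffineOpen U} {f : σ → Γ(S, U)}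
    (hf : I.ideal ⟨U, hU⟩ = Ideal.span (Set.range f)) {W : Scheme.{u}} {w : W ⟶ S}
    (hw : IsEffectiveCartier (I.comap w)) : ⨆ i, chartLocus w f i = w ⁻¹ᵁ U := by
  cases nonempty_fintype σ
  refine le_antisymm (iSup_le fun i => chartLocus_le) fun x hx => ?_
  obtain ⟨V₀, hxV₀, g, hg, hgV⟩ := hw x
  obtain ⟨V, hV, hxV, hle⟩ := exists_affine_le (O := V₀.1 ⊓ w ⁻¹ᵁ U) ⟨hxV₀, hx⟩
  have h : V ≤ w ⁻¹ᵁ U := hle.trans inf_le_right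
  have h0 : V ≤ V₀.1 := hle.trans inf_le_left
  set g' := (W.presheaf.map (homOfLE h0).op).hom g
  have hg' : g' ∈ nonZeroDivisors Γ(W, V) := map_mem_nonZeroDivisors V₀.2 hV h0 hg
  have e1 : (I.comap w).ideal ⟨V, hV⟩ = Ideal.span {g'} := by
    rw [← (I.comap w).map_ideal (U := ⟨V, hV⟩) (V := V₀) h0, hgV, Ideal.map_span,
      Set.image_singleton]
    rfl
  have e2 := comap_ideal_eq_map_appLE w I ⟨V, hV⟩ ⟨U, hU⟩ h
  rw [e1, hf, Ideal.map_span, ← Set.range_comp] at e2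
  have h1 : ∀ j, g' ∣ (w.appLE U V h).hom (f j) := fun j => by
    rw [← Ideal.mem_span_singleton, e2]
    exact Ideal.subset_span ⟨j, rfl⟩
  choose a ha using h1
  have h2 : g' ∈ Ideal.span (Set.range ((w.appLE U V h).hom ∘ f)) := by
    rw [← e2]; exact Ideal.mem_span_singleton_self _
  obtain ⟨c, hc⟩ := (Ideal.mem_span_range_iff_exists_fun).mp h2
  have h3 : ∑ j, c j * a j = 1 := by
    refine (mul_cancel_right_mem_nonZeroDivisors hg').mp ?_
    rw [one_mul, Finset.sum_mul]
    refine Eq.trans (Finset.sum_congr rfl fun j _ => ?_) hc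
    rw [Function.comp_apply, ha, mul_assoc, mul_comm (a j)]
  have h4 : Ideal.span (Set.range a) = ⊤ := by
    rw [Ideal.eq_top_iff_one, ← h3]
    exact Ideal.sum_mem _ fun j _ => Ideal.mul_mem_left _ _ (Ideal.subset_span ⟨j, rfl⟩)
  have h6 : x ∈ ⨆ s ∈ Set.range a, W.basicOpen s := by
    rw [iSup_basicOpen_of_span_eq_top V _ h4]; exact hxV
  simp only [TopologicalSpace.Opens.mem_iSup] at h6
  obtain ⟨_, ⟨i, rfl⟩, hi⟩ := h6
  refine TopologicalSpace.Opens.mem_iSup.mpr ⟨i, ?_⟩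
  exact mem_chartLocus_of_isUnit hV h hg' (fun j => ⟨a j, ha j⟩)
    (by rw [ha, mul_comm]) hi

end ChartLocus

end Motivic

namespace Motivic

/-! ### Functoriality of chart loci and gluing of quotients -/

section ChartHom

variable {S : Scheme.{u}} {U : S.Opens} {σ : Type*}

lemma exists_chartLocus_affine {W : Scheme.{u}} {w : W ⟶ S} {f : σ → Γ(S, U)} {i : σ} {x : W}
    (hx : x ∈ chartLocus w f i) {O : W.Opens} (hxO : x ∈ O) :
    ∃ (V : W.Opens) (_ : IsAffineOpen V) (_ : x ∈ V) (_ : V ≤ O) (h : V ≤ w ⁻¹ᵁ U),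
      (w.appLE U V h).hom (f i) ∈ nonZeroDivisors Γ(W, V) ∧
        ∀ j, (w.appLE U V h).hom (f i) ∣ (w.appLE U V h).hom (f j) := by
  obtain ⟨V, hV, hxV, h, h1, h2⟩ := mem_chartLocus.mp hx
  obtain ⟨V', hV', hxV', hle⟩ := exists_affine_le (O := V ⊓ O) ⟨hxV, hxO⟩
  have h' : V' ≤ V := hle.trans inf_le_left
  refine ⟨V', hV', hxV', hle.trans inf_le_right, h'.trans h, ?_, fun j => ?_⟩
  · rw [← map_appLE_apply w h h']
    exact map_mem_nonZeroDivisors hV hV' h' h1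
  · rw [← map_appLE_apply w h h', ← map_appLE_apply w h h']
    exact map_dvd _ (h2 j)

lemma appLE_comp_apply {W T : Scheme.{u}} (h : W ⟶ T) (p : T ⟶ S) {w : W ⟶ S} (hw : h ≫ p = w)
    {V : T.Opens} {V' : W.Opens} (e : V ≤ p ⁻¹ᵁ U) (e' : V' ≤ h ⁻¹ᵁ V) (e'' : V' ≤ w ⁻¹ᵁ U)
    (a : Γ(S, U)) : (h.appLE V V' e').hom ((p.appLE U V e).hom a) = (w.appLE U V' e'').hom a := by
  subst hw
  rw [← Scheme.Hom.appLE_comp_appLE h p U V V' e e']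
  rfl

/-- A pulled-back nonzerodivisor may become a zero divisor, so the comparison uses an index `m`
whose locus contains the point in question. Where `f_i` and `f_m` divide each other and one of them
is a nonzerodivisor, they differ by a unit. In one direction the unit shows that `f_i` stays a
nonzerodivisor on `W`; in the other, `f_i = f_m b` on `T` with `b` invertible after pullback, hence
invertible at the image point. -/
lemma preimage_chartLocus [Finite σ] {I : S.IdealSheafData} {hU : IsAffineOpen U} {f : σ → Γ(S, U)}
    (hf : I.ideal ⟨U, hU⟩ = Ideal.span (Set.range f)) {W T : Scheme.{u}} (h : W ⟶ T) (p : T ⟶ S)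
    {w : W ⟶ S} (hhw : h ≫ p = w) (hp : IsEffectiveCartier (I.comap p))
    (hw : IsEffectiveCartier (I.comap w)) (i : σ) :
    h ⁻¹ᵁ chartLocus p f i = chartLocus w f i := by
  have hpw : ∀ {x}, h x ∈ p ⁻¹ᵁ U ↔ x ∈ w ⁻¹ᵁ U := fun {x} => by subst hhw; rfl
  apply le_antisymm
  · intro x hx
    have hx : h x ∈ chartLocus p f i := hx
    obtain ⟨V, hV, hxV, e, h1, h2⟩ := mem_chartLocus.mp hx
    have hxU : x ∈ w ⁻¹ᵁ U := hpw.mp (e hxV)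
    rw [← iSup_chartLocus hf hw] at hxU
    obtain ⟨m, hm⟩ := TopologicalSpace.Opens.mem_iSup.mp hxU
    obtain ⟨V', hV', hxV', hle, e', h1', h2'⟩ := exists_chartLocus_affine hm (O := h ⁻¹ᵁ V) hxV
    obtain ⟨b, hb⟩ := h2' i
    have hd : ∀ j, (w.appLE U V' e').hom (f i) ∣ (w.appLE U V' e').hom (f j) := fun j => by
      rw [← appLE_comp_apply h p hhw e hle e', ← appLE_comp_apply h p hhw e hle e']
      exact map_dvd _ (h2 j)
    obtain ⟨c, hc⟩ := hd m
    have hbc : b * c = 1 := by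
      refine (mul_cancel_left_mem_nonZeroDivisors h1').mp ?_
      rw [mul_one, ← mul_assoc, ← hb, ← hc]
    refine mem_chartLocus.mpr ⟨V', hV', hxV', e', ?_, hd⟩
    rw [hb]
    exact mul_mem h1' (IsUnit.of_mul_eq_one c hbc).mem_nonZeroDivisors
  · intro x hx
    change h x ∈ chartLocus p f i
    have hxU : h x ∈ p ⁻¹ᵁ U := hpw.mpr (chartLocus_le hx)
    rw [← iSup_chartLocus hf hp] at hxU
    obtain ⟨m, hm⟩ := TopologicalSpace.Opens.mem_iSup.mp hxU
    obtain ⟨V, hV, hxV, e, h1, h2⟩ := mem_chartLocus.mp hm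
    obtain ⟨V', hV', hxV', hle, e', h1', h2'⟩ := exists_chartLocus_affine hx (O := h ⁻¹ᵁ V) hxV
    obtain ⟨b, hb⟩ := h2 i
    obtain ⟨c, hc⟩ := h2' m
    have hb' := congrArg (h.appLE V V' hle).hom hb
    rw [map_mul, appLE_comp_apply h p hhw e hle e', appLE_comp_apply h p hhw e hle e', hc] at hb'
    have hcb : c * (h.appLE V V' hle).hom b = 1 := by
      refine (mul_cancel_left_mem_nonZeroDivisors h1').mp ?_
      rw [mul_one, ← mul_assoc]
      exact hb'.symm
    have hub : x ∈ W.basicOpen ((h.appLE V V' hle).hom b) := by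
      rw [Scheme.basicOpen_of_isUnit _ (IsUnit.of_mul_eq_one_right c hcb)]
      exact hxV'
    rw [Scheme.basicOpen_appLE] at hub
    exact mem_chartLocus_of_isUnit hV e h1 h2 (by rw [hb, mul_comm]) hub.2

/-- A section which locally is a nonzerodivisor cancels. -/
lemma eq_zero_of_locally_nonZeroDivisor {W : Scheme.{u}} {D O : W.Opens} (hOD : O ≤ D) (a : Γ(W, D))
    (h : ∀ x ∈ D, ∃ (V : W.Opens) (_ : IsAffineOpen V) (_ : x ∈ V) (e : V ≤ D),
      (W.presheaf.map (homOfLE e).op).hom a ∈ nonZeroDivisors Γ(W, V)) (s : Γ(W, O))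
    (hs : (W.presheaf.map (homOfLE hOD).op).hom a * s = 0) : s = 0 := by
  refine W.IsSheaf.section_ext fun x hx => ?_
  obtain ⟨V, hV, hxV, e, hVa⟩ := h x (hOD hx)
  obtain ⟨V', hV', hxV', hle⟩ := exists_affine_le (O := V ⊓ O) ⟨hxV, hx⟩
  have h1 : V' ≤ V := hle.trans inf_le_left
  have h2 : V' ≤ O := hle.trans inf_le_right
  refine ⟨V', h2, hxV', ?_⟩
  have h3 := map_mem_nonZeroDivisors hV hV' h1 hVa
  have h4 := congrArg (W.presheaf.map (homOfLE h2).op).hom hs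
  have e1 : (W.presheaf.map (homOfLE h2).op).hom ((W.presheaf.map (homOfLE hOD).op).hom a) =
      (W.presheaf.map (homOfLE h1).op).hom ((W.presheaf.map (homOfLE e).op).hom a) := by
    rw [← CommRingCat.comp_apply, ← CommRingCat.comp_apply, ← Functor.map_comp, ← Functor.map_comp]
    rfl
  rw [map_mul, map_zero, e1] at h4
  exact ((mem_nonZeroDivisors_iff.mp h3).1 _ h4).trans (map_zero _).symm

/-- Local quotients by a local nonzerodivisor are unique, so they agree on overlaps and glue. -/
lemma dvd_of_locally {W : Scheme.{u}} {D : W.Opens} (a b : Γ(W, D))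
    (h : ∀ x ∈ D, ∃ (V : W.Opens) (_ : IsAffineOpen V) (_ : x ∈ V) (e : V ≤ D),
      (W.presheaf.map (homOfLE e).op).hom a ∈ nonZeroDivisors Γ(W, V) ∧
      (W.presheaf.map (homOfLE e).op).hom a ∣ (W.presheaf.map (homOfLE e).op).hom b) : a ∣ b := by
  choose V hV hxV e h1 h2 using fun x : D => h x.1 x.2
  choose c hc using h2
  have hcov : D ≤ iSup V := fun x hx => TopologicalSpace.Opens.mem_iSup.mpr ⟨⟨x, hx⟩, hxV _⟩
  have hnz : ∀ x ∈ D, ∃ (V : W.Opens) (_ : IsAffineOpen V) (_ : x ∈ V) (e : V ≤ D),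
      (W.presheaf.map (homOfLE e).op).hom a ∈ nonZeroDivisors Γ(W, V) :=
    fun x hx => ⟨V ⟨x, hx⟩, hV _, hxV _, e _, h1 _⟩
  have comp : ∀ {V₁ V₂ V₃ : W.Opens} (h₁ : V₂ ≤ V₁) (h₂ : V₃ ≤ V₂) (t : Γ(W, V₁)),
      (W.presheaf.map (homOfLE h₂).op).hom ((W.presheaf.map (homOfLE h₁).op).hom t) =
        (W.presheaf.map (homOfLE (h₂.trans h₁)).op).hom t := fun h₁ h₂ t => by
    rw [← CommRingCat.comp_apply, ← Functor.map_comp]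
    rfl
  obtain ⟨s, hs, -⟩ := W.sheaf.existsUnique_gluing' V D (fun x => homOfLE (e x)) hcov c (by
    intro x y
    have e1 := congrArg (W.presheaf.map (homOfLE (inf_le_left : V x ⊓ V y ≤ V x)).op).hom (hc x)
    have e2 := congrArg (W.presheaf.map (homOfLE (inf_le_right : V x ⊓ V y ≤ V y)).op).hom (hc y)
    rw [map_mul, comp, comp] at e1 e2
    have e3 : (W.presheaf.map (homOfLE ((inf_le_left : V x ⊓ V y ≤ V x).trans (e x))).op).hom a *
        ((W.presheaf.map (homOfLE (inf_le_left : V x ⊓ V y ≤ V x)).op).hom (c x) -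
          (W.presheaf.map (homOfLE (inf_le_right : V x ⊓ V y ≤ V y)).op).hom (c y)) = 0 := by
      rw [mul_sub, sub_eq_zero]
      exact e1.symm.trans e2
    exact sub_eq_zero.mp (eq_zero_of_locally_nonZeroDivisor _ a hnz _ e3))
  let s' : Γ(W, D) := s
  refine ⟨s', sub_eq_zero.mp ?_⟩
  refine eq_zero_of_locally_nonZeroDivisor le_rfl 1 (fun x hx =>
    ⟨V ⟨x, hx⟩, hV _, hxV _, e _, by rw [map_one]; exact one_mem _⟩) _ ?_
  rw [map_one, one_mul]
  refine W.IsSheaf.section_ext fun x hx => ⟨V ⟨x, hx⟩, e _, hxV _, ?_⟩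
  have h3 : (W.presheaf.map (homOfLE (e ⟨x, hx⟩)).op).hom s' = c ⟨x, hx⟩ := hs ⟨x, hx⟩
  change (W.presheaf.map (homOfLE (e ⟨x, hx⟩)).op).hom (b - a * s') =
    (W.presheaf.map (homOfLE (e ⟨x, hx⟩)).op).hom 0
  rw [map_sub, map_mul, h3, hc, sub_self, map_zero]

end ChartHom

end Motivic

namespace Motivic

/-! ### Standard charts of a blow-up -/

section BlowUpCharts

variable {S : Scheme.{u}} {U : S.Opens} {σ : Type*}

lemma SpecMap_fromSpec_appLE (hU : IsAffineOpen U) {B : CommRingCat.{u}} (φ : Γ(S, U) ⟶ B)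
    (h : ⊤ ≤ (Spec.map φ ≫ hU.fromSpec) ⁻¹ᵁ U) :
    (Spec.map φ ≫ hU.fromSpec).appLE U ⊤ h = φ ≫ (Scheme.ΓSpecIso B).inv := by
  have h1 : hU.fromSpec.appLE U ⊤ (by rw [hU.fromSpec_preimage_self]) =
      (Scheme.ΓSpecIso Γ(S, U)).inv := by
    rw [Scheme.Hom.appLE, hU.fromSpec_app_self, Category.assoc, ← Functor.map_comp]
    exact (congrArg _ ((Spec Γ(S, U)).presheaf.map_id _)).trans (Category.comp_id _)
  rw [← Scheme.Hom.appLE_comp_appLE (Spec.map φ) hU.fromSpec U ⊤ ⊤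
    (by rw [hU.fromSpec_preimage_self]) le_top, h1, Scheme.ΓSpecIso_inv_naturality]
  congr 1

section Abstract

variable (hU : IsAffineOpen U) {B : CommRingCat.{u}} (φ : Γ(S, U) ⟶ B)

lemma top_le_SpecMap_fromSpec_preimage : ⊤ ≤ (Spec.map φ ≫ hU.fromSpec) ⁻¹ᵁ U := by
  rw [Scheme.Hom.comp_preimage, hU.fromSpec_preimage_self]
  exact le_rfl

variable {f : σ → Γ(S, U)} {i : σ} {g : σ → B}

lemma SpecMap_appLE_mem (hφ : φ.hom (f i) ∈ nonZeroDivisors B) :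
    ((Spec.map φ ≫ hU.fromSpec).appLE U ⊤ (top_le_SpecMap_fromSpec_preimage hU φ)).hom (f i) ∈
      nonZeroDivisors Γ(Spec B, ⊤) := by
  rw [SpecMap_fromSpec_appLE]
  have := MulEquivClass.map_nonZeroDivisors (Scheme.ΓSpecIso B).symm.commRingCatIsoToRingEquiv
  rw [← this]
  exact ⟨φ.hom (f i), hφ, rfl⟩

lemma SpecMap_appLE_eq (hg : ∀ j, φ.hom (f i) * g j = φ.hom (f j)) (j : σ) :
    ((Spec.map φ ≫ hU.fromSpec).appLE U ⊤ (top_le_SpecMap_fromSpec_preimage hU φ)).hom (f j) =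
      (Scheme.ΓSpecIso B).inv.hom (g j) *
      ((Spec.map φ ≫ hU.fromSpec).appLE U ⊤ (top_le_SpecMap_fromSpec_preimage hU φ)).hom (f i) := by
  rw [SpecMap_fromSpec_appLE, CommRingCat.hom_comp, RingHom.comp_apply, RingHom.comp_apply, ← hg j,
    map_mul, mul_comm]

lemma isEffectiveCartier_comap_SpecMap (hφ : φ.hom (f i) ∈ nonZeroDivisors B)
    (hg : ∀ j, φ.hom (f i) * g j = φ.hom (f j)) {I : S.IdealSheafData}
    (hf : I.ideal ⟨U, hU⟩ = Ideal.span (Set.range f)) :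
    IsEffectiveCartier (I.comap (Spec.map φ ≫ hU.fromSpec)) := by
  intro x
  refine ⟨⟨⊤, isAffineOpen_top _⟩, trivial, _, SpecMap_appLE_mem hU φ hφ, ?_⟩
  rw [comap_ideal_eq_map_appLE (Spec.map φ ≫ hU.fromSpec) I ⟨⊤, isAffineOpen_top _⟩ ⟨U, hU⟩
    (top_le_SpecMap_fromSpec_preimage hU φ), hf, Ideal.map_span, ← Set.range_comp]
  apply le_antisymm
  · rw [Ideal.span_le]
    rintro _ ⟨j, rfl⟩
    rw [Function.comp_apply, SpecMap_appLE_eq hU φ hg j]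
    exact Ideal.mul_mem_left _ _ (Ideal.mem_span_singleton_self _)
  · rw [Ideal.span_singleton_le_iff_mem]
    exact Ideal.subset_span ⟨i, rfl⟩

/-- Here `f_i` generates the pulled-back ideal and `f_j = g_j f_i`, so `f_j` generates it near a
point exactly when `g_j` is invertible there. -/
lemma mem_chartLocus_SpecMap (hφ : φ.hom (f i) ∈ nonZeroDivisors B)
    (hg : ∀ j, φ.hom (f i) * g j = φ.hom (f j)) (j : σ) (x : Spec B) :
    x ∈ chartLocus (Spec.map φ ≫ hU.fromSpec) f j ↔ x ∈ PrimeSpectrum.basicOpen (g j) := by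
  have hb : (Spec B).basicOpen ((Scheme.ΓSpecIso B).inv.hom (g j)) =
      PrimeSpectrum.basicOpen (g j) := basicOpen_eq_of_affine (g j)
  rw [← hb]
  constructor
  · intro hx
    obtain ⟨V, hV, hxV, h, h1, h2⟩ := mem_chartLocus.mp hx
    obtain ⟨b, hb⟩ := h2 i
    have h0 := map_mem_nonZeroDivisors (isAffineOpen_top _) hV le_top (SpecMap_appLE_mem hU φ hφ)
    have e1 := congrArg ((Spec B).presheaf.map
      (homOfLE (le_top : V ≤ ⊤)).op).hom (SpecMap_appLE_eq hU φ hg j)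
    rw [map_mul, map_appLE_apply, map_appLE_apply] at e1
    rw [map_appLE_apply] at h0
    rw [e1] at hb
    set t := ((Spec B).presheaf.map (homOfLE (le_top : V ≤ ⊤)).op).hom
      ((Scheme.ΓSpecIso B).inv.hom (g j)) with ht
    have htb : t * b = 1 := by
      refine (mul_cancel_right_mem_nonZeroDivisors h0).mp ?_
      rw [one_mul]
      nth_rw 2 [hb]
      ring
    have hxt : x ∈ (Spec B).basicOpen t := by
      rw [Scheme.basicOpen_of_isUnit _ (IsUnit.of_mul_eq_one b htb)]
      exact hxV
    rw [ht, Scheme.basicOpen_res] at hxt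
    exact hxt.2
  · intro hx
    refine mem_chartLocus_of_isUnit (isAffineOpen_top _)
      (top_le_SpecMap_fromSpec_preimage hU φ) (SpecMap_appLE_mem hU φ hφ) (fun l => ?_)
      (SpecMap_appLE_eq hU φ hg j) hx
    exact Dvd.intro_left _ (SpecMap_appLE_eq hU φ hg l).symm

end Abstract

/-- The structure morphism of the `i`-th standard chart of the blow-up. -/
noncomputable def chartMap (hU : IsAffineOpen U) (f : σ → Γ(S, U)) (i : σ) :
    Spec (CommRingCat.of (blowUpChart f i)) ⟶ S :=
  Spec.map (CommRingCat.ofHom (algebraMap Γ(S, U) (blowUpChart f i))) ≫ hU.fromSpec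

lemma isEffectiveCartier_chartMap {I : S.IdealSheafData} (hU : IsAffineOpen U) {f : σ → Γ(S, U)}
    (hf : I.ideal ⟨U, hU⟩ = Ideal.span (Set.range f)) (i : σ) :
    IsEffectiveCartier (I.comap (chartMap hU f i)) :=
  isEffectiveCartier_comap_SpecMap hU _ (blowUpChart.mem_nonZeroDivisors f i)
    (g := blowUpChart.frac f i) (blowUpChart.mul_frac f i) hf

lemma mem_chartLocus_chartMap (hU : IsAffineOpen U) (f : σ → Γ(S, U)) (i j : σ)
    (x : Spec (CommRingCat.of (blowUpChart f i))) :
    x ∈ chartLocus (chartMap hU f i) f j ↔ x ∈ PrimeSpectrum.basicOpen (blowUpChart.frac f i j) :=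
  mem_chartLocus_SpecMap hU (B := CommRingCat.of (blowUpChart f i))
    (CommRingCat.ofHom (algebraMap Γ(S, U) (blowUpChart f i)))
    (blowUpChart.mem_nonZeroDivisors f i)
    (g := blowUpChart.frac f i) (blowUpChart.mul_frac f i) j x

/-- The open set `D` need not be affine. The hypotheses of `blowUpChart.exists_lift` for its ring of
sections are therefore glued from small affine opens. -/
lemma exists_hom_chart (hU : IsAffineOpen U) (f : σ → Γ(S, U)) (i : σ) {W : Scheme.{u}} (w : W ⟶ S)
    {D : W.Opens} (hD : D ≤ chartLocus w f i) :
    ∃ d : D.toScheme ⟶ Spec (CommRingCat.of (blowUpChart f i)), d ≫ chartMap hU f i = D.ι ≫ w := by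
  have h : D ≤ w ⁻¹ᵁ U := hD.trans chartLocus_le
  let ρ : Γ(S, U) →+* Γ(W, D) := (w.appLE U D h).hom
  have hloc : ∀ x ∈ D, ∃ (V : W.Opens) (_ : IsAffineOpen V) (_ : x ∈ V) (e : V ≤ D),
      (W.presheaf.map (homOfLE e).op).hom (ρ (f i)) ∈ nonZeroDivisors Γ(W, V) ∧
      ∀ j, (W.presheaf.map (homOfLE e).op).hom (ρ (f i)) ∣
        (W.presheaf.map (homOfLE e).op).hom (ρ (f j)) := by
    intro x hx
    obtain ⟨V, hV, hxV, hle, e, h1, h2⟩ := exists_chartLocus_affine (hD hx) hx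
    refine ⟨V, hV, hxV, hle, ?_, fun j => ?_⟩
    · rw [map_appLE_apply w h hle]; exact h1
    · rw [map_appLE_apply w h hle, map_appLE_apply w h hle]; exact h2 j
  have hnz : ρ (f i) ∈ nonZeroDivisors Γ(W, D) := by
    rw [mem_nonZeroDivisors_iff]
    suffices h' : ∀ a, ρ (f i) * a = 0 → a = 0 from
      And.intro (fun a ha => h' a ha) (fun a ha => h' a (by rwa [mul_comm]))
    intro a ha
    refine eq_zero_of_locally_nonZeroDivisor le_rfl (ρ (f i)) (fun x hx => ?_) a ?_
    · obtain ⟨V, hV, hxV, hle, h1, -⟩ := hloc x hx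
      exact ⟨V, hV, hxV, hle, h1⟩
    · have : (W.presheaf.map (homOfLE (le_refl D)).op) = 𝟙 _ := W.presheaf.map_id _
      rw [this]
      exact ha
  have hI : (Ideal.span (Set.range f)).map ρ ≤ Ideal.span {ρ (f i)} := by
    rw [Ideal.map_span, Ideal.span_le]
    rintro _ ⟨_, ⟨j, rfl⟩, rfl⟩
    rw [SetLike.mem_coe, Ideal.mem_span_singleton]
    refine dvd_of_locally _ _ fun x hx => ?_
    obtain ⟨V, hV, hxV, hle, h1, h2⟩ := hloc x hx
    exact ⟨V, hV, hxV, hle, h1, h2 j⟩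
  obtain ⟨τ, hτ⟩ := blowUpChart.exists_lift f i ρ hnz hI
  refine ⟨D.toSpecΓ ≫ Spec.map (CommRingCat.ofHom τ), ?_⟩
  rw [chartMap, Category.assoc, ← Spec.map_comp_assoc, ← CommRingCat.ofHom_comp, hτ]
  change D.toSpecΓ ≫ Spec.map (w.appLE U D h) ≫ hU.fromSpec = _
  rw [Scheme.Opens.toSpecΓ_SpecMap_appLE_assoc, hU.toSpecΓ_fromSpec, Scheme.Hom.resLE_comp_ι]

/-- Such an endomorphism is a ring endomorphism fixing the image of `Γ(S, U)`, and fractions by a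
nonzerodivisor are determined by their numerators. -/
lemma chart_end_eq_id (hU : IsAffineOpen U) (f : σ → Γ(S, U)) (i : σ)
    (e : Spec (CommRingCat.of (blowUpChart f i)) ⟶ Spec (CommRingCat.of (blowUpChart f i)))
    (he : e ≫ chartMap hU f i = chartMap hU f i) : e = 𝟙 _ := by
  obtain ⟨τ, rfl⟩ := Spec.map_surjective e
  rw [chartMap, ← Category.assoc, cancel_mono, ← Spec.map_comp] at he
  have h1 := Spec.map_injective he
  rw [← Spec.map_id]
  congr 1
  ext1
  refine blowUpChart.hom_ext f i (algebraMap Γ(S, U) (blowUpChart f i))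
    (blowUpChart.mem_nonZeroDivisors f i) ?_ rfl
  exact congrArg CommRingCat.Hom.hom h1

/-- The standard charts of a blow-up. -/
theorem IsBlowUp.exists_chart {T : Scheme.{u}} {p : T ⟶ S} {I : S.IdealSheafData}
    (hp : IsBlowUp p I) (hU : IsAffineOpen U) [Finite σ] {f : σ → Γ(S, U)}
    (hf : I.ideal ⟨U, hU⟩ = Ideal.span (Set.range f)) :
    ∃ c : ∀ i, Spec (CommRingCat.of (blowUpChart f i)) ⟶ T,
      (∀ i, IsOpenImmersion (c i)) ∧ (∀ i, c i ≫ p = chartMap hU f i) ∧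
      (⋃ i, Set.range (c i)) = p ⁻¹' U ∧
      ∀ i j x, c i x ∈ Set.range (c j) ↔
        x ∈ PrimeSpectrum.basicOpen (blowUpChart.frac f i j) := by
  have hC := fun i => isEffectiveCartier_chartMap hU hf i
  choose c hc hcu using fun i => hp.existsUnique_lift (chartMap hU f i) (hC i)
  have hpre : ∀ i j, c i ⁻¹ᵁ chartLocus p f j = chartLocus (chartMap hU f i) f j := fun i j =>
    preimage_chartLocus hf (c i) p (hc i) hp.cartier (hC i) j
  have hmem : ∀ i x, c i x ∈ chartLocus p f i := fun i x => by
    change x ∈ c i ⁻¹ᵁ chartLocus p f i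
    rw [hpre, mem_chartLocus_chartMap, blowUpChart.frac_self, PrimeSpectrum.basicOpen_one]
    trivial
  -- The chart is identified with the open chart locus `D` of `T`. The inverse `d` comes from the
  -- universal property of the chart ring; one composite is the identity by rigidity of the chart,
  -- the other by uniqueness of lifts to `T`.
  have key : ∀ i, IsOpenImmersion (c i) ∧ Set.range (c i) = chartLocus p f i := by
    intro i
    let D := chartLocus p f i
    obtain ⟨d, hd⟩ := exists_hom_chart hU f i p (le_refl D)
    let c' := IsOpenImmersion.lift D.ι (c i) (by
      rintro _ ⟨x, rfl⟩
      rw [Scheme.Opens.range_ι]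
      exact hmem i x)
    have hc' : c' ≫ D.ι = c i := IsOpenImmersion.lift_fac _ _ _
    have h1 : c' ≫ d = 𝟙 _ := chart_end_eq_id hU f i _ (by
      rw [Category.assoc, hd, ← Category.assoc, hc', hc])
    have h2 : d ≫ c i = D.ι := by
      have hcD : IsEffectiveCartier (I.comap (D.ι ≫ p)) := by
        rw [Scheme.IdealSheafData.comap_comp]
        exact hp.cartier.comap_of_flat D.ι
      exact (hp.existsUnique_lift (D.ι ≫ p) hcD).unique
        (by rw [Category.assoc, hc, hd]) rfl
    have h3 : d ≫ c' = 𝟙 _ := by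
      rw [← cancel_mono D.ι, Category.assoc, hc', h2, Category.id_comp]
    have : IsIso c' := ⟨d, h1, h3⟩
    rw [← hc']
    refine ⟨inferInstance, ?_⟩
    rw [Scheme.Hom.comp_base, TopCat.coe_comp,
      Set.range_comp, Set.range_eq_univ.mpr c'.surjective, Set.image_univ, Scheme.Opens.range_ι]
  refine ⟨c, fun i => (key i).1, hc, ?_, fun i j x => ?_⟩
  · simp_rw [fun i => (key i).2]
    rw [← TopologicalSpace.Opens.coe_iSup, iSup_chartLocus hf hp.cartier]
    rfl
  · rw [(key j).2]
    rw [SetLike.mem_coe, ← mem_chartLocus_chartMap hU, ← hpre]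
    rfl

end BlowUpCharts

end Motivic

namespace Motivic

/-! ### Cut-and-paste relations in the Grothendieck ring -/

section GrothendieckRelations

variable {k : Type u} [Field k]

lemma k0Class_eq_of_iso {X Y : Sch k} [IsFiniteType X] [IsFiniteType Y] (e : X ≅ Y) :
    k0Class X = k0Class Y :=
  Ideal.Quotient.eq.mpr (Ideal.subset_span (K0Rel.iso X Y e))

lemma k0Class_cut {X U Z : Sch k} [IsFiniteType X] [IsFiniteType U] [IsFiniteType Z]
    (j : U ⟶ X) (i : Z ⟶ X) [IsOpenImmersion j.left] [IsClosedImmersion i.left]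
    (h : Set.range j.left = (Set.range i.left)ᶜ) : k0Class X = k0Class U + k0Class Z := by
  rw [k0Class, k0Class, k0Class, ← map_add]
  exact Ideal.Quotient.eq.mpr (Ideal.subset_span (K0Rel.cut X U Z j i inferInstance inferInstance h))

lemma k0Class_prod (X Y : Sch k) [IsFiniteType X] [IsFiniteType Y] :
    k0Class (prod X Y) = k0Class X * k0Class Y := by
  rw [k0Class, k0Class, k0Class, ← map_mul]
  exact Ideal.Quotient.eq.mpr (Ideal.subset_span (K0Rel.prod X Y))

lemma isFiniteType_of_immersion {C M : Sch k} [IsFiniteType M] (s : C ⟶ M) [IsImmersion s.left] :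
    IsFiniteType C := by
  have e : s.left ≫ M.hom = C.hom := Over.w s
  have : IsLocallyNoetherian M.left := LocallyOfFiniteType.isLocallyNoetherian M.hom
  have : CompactSpace M.left := QuasiCompact.compactSpace_of_compactSpace M.hom
  have : IsNoetherian M.left := {}
  have : TopologicalSpace.NoetherianSpace C.left :=
    s.left.isEmbedding.isInducing.noetherianSpace
  constructor
  · rw [← e]; infer_instance
  · exact (quasiCompact_iff_compactSpace (f := C.hom)).mpr inferInstance

/-- The open subscheme `V` of `M` as a scheme over `k`. -/
noncomputable def opn (M : Sch k) (V : M.left.Opens) : Sch k := Over.mk (V.ι ≫ M.hom)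

/-- The inclusion of an open subscheme. -/
noncomputable def opnι (M : Sch k) (V : M.left.Opens) : opn M V ⟶ M := Over.homMk V.ι

instance (M : Sch k) (V : M.left.Opens) : IsOpenImmersion (opnι M V).left :=
  inferInstanceAs (IsOpenImmersion V.ι)

instance opn_isFiniteType (M : Sch k) [IsFiniteType M] (V : M.left.Opens) :
    IsFiniteType (opn M V) :=
  isFiniteType_of_immersion (opnι M V)

lemma isClosedImmersion_of_isClosed_range {X Y : Scheme.{u}} (f : X ⟶ Y) [IsImmersion f]
    (h : IsClosed (Set.range f)) : IsClosedImmersion f :=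
  .of_isPreimmersion f h

/-- Cutting out a locally closed piece, given as an immersion. -/
lemma k0Class_opn_eq_add {M C : Sch k} [IsFiniteType M] [IsFiniteType C] (s : C ⟶ M)
    [IsImmersion s.left] (U V : M.left.Opens) (hUV : U ≤ V)
    (h : Set.range s.left = (V : Set M.left) \ U) :
    k0Class (opn M V) = k0Class (opn M U) + k0Class C := by
  let j : opn M U ⟶ opn M V := Over.homMk (M.left.homOfLE hUV) (by simp [opn])
  have hj : IsOpenImmersion j.left := inferInstanceAs (IsOpenImmersion (M.left.homOfLE hUV))
  let s' : C.left ⟶ V := IsOpenImmersion.lift V.ι s.left (by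
    rw [Scheme.Opens.range_ι, h]; exact Set.sdiff_subset)
  have hs' : s' ≫ V.ι = s.left := IsOpenImmersion.lift_fac _ _ _
  let i : C ⟶ opn M V := Over.homMk s' (by
    change s' ≫ V.ι ≫ M.hom = C.hom
    rw [← Category.assoc, hs', Over.w s])
  have him : IsImmersion s' := by
    have : IsImmersion (s' ≫ V.ι) := by rw [hs']; infer_instance
    exact IsImmersion.of_comp s' V.ι
  have hr : Set.range s' = (Set.range (M.left.homOfLE hUV))ᶜ := by
    ext x
    have h1 : x ∈ Set.range s' ↔ V.ι x ∈ Set.range s.left := by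
      rw [← hs']
      constructor
      · rintro ⟨y, rfl⟩; exact ⟨y, rfl⟩
      · rintro ⟨y, hy⟩; exact ⟨y, V.ι.isOpenEmbedding.injective hy⟩
    have hcomp : ∀ y : U.toScheme, V.ι (M.left.homOfLE hUV y) = U.ι y := fun y => by
      rw [← Scheme.Hom.comp_apply, Scheme.homOfLE_ι]
    have h2 : x ∈ Set.range (M.left.homOfLE hUV) ↔ V.ι x ∈ U := by
      constructor
      · rintro ⟨y, rfl⟩
        rw [hcomp]
        exact y.2
      · intro hx
        exact ⟨⟨V.ι x, hx⟩, V.ι.isOpenEmbedding.injective (hcomp _)⟩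
    rw [h1, Set.mem_compl_iff, h2, h]
    exact ⟨fun hx => hx.2, fun hx => ⟨x.2, hx⟩⟩
  have hi : IsClosedImmersion i.left := by
    refine isClosedImmersion_of_isClosed_range s' ?_
    rw [hr]
    exact (M.left.homOfLE hUV).isOpenEmbedding.isOpen_range.isClosed_compl
  refine k0Class_cut j i ?_
  change Set.range (M.left.homOfLE hUV) = (Set.range s')ᶜ
  rw [hr, compl_compl]

lemma k0Class_opn_top (M : Sch k) [IsFiniteType M] : k0Class (opn M ⊤) = k0Class M :=
  k0Class_eq_of_iso (Over.isoMk M.left.topIso (by simp [opn]))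

/-- The identity of an empty scheme is both an open immersion and the closed immersion of its
complement, so the class equals twice itself. -/
lemma k0Class_of_isEmpty (M : Sch k) [IsFiniteType M] [IsEmpty M.left] : k0Class M = 0 := by
  have h := k0Class_cut (𝟙 M) (𝟙 M) (Set.ext fun x => isEmptyElim x)
  simpa using h

/-- `Spec B` as a scheme over `k`. -/
noncomputable def specOver {B : Type u} [CommRing B] (β : k →+* B) : Sch k :=
  Over.mk (Spec.map (CommRingCat.ofHom β))

lemma isFiniteType_specOver {B : Type u} [CommRing B] (β : k →+* B) (hβ : β.FiniteType) :
    IsFiniteType (specOver β) where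
  locallyOfFiniteType := (HasRingHomProperty.Spec_iff (P := @LocallyOfFiniteType)).mpr hβ
  quasiCompact := inferInstanceAs (QuasiCompact (Spec.map _))

lemma finiteType_of_isFiniteType_specOver {B : Type u} [CommRing B] (β : k →+* B)
    [h : IsFiniteType (specOver β)] : β.FiniteType :=
  (HasRingHomProperty.Spec_iff (P := @LocallyOfFiniteType)).mp h.locallyOfFiniteType

instance isFiniteType_specOver_mvPolynomial {B : Type u} [CommRing B] (β : k →+* B) 
    [IsFiniteType (specOver β)] {σ : Type} [Finite σ] :
    IsFiniteType (specOver ((MvPolynomial.C (σ := σ)).comp β)) :=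
  isFiniteType_specOver _ (RingHom.FiniteType.comp
    (RingHom.finiteType_algebraMap.mpr (inferInstance :
      Algebra.FiniteType B (MvPolynomial σ B))) (finiteType_of_isFiniteType_specOver β))

lemma k0Class_specOver_ringEquiv {B C : Type u} [CommRing B] [CommRing C] (β : k →+* B)
    (γ : k →+* C) [IsFiniteType (specOver β)] [IsFiniteType (specOver γ)] (e : B ≃+* C)
    (h : (e : B →+* C).comp β = γ) : k0Class (specOver β) = k0Class (specOver γ) := by
  refine k0Class_eq_of_iso (Over.isoMk (Scheme.Spec.mapIso e.toCommRingCatIso.op).symm ?_)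
  subst h
  change Spec.map (CommRingCat.ofHom (e.symm : C →+* B)) ≫ Spec.map (CommRingCat.ofHom _) =
    Spec.map (CommRingCat.ofHom _)
  rw [← Spec.map_comp]
  congr 1
  ext x
  exact e.symm_apply_apply _

lemma k0Class_specOver_affineLine {B : Type u} [CommRing B] (β : k →+* B)
    [IsFiniteType (specOver β)]
    [IsFiniteType (specOver ((MvPolynomial.C (σ := ULift.{u} (Fin 1))).comp β))] :
    k0Class (specOver ((MvPolynomial.C (σ := ULift.{u} (Fin 1))).comp β)) =
      lefschetz k * k0Class (specOver β) := by
  rw [lefschetz, mul_comm, ← k0Class_prod]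
  have h := AffineSpace.isPullback_map (n := ULift.{u} (Fin 1)) (Spec.map (CommRingCat.ofHom β))
  have h' := h.flip
  refine k0Class_eq_of_iso (Over.isoMk
    ((AffineSpace.SpecIso (ULift.{u} (Fin 1)) (CommRingCat.of B)).symm ≪≫ h'.isoPullback) ?_)
  change ((AffineSpace.SpecIso (ULift.{u} (Fin 1)) (CommRingCat.of B)).inv ≫ h'.isoPullback.hom) ≫
    Limits.pullback.fst _ _ ≫ Spec.map (CommRingCat.ofHom β) = Spec.map (CommRingCat.ofHom _)
  rw [Category.assoc, IsPullback.isoPullback_hom_fst_assoc, AffineSpace.SpecIso_inv_over_assoc,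
    ← Spec.map_comp]
  rfl

/-- Peel off one variable at a time; the lifted index type `ULift (Fin 1)` matches the definition of
`affineLine`. -/
lemma k0Class_specOver_mvPolynomial_fin {B : Type u} [CommRing B] (β : k →+* B)
    [IsFiniteType (specOver β)] (n : ℕ) :
    k0Class (specOver ((MvPolynomial.C (σ := Fin n)).comp β)) =
      lefschetz k ^ n * k0Class (specOver β) := by
  induction n with
  | zero =>
    rw [pow_zero, one_mul]
    refine (k0Class_specOver_ringEquiv _ _ (MvPolynomial.isEmptyRingEquiv B (Fin 0)).symm ?_).symm
    rfl
  | succ n ih =>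
    let β' : k →+* MvPolynomial (Fin n) B := (MvPolynomial.C).comp β
    have hft : IsFiniteType (specOver ((MvPolynomial.C (σ := ULift.{u} (Fin 1))).comp β')) :=
      isFiniteType_specOver _ (RingHom.FiniteType.comp
        (RingHom.finiteType_algebraMap.mpr (inferInstance :
          Algebra.FiniteType (MvPolynomial (Fin n) B)
            (MvPolynomial (ULift.{u} (Fin 1)) (MvPolynomial (Fin n) B))))
        (finiteType_of_isFiniteType_specOver β'))
    have e : Fin (n + 1) ≃ ULift.{u} (Fin 1) ⊕ Fin n :=
      (finCongr (add_comm n 1)).trans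
        (finSumFinEquiv.symm.trans (Equiv.sumCongr Equiv.ulift.symm (Equiv.refl _)))
    rw [pow_succ', mul_assoc, ← ih, ← k0Class_specOver_affineLine β']
    refine k0Class_specOver_ringEquiv _ _ ((MvPolynomial.renameEquiv B e).trans
      (MvPolynomial.sumAlgEquiv B (ULift.{u} (Fin 1)) (Fin n))).toRingEquiv ?_
    ext x
    simp [β']

lemma k0Class_specOver_mvPolynomial {B : Type u} [CommRing B] (β : k →+* B)
    [IsFiniteType (specOver β)] {σ : Type} [Finite σ] :
    k0Class (specOver ((MvPolynomial.C (σ := σ)).comp β)) =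
      lefschetz k ^ Nat.card σ * k0Class (specOver β) := by
  rw [← k0Class_specOver_mvPolynomial_fin]
  refine k0Class_specOver_ringEquiv _ _
    (MvPolynomial.renameEquiv B (Finite.equivFin σ)).toRingEquiv ?_
  ext x
  simp

end GrothendieckRelations

end Motivic

namespace Motivic

/-! ### Cell decomposition of projective bundles -/

section Bundle

variable {k : Type u} [Field k]

/-- A scheme which is stratified by the charts of a projective bundle over `Spec B`. -/
lemma k0Class_opn_projective_strata {M : Sch k} [IsFiniteType M] {B : Type u} [CommRing B]
    (β : k →+* B) [IsFiniteType (specOver β)] {m : ℕ}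
    (e : ∀ j : Fin m, specOver ((MvPolynomial.C (σ := {l : Fin m // l ≠ j})).comp β) ⟶ M)
    [he : ∀ j, IsImmersion (e j).left] (O : M.left.Opens) (V : Fin m → M.left.Opens)
    (hV : ∀ j, Set.range (e j).left = (V j : Set M.left) \ O)
    (hx : ∀ (j : Fin m) (l : {l : Fin m // l ≠ j}) (x : PrimeSpectrum (MvPolynomial _ B)),
      (e j).left x ∈ V l ↔ x ∈ PrimeSpectrum.basicOpen (MvPolynomial.X l)) :
    k0Class (opn M (O ⊔ ⨆ j, V j)) =
      k0Class (opn M O) + (∑ j ∈ Finset.range m, lefschetz k ^ j) * k0Class (specOver β) := by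
  classical
  -- The union of `O` with the first `n` charts. The difference of two consecutive terms is one
  -- affine cell over `Spec B`.
  let W : ℕ → M.left.Opens := fun n => O ⊔ ⨆ (j : Fin m) (_ : j.1 < n), V j
  have key : ∀ n ≤ m, k0Class (opn M (W n)) = k0Class (opn M O) +
      (∑ j ∈ Finset.range n, lefschetz k ^ (m - 1 - j)) * k0Class (specOver β) := by
    intro n
    induction n with
    | zero =>
      intro _
      have : W 0 = O := by simp [W]
      rw [this]
      simp
    | succ n ih =>
      intro hn
      let j : Fin m := ⟨n, hn⟩
      -- By `hx` the points of chart `j` outside the earlier charts are those where the coordinates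
      -- of smaller index vanish. `ρ` kills these coordinates, leaving an affine space with `m - 1 -
      -- n` coordinates.
      let ρ : MvPolynomial {l : Fin m // l ≠ j} B →+* MvPolynomial {l : Fin m // j < l} B :=
        MvPolynomial.eval₂Hom MvPolynomial.C
          (fun l => if h : j < l.1 then MvPolynomial.X ⟨l.1, h⟩ else 0)
      let ι : MvPolynomial {l : Fin m // j < l} B →+* MvPolynomial {l : Fin m // l ≠ j} B :=
        (MvPolynomial.rename fun l => ⟨l.1, l.2.ne'⟩ : _ →ₐ[B] _).toRingHom
      have hρι : ∀ x, ρ (ι x) = x := fun x => by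
        have : ρ.comp ι = RingHom.id _ := by
          ext l
          · simp [ρ, ι]
          · simp [ρ, ι, l.2]
        exact congrArg (fun t => t x) this
      have hρ : Function.Surjective ρ := fun x => ⟨ι x, hρι x⟩
      have hρC : ρ.comp ((MvPolynomial.C).comp β) = (MvPolynomial.C).comp β := by
        ext x; simp [ρ]
      let s : specOver ((MvPolynomial.C (σ := {l : Fin m // j < l})).comp β) ⟶
          specOver ((MvPolynomial.C (σ := {l : Fin m // l ≠ j})).comp β) :=
        Over.homMk (Spec.map (CommRingCat.ofHom ρ)) (by
          change Spec.map _ ≫ Spec.map _ = Spec.map _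
          rw [← Spec.map_comp, ← CommRingCat.ofHom_comp, hρC])
      have hs : IsClosedImmersion s.left := IsClosedImmersion.spec_of_surjective _ hρ
      have hrange : ∀ x : PrimeSpectrum (MvPolynomial {l : Fin m // l ≠ j} B),
          x ∈ Set.range s.left ↔ ∀ l : {l : Fin m // l ≠ j}, l.1 < j →
            MvPolynomial.X l ∈ x.asIdeal := by
        intro x
        have h1 : Set.range s.left = PrimeSpectrum.zeroLocus (RingHom.ker ρ) :=
          range_comap_of_surjective _ ρ hρ
        have h2 : x ∈ Set.range s.left ↔ (RingHom.ker ρ : Set (MvPolynomial {l : Fin m // l ≠ j} B)) ⊆ x.asIdeal := by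
          rw [h1]
          exact PrimeSpectrum.mem_zeroLocus x _
        refine h2.trans ?_
        constructor
        · intro h l hl
          refine h ?_
          simp [ρ, not_lt.mpr hl.le]
        · intro h P hP
          let q := Ideal.Quotient.mk x.asIdeal
          have : q = q.comp (ι.comp ρ) := by
            ext l
            · simp [ρ, ι]
            · by_cases hl : j < l.1
              · simp [ρ, ι, hl]
              · have hl' : l.1 < j := lt_of_le_of_ne (not_lt.mp hl) l.2
                simpa [ρ, hl] using Ideal.Quotient.eq_zero_iff_mem.mpr (h l hl')
          have h2 : q P = 0 := by
            rw [this]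
            simp [show ρ P = 0 from hP]
          exact Ideal.Quotient.eq_zero_iff_mem.mp h2
      let t := s ≫ e j
      have ht : IsImmersion t.left := inferInstanceAs (IsImmersion (s.left ≫ (e j).left))
      have hWle : W n ≤ W (n + 1) := sup_le_sup le_rfl
        (iSup_mono fun l => iSup_mono' fun h => ⟨Nat.lt_succ_of_lt h, le_rfl⟩)
      have hmemW : ∀ (n : ℕ) (y : M.left), y ∈ W n ↔ y ∈ O ∨ ∃ l : Fin m, l.1 < n ∧ y ∈ V l := by
        intro n y
        simp [W]
      have hr : Set.range t.left = (W (n + 1) : Set M.left) \ W n := by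
        have hcomp : ∀ z, t.left z = (e j).left (s.left z) := fun z => rfl
        ext y
        constructor
        · rintro ⟨z, rfl⟩
          rw [hcomp]
          have h1 : (e j).left (s.left z) ∈ (V j : Set M.left) \ O := by
            rw [← hV]; exact ⟨_, rfl⟩
          refine ⟨(hmemW _ _).mpr (Or.inr ⟨j, Nat.lt_succ_self n, h1.1⟩), fun h => ?_⟩
          rcases (hmemW _ _).mp h with h | ⟨l, hl, h⟩
          · exact h1.2 h
          · have hlj : l ≠ j := fun h => by simp [h, j] at hl
            exact (hx j ⟨l, hlj⟩ _).mp h ((hrange _).mp ⟨z, rfl⟩ ⟨l, hlj⟩ hl)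
        · rintro ⟨h1, h2⟩
          have h2 : y ∉ W n := h2
          rw [hmemW] at h2
          push Not at h2
          rcases (hmemW _ _).mp h1 with h | ⟨l, hl, h⟩
          · exact absurd h h2.1
          · have hln : l = j := by
              by_contra hne
              have : l.1 ≠ n := fun h => hne (Fin.ext h)
              exact h2.2 l (by omega) h
            rw [hln] at h
            have h3 : y ∈ Set.range (e j).left := by
              rw [hV]; exact ⟨h, h2.1⟩
            obtain ⟨x, rfl⟩ := h3
            obtain ⟨z, rfl⟩ : x ∈ Set.range s.left := by
              refine (hrange x).mpr fun l' hl' => ?_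
              by_contra hnot
              exact h2.2 l'.1 hl' ((hx j l' x).mpr hnot)
            exact ⟨z, rfl⟩
      rw [k0Class_opn_eq_add t _ _ hWle hr, ih (Nat.le_of_succ_le hn), Finset.sum_range_succ,
        k0Class_specOver_mvPolynomial, add_mul, add_assoc]
      congr 3
      rw [Nat.card_eq_fintype_card]
      have : Fintype.card {l : Fin m // j < l} = m - 1 - n := by
        rw [Fintype.card_subtype]
        have := Fin.card_Ioi j
        rw [← this]
        congr 1
        ext; simp
      rw [this]
  have hm := key m le_rfl
  -- The cells were added in order of decreasing dimension.
  rw [Finset.sum_range_reflect (fun j => lefschetz k ^ j) m] at hm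
  have hW : W m = O ⊔ ⨆ j, V j := by
    simp only [W, Fin.is_lt, iSup_pos]
  rw [← hm, hW]

end Bundle

/-! ### Standard charts and class of projective space -/

section ProjectiveSpaceCharts

attribute [local instance] MvPolynomial.gradedAlgebra

variable (k : Type u) [Field k] {r : ℕ} (j : Fin r)

lemma X_mem_homogeneousSubmodule :
    (MvPolynomial.X j : MvPolynomial (Fin r) k) ∈ MvPolynomial.homogeneousSubmodule (Fin r) k 1 :=
  MvPolynomial.isHomogeneous_X k j

/-- The coordinate `X l / X j` on the `j`-th standard chart of projective space. -/
noncomputable def projCoord (l : Fin r) :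
    HomogeneousLocalization.Away (MvPolynomial.homogeneousSubmodule (Fin r) k)
      (MvPolynomial.X j) :=
  HomogeneousLocalization.Away.isLocalizationElem
    (𝒜 := MvPolynomial.homogeneousSubmodule (Fin r) k)
    (X_mem_homogeneousSubmodule k j) (X_mem_homogeneousSubmodule k l)

lemma val_projCoord_mul (l : Fin r) :
    algebraMap (MvPolynomial (Fin r) k) (Localization.Away (MvPolynomial.X j : MvPolynomial (Fin r) k))
      (MvPolynomial.X j) * (projCoord k j l).val =
    algebraMap (MvPolynomial (Fin r) k) (Localization.Away (MvPolynomial.X j : MvPolynomial (Fin r) k))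
      (MvPolynomial.X l) := by
  have : (projCoord k j l).val = Localization.mk (MvPolynomial.X l ^ 1)
      (⟨MvPolynomial.X j ^ 1, 1, rfl⟩ :
        Submonoid.powers (MvPolynomial.X j : MvPolynomial (Fin r) k)) := rfl
  rw [this, Localization.mk_eq_mk']
  simp only [pow_one]
  exact IsLocalization.mk'_spec' (Localization.Away (MvPolynomial.X j : MvPolynomial (Fin r) k))
    (MvPolynomial.X l) _

/-- The dehomogenized coordinate ring of the `j`-th standard chart of projective space. -/
noncomputable def projChartHom : MvPolynomial {l : Fin r // l ≠ j} k →+*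
    HomogeneousLocalization.Away (MvPolynomial.homogeneousSubmodule (Fin r) k)
      (MvPolynomial.X j) :=
  MvPolynomial.eval₂Hom ((HomogeneousLocalization.fromZeroRingHom _ _).comp
    (algebraMap k (MvPolynomial.homogeneousSubmodule (Fin r) k 0))) (fun l => projCoord k j l)

lemma projCoord_self : projCoord k j j = 1 := by
  apply HomogeneousLocalization.val_injective
  have h := val_projCoord_mul k j j
  rw [HomogeneousLocalization.val_one]
  refine (IsLocalization.Away.algebraMap_isUnit (S := Localization.Away
    (MvPolynomial.X j : MvPolynomial (Fin r) k)) (MvPolynomial.X j :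
      MvPolynomial (Fin r) k)).mul_left_cancel ?_
  rw [h, mul_one]

lemma val_projChartHom_C (a : k) : (projChartHom k j (MvPolynomial.C a)).val =
    algebraMap (MvPolynomial (Fin r) k) (Localization.Away (MvPolynomial.X j : MvPolynomial (Fin r) k))
      (MvPolynomial.C a) := by
  simp [projChartHom]
  rfl

lemma projChartHom_X (l : {l : Fin r // l ≠ j}) :
    projChartHom k j (MvPolynomial.X l) = projCoord k j l := by
  simp [projChartHom]

/-- Setting `X_j = 1` extends to the localization at `X_j` and provides a left inverse. -/
lemma projChartHom_injective : Function.Injective (projChartHom k j) := by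
  classical
  let θ : MvPolynomial (Fin r) k →+* MvPolynomial {l : Fin r // l ≠ j} k :=
    MvPolynomial.eval₂Hom MvPolynomial.C
      (fun l => if h : l ≠ j then MvPolynomial.X ⟨l, h⟩ else 1)
  have hθ : IsUnit (θ (MvPolynomial.X j)) := by simp [θ]
  let Θ : Localization.Away (MvPolynomial.X j : MvPolynomial (Fin r) k) →+* _ :=
    IsLocalization.Away.lift (MvPolynomial.X j) hθ
  let v : HomogeneousLocalization.Away (MvPolynomial.homogeneousSubmodule (Fin r) k)
      (MvPolynomial.X j) →+* Localization.Away (MvPolynomial.X j : MvPolynomial (Fin r) k) :=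
    algebraMap _ _
  have hΘ : ∀ x, Θ (algebraMap _ _ x) = θ x := fun x => IsLocalization.Away.lift_eq _ hθ x
  have : (Θ.comp v).comp (projChartHom k j) = RingHom.id _ := by
    refine MvPolynomial.ringHom_ext (fun a => ?_) (fun l => ?_)
    · have h1 : v (projChartHom k j (MvPolynomial.C a)) = _ := val_projChartHom_C k j a
      simp [h1, hΘ, θ]
    · have h1 : v (projCoord k j l) = (projCoord k j l).val := rfl
      have h2 := congrArg Θ (val_projCoord_mul k j l)
      have h3 : θ (MvPolynomial.X j) = 1 := by simp [θ]
      rw [map_mul, hΘ, hΘ, h3, one_mul] at h2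
      simp only [RingHom.comp_apply, projChartHom_X, h1, h2]
      simp [θ, l.2]
  exact (show Function.LeftInverse (Θ.comp v) (projChartHom k j) from
    fun x => congrArg (fun t => t x) this).injective

/-- An element of the chart ring is `F / X_j^n` with `F` of degree `n`, and homogeneity turns this
into the value of `F` at the coordinates `X_l / X_j`, that is, of its dehomogenization. -/
lemma projChartHom_surjective : Function.Surjective (projChartHom k j) := by
  classical
  intro z
  obtain ⟨n, F, hF, rfl⟩ := HomogeneousLocalization.Away.mk_surjective
    (MvPolynomial.homogeneousSubmodule (Fin r) k) (X_mem_homogeneousSubmodule k j) z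
  let G : MvPolynomial {l : Fin r // l ≠ j} k :=
    MvPolynomial.eval₂Hom MvPolynomial.C
      (fun l => if h : l ≠ j then MvPolynomial.X ⟨l, h⟩ else 1) F
  refine ⟨G, HomogeneousLocalization.val_injective _ ?_⟩
  rw [HomogeneousLocalization.Away.val_mk]
  let Q := Localization.Away (MvPolynomial.X j : MvPolynomial (Fin r) k)
  let v : HomogeneousLocalization.Away (MvPolynomial.homogeneousSubmodule (Fin r) k)
      (MvPolynomial.X j) →+* Localization.Away (MvPolynomial.X j : MvPolynomial (Fin r) k) :=
    algebraMap _ _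
  let α := algebraMap (MvPolynomial (Fin r) k) Q
  let : Algebra k Q := (α.comp MvPolynomial.C).toAlgebra
  have h1 : v (projChartHom k j G) = MvPolynomial.aeval (fun l => (projCoord k j l).val : Fin r → Q) F := by
    have : (v.comp ((projChartHom k j).comp (MvPolynomial.eval₂Hom MvPolynomial.C
      (fun l => if h : l ≠ j then MvPolynomial.X ⟨l, h⟩ else 1)))) =
        (MvPolynomial.aeval (fun l => (projCoord k j l).val : Fin r → Q) :
          MvPolynomial (Fin r) k →ₐ[k] Q).toRingHom := by
      refine MvPolynomial.ringHom_ext (fun a => ?_) (fun l => ?_)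
      · have h1 : v (projChartHom k j (MvPolynomial.C a)) = _ := val_projChartHom_C k j a
        simp [h1]
        rfl
      · by_cases h : l = j
        · subst h
          simp [projCoord_self]
        · simp [h, projChartHom_X]
          rfl
    exact congrArg (fun t => t F) this
  have h2 : α F = MvPolynomial.aeval (fun l => α (MvPolynomial.X j) * (projCoord k j l).val : Fin r → Q) F := by
    have : α = (MvPolynomial.aeval
      (fun l => α (MvPolynomial.X j) * (projCoord k j l).val : Fin r → Q) :
          MvPolynomial (Fin r) k →ₐ[k] Q).toRingHom := by
      refine MvPolynomial.ringHom_ext (fun a => ?_) (fun l => ?_)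
      · simp; rfl
      · simp [α, Q, val_projCoord_mul]
    exact congrArg (fun t => t F) this
  have hF' : F.IsHomogeneous n := by simpa using hF
  rw [isHomogeneous_aeval_mul hF', ← h1] at h2
  refine Eq.trans ?_ (Localization.mk_eq_mk'_apply _ _).symm
  rw [eq_comm, IsLocalization.mk'_eq_iff_eq_mul, mul_comm]
  rw [map_pow]
  exact h2

lemma projChartHom_bijective : Function.Bijective (projChartHom k j) :=
  ⟨projChartHom_injective k j, projChartHom_surjective k j⟩

/-- The inverse of `projChartHom`. -/
noncomputable def projChartInv : HomogeneousLocalization.Away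
    (MvPolynomial.homogeneousSubmodule (Fin r) k) (MvPolynomial.X j) →+*
      MvPolynomial {l : Fin r // l ≠ j} k :=
  ((RingEquiv.ofBijective _ (projChartHom_bijective k j)).symm : _ ≃+* _)

lemma projChartInv_projChartHom (x : MvPolynomial {l : Fin r // l ≠ j} k) :
    projChartInv k j (projChartHom k j x) = x :=
  (RingEquiv.ofBijective _ (projChartHom_bijective k j)).symm_apply_apply x

instance : IsIso (Spec.map (CommRingCat.ofHom (projChartInv k j))) :=
  inferInstanceAs (IsIso (Spec.map (RingEquiv.toCommRingCatIso
    (RingEquiv.ofBijective _ (projChartHom_bijective k j)).symm).hom))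

/-- The `j`-th standard open subset of projective space. -/
noncomputable def projOpen : (projSpace k r).left.Opens :=
  Proj.basicOpen (MvPolynomial.homogeneousSubmodule (Fin r) k) (MvPolynomial.X j)

/-- The `j`-th standard chart of projective space. -/
noncomputable def projChart : specOver ((MvPolynomial.C (σ := {l : Fin r // l ≠ j})).comp
    (RingHom.id k)) ⟶ projSpace k r :=
  Over.homMk (Spec.map (CommRingCat.ofHom (projChartInv k j)) ≫
    Proj.awayι _ _ (X_mem_homogeneousSubmodule k j) one_pos) (by
  change (Spec.map _ ≫ Proj.awayι _ _ _ _) ≫ Proj.toSpecZero _ ≫ Spec.map _ = Spec.map _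
  rw [Category.assoc, Proj.awayι_toSpecZero_assoc, ← Spec.map_comp, ← Spec.map_comp]
  congr 1
  refine CommRingCat.hom_ext (RingHom.ext fun a => ?_)
  refine Eq.trans ?_ (projChartInv_projChartHom k j (MvPolynomial.C a))
  simp [projChartHom])

instance isOpenImmersion_projChart : IsOpenImmersion (projChart k j).left :=
  inferInstanceAs (IsOpenImmersion (Spec.map (CommRingCat.ofHom (projChartInv k j)) ≫
    Proj.awayι _ _ (X_mem_homogeneousSubmodule k j) one_pos))

lemma range_projChart : Set.range (projChart k j).left = projOpen k j := by
  have h : (Spec.map (CommRingCat.ofHom (projChartInv k j)) ≫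
      Proj.awayι _ _ (X_mem_homogeneousSubmodule k j) one_pos).opensRange =
      Proj.basicOpen (MvPolynomial.homogeneousSubmodule (Fin r) k) (MvPolynomial.X j) :=
    (Scheme.Hom.opensRange_comp_of_isIso _ _).trans (Proj.opensRange_awayι _ _ _ _)
  exact congrArg (fun U : (Proj (MvPolynomial.homogeneousSubmodule (Fin r) k)).Opens => U.1) h

lemma projChart_mem_basicOpen (l : {l : Fin r // l ≠ j})
    (x : PrimeSpectrum (MvPolynomial {l : Fin r // l ≠ j} k)) :
    (projChart k j).left x ∈ projOpen k l.1 ↔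
    x ∈ PrimeSpectrum.basicOpen (MvPolynomial.X l) := by
  let y := PrimeSpectrum.comap (projChartInv k j) x
  have h := Proj.awayι_preimage_basicOpen (MvPolynomial.homogeneousSubmodule (Fin r) k)
    (X_mem_homogeneousSubmodule k j) one_pos (X_mem_homogeneousSubmodule k l.1) one_pos
  have h1 : (projChart k j).left x ∈ projOpen k l.1 ↔
    y ∈ PrimeSpectrum.basicOpen (projCoord k j l.1) :=
    (Iff.of_eq (congrArg (fun U : (Spec (.of (HomogeneousLocalization.Away
      (MvPolynomial.homogeneousSubmodule (Fin r) k) (MvPolynomial.X j)))).Opens => y ∈ U.1) h))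
  have h2 : projChartInv k j (projCoord k j l.1) = MvPolynomial.X l := by
    rw [← projChartHom_X, projChartInv_projChartHom]
  rw [h1, PrimeSpectrum.mem_basicOpen, PrimeSpectrum.mem_basicOpen, ← h2]
  rfl

lemma iSup_projOpen (r : ℕ) : ⨆ j : Fin r, projOpen k j = ⊤ := by
  refine Proj.iSup_basicOpen_eq_top' _ _ (fun j => ⟨1, X_mem_homogeneousSubmodule k j⟩) ?_
  rw [eq_top_iff]
  rintro p -
  induction p using MvPolynomial.induction_on with
  | C a => 
    have : (MvPolynomial.C a : MvPolynomial (Fin r) k) ∈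
        MvPolynomial.homogeneousSubmodule (Fin r) k 0 := MvPolynomial.isHomogeneous_C _ _
    exact Subalgebra.algebraMap_mem _ (⟨_, this⟩ : MvPolynomial.homogeneousSubmodule (Fin r) k 0)
  | add p q hp hq => exact add_mem hp hq
  | mul_X p j hp => exact mul_mem hp (Algebra.subset_adjoin ⟨j, rfl⟩)

lemma k0Class_projSpace (r : ℕ) :
    k0Class (projSpace k r) = ∑ j ∈ Finset.range r, lefschetz k ^ j := by
  have hpt : IsFiniteType (specOver (RingHom.id k)) :=
    isFiniteType_specOver _ (RingHom.FiniteType.id k)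
  have hpt1 : k0Class (specOver (RingHom.id k)) = 1 := by
    have : k0Class (specOver (RingHom.id k)) = k0Class (pt k) :=
      k0Class_eq_of_iso (Over.isoMk (Iso.refl _) (by
        change 𝟙 _ ≫ 𝟙 _ = Spec.map (𝟙 _)
        simp))
    rw [this]
    exact Ideal.Quotient.eq.mpr (Ideal.subset_span K0Rel.one)
  have h := k0Class_opn_projective_strata (M := projSpace k r) (RingHom.id k)
    (fun j => projChart k j) ⊥
    (projOpen k) (fun j => by rw [range_projChart]; exact (Set.sdiff_empty).symm)
    (fun j l x => projChart_mem_basicOpen k j l x)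
  have h0 : k0Class (opn (projSpace k r) ⊥) = 0 := by
    have : IsEmpty (opn (projSpace k r) ⊥).left := ⟨fun x => x.2⟩
    exact k0Class_of_isEmpty _
  rw [h0, zero_add, hpt1, mul_one] at h
  rw [← h, ← k0Class_opn_top]
  congr 1
  rw [bot_sup_eq]
  exact congrArg (opn (projSpace k r)) (iSup_projOpen k r).symm

end ProjectiveSpaceCharts

end Motivic

namespace Motivic

/-! ### Blow-ups away from the center -/

section AwayFromCenter

lemma isEffectiveCartier_top (X : Scheme.{u}) : IsEffectiveCartier (⊤ : X.IdealSheafData) := by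
  intro x
  obtain ⟨V, hV, hx, -⟩ := exists_affine_le (O := (⊤ : X.Opens)) (x := x) trivial
  refine ⟨⟨V, hV⟩, hx, 1, one_mem _, ?_⟩
  rw [Ideal.span_singleton_one]
  rfl

/-- A blow-up is an isomorphism away from its center. -/
lemma IsBlowUp.isIso_morphismRestrict {T S : Scheme.{u}} {p : T ⟶ S} {I : S.IdealSheafData}
    (hp : IsBlowUp p I) (V : S.Opens) (hV : ∀ x ∈ V, x ∉ I.support) : IsIso (p ∣_ V) := by
  have h1 : I.comap V.ι = ⊤ := by
    rw [← Scheme.IdealSheafData.support_eq_bot_iff, Scheme.IdealSheafData.support_comap]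
    ext x
    simp only [TopologicalSpace.Closeds.coe_preimage, Set.mem_preimage]
    exact iff_of_false (hV _ x.2) id
  -- Off the center the ideal is the unit ideal, which is Cartier, so the inclusion of `V` lifts to
  -- the blow-up; the lift is the inverse.
  obtain ⟨h, hh, -⟩ := hp.existsUnique_lift V.ι (by rw [h1]; exact isEffectiveCartier_top _)
  let h' : V.toScheme ⟶ (p ⁻¹ᵁ V).toScheme := IsOpenImmersion.lift (p ⁻¹ᵁ V).ι h (by
    rintro _ ⟨x, rfl⟩
    rw [Scheme.Opens.range_ι]
    change p (h x) ∈ V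
    rw [← Scheme.Hom.comp_apply, hh]
    exact x.2)
  have hh' : h' ≫ (p ⁻¹ᵁ V).ι = h := IsOpenImmersion.lift_fac _ _ _
  have e : p ∣_ V ≫ V.ι = (p ⁻¹ᵁ V).ι ≫ p := morphismRestrict_ι p V
  refine ⟨h', ?_, ?_⟩
  · have hC : IsEffectiveCartier (I.comap ((p ⁻¹ᵁ V).ι ≫ p)) := by
      rw [Scheme.IdealSheafData.comap_comp]
      exact hp.cartier.comap_of_flat _
    have := (hp.existsUnique_lift _ hC).unique (y₁ := p ∣_ V ≫ h) (y₂ := (p ⁻¹ᵁ V).ι)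
      (by rw [Category.assoc, hh, e]) rfl
    rw [← cancel_mono (p ⁻¹ᵁ V).ι, Category.assoc, hh', this, Category.id_comp]
  · rw [← cancel_mono V.ι, Category.assoc, e, reassoc_of% hh', hh, Category.id_comp]

lemma mem_support_ker_iff {X S : Scheme.{u}} (i : X ⟶ S) [IsClosedImmersion i] (s : S) :
    s ∈ i.ker.support ↔ s ∈ Set.range i := by
  rw [← SetLike.mem_coe, Scheme.Hom.support_ker, i.isClosedEmbedding.isClosed_range.closure_eq]

end AwayFromCenter

/-! ### Equations of smooth centers and their number -/

section Frames

variable {k : Type u} [Field k]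

lemma exists_smooth_specOver (M : Sch k) {U : M.left.Opens} (hU : IsAffineOpen U)
    (h : Smooth (U.ι ≫ M.hom)) :
    ∃ α : k →+* Γ(M.left, U), α.Smooth ∧ Spec.map (CommRingCat.ofHom α) = hU.fromSpec ≫ M.hom := by
  obtain ⟨a, ha⟩ := Spec.map_surjective (hU.fromSpec ≫ M.hom)
  refine ⟨a.hom, ?_, ha⟩
  have : Smooth (Spec.map a) := by
    rw [ha, ← IsAffineOpen.isoSpec_inv_ι, Category.assoc]
    infer_instance
  exact (HasRingHomProperty.Spec_iff (P := @Smooth)).mp this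

lemma SmoothAt.exists_isOpen_mem {M : Sch k} {x : M.left} (h : SmoothAt M x) :
    ∃ U : M.left.Opens, x ∈ U ∧ ∀ V ≤ U, Smooth (V.ι ≫ M.hom) := by
  obtain ⟨U, hx, hU⟩ := h
  refine ⟨U, hx, fun V hV => ?_⟩
  rw [← Scheme.homOfLE_ι M.left hV, Category.assoc]
  infer_instance

/-- Near a point where both are smooth, a closed subscheme is cut out by a quasi-regular
sequence. -/
lemma exists_quasiRegular_frame {X S : Sch k} [IsFiniteType S] (i : X ⟶ S)
    [IsClosedImmersion i.left] (x : X.left) (hX : SmoothAt X x) (hS : SmoothAt S (i.left x)) :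
    ∃ (U : S.left.Opens) (hU : IsAffineOpen U) (n : ℕ) (f : Fin n → Γ(S.left, U)),
      i.left x ∈ U ∧ i.left.ker.ideal ⟨U, hU⟩ = Ideal.span (Set.range f) ∧ IsQuasiRegular f := by
  obtain ⟨VX, hxV, hVX⟩ := hX.exists_isOpen_mem
  obtain ⟨VS, hxS, hVS⟩ := hS.exists_isOpen_mem
  obtain ⟨O, hO, hOV⟩ := i.left.isEmbedding.isInducing.isOpen_iff.mp VX.2
  let O' : S.left.Opens := ⟨O, hO⟩
  -- `O'` is an open subset of `S` that meets `X` in `VX`, so an affine neighbourhood inside `VS ⊓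
  -- O'` has smooth coordinate rings both on `S` and on `X`.
  have hxO : i.left x ∈ VS ⊓ O' := ⟨hxS, by
    change x ∈ i.left ⁻¹' O
    rw [hOV]; exact hxV⟩
  obtain ⟨U, hU, hxU, hUO⟩ := exists_affine_le hxO
  let W := i.left ⁻¹ᵁ U
  have hW : IsAffineOpen W := hU.preimage i.left
  have hWV : W ≤ VX := fun y hy => by
    change y ∈ (VX : Set X.left)
    rw [TopologicalSpace.Opens.carrier_eq_coe] at hOV
    rw [← hOV]
    exact (hUO hy).2
  obtain ⟨α, hα, hαU⟩ := exists_smooth_specOver S hU (hVS U (hUO.trans inf_le_left))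
  obtain ⟨β, hβ, hβW⟩ := exists_smooth_specOver X hW (hVX W hWV)
  let φ := (i.left.app U).hom
  have hφ : Function.Surjective φ := i.left.app_surjective U hU
  have hcomp : φ.comp α = β := by
    suffices h : CommRingCat.ofHom α ≫ i.left.app U = CommRingCat.ofHom β from
      congrArg CommRingCat.Hom.hom h
    apply Spec.map_injective
    rw [Spec.map_comp, hαU, hβW, ← Over.w i, ← Category.assoc, ← Category.assoc]
    congr 1
    have := IsAffineOpen.SpecMap_appLE_fromSpec i.left hU hW le_rfl
    rwa [Scheme.Hom.appLE_eq_app] at this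
  let := α.toAlgebra
  let := β.toAlgebra
  have : Algebra.Smooth k Γ(S.left, U) := hα
  have : Algebra.Smooth k Γ(X.left, W) := hβ
  let φ' : Γ(S.left, U) →ₐ[k] Γ(X.left, W) := { φ with commutes' := fun r => congrArg (fun t => t r) hcomp }
  have : IsLocallyNoetherian S.left := LocallyOfFiniteType.isLocallyNoetherian S.hom
  have : IsNoetherianRing Γ(S.left, U) := IsLocallyNoetherian.component_noetherian ⟨U, hU⟩
  let P := (hW.primeIdealOf ⟨x, hxU⟩).asIdeal.comap φ
  obtain ⟨h, hhP, n, f, hf1, hf2, hf3⟩ := exists_conormal_frame φ' hφ P (Ideal.ker_le_comap φ)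
  -- Inverting `h` turns the conormal frame into quasi-regular generators, and `h ∉ P` keeps `i x`
  -- in `D`.
  let D := S.left.basicOpen h
  have hD : IsAffineOpen D := hU.basicOpen h
  have hDU : D ≤ U := S.left.basicOpen_le h
  have hloc := hU.isLocalization_basicOpen h
  obtain ⟨h1, h2⟩ := isQuasiRegular_of_conormal_frame φ' hφ hf1 hf2 hf3 Γ(S.left, D)
  refine ⟨D, hD, n, algebraMap Γ(S.left, U) Γ(S.left, D) ∘ f, ?_, ?_, h2⟩
  · have h3 : x ∈ X.left.basicOpen (φ h) := by
      have h4 : hW.primeIdealOf ⟨x, hxU⟩ ∈ hW.fromSpec ⁻¹ᵁ X.left.basicOpen (φ h) := by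
        rw [hW.fromSpec_preimage_basicOpen]
        exact hhP
      have h5 : hW.fromSpec (hW.primeIdealOf ⟨x, hxU⟩) ∈ X.left.basicOpen (φ h) := h4
      rwa [hW.fromSpec_primeIdealOf] at h5
    have h6 := Scheme.preimage_basicOpen i.left h
    change x ∈ i.left ⁻¹ᵁ D
    rw [h6]
    exact h3
  · rw [← h1]
    have h7 := i.left.ker.map_ideal_basicOpen ⟨U, hU⟩ h
    rw [Scheme.Hom.ker_apply] at h7
    exact h7.symm

lemma coheight_eq_height_primeIdealOf {S : Scheme.{u}} {U : S.Opens} (hU : IsAffineOpen U) (s : S)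
    (hs : s ∈ U) : Order.coheight s = (hU.primeIdealOf ⟨s, hs⟩).asIdeal.height := by
  exact (congrArg _ (hU.fromSpec_primeIdealOf ⟨s, hs⟩).symm).trans
    ((coheight_eq_of_isOpenImmersion hU.fromSpec).trans (idealHeight_eq_coheight _ _).symm)

lemma primeIdealOf_genericPoint_image {X S : Scheme.{u}} [IsIntegral X] (i : X ⟶ S)
    [IsClosedImmersion i] {U : S.Opens} (hU : IsAffineOpen U) (h : i (genericPoint X) ∈ U) :
    (hU.primeIdealOf ⟨i (genericPoint X), h⟩).asIdeal = i.ker.ideal ⟨U, hU⟩ := by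
  have hW : IsAffineOpen (i ⁻¹ᵁ U) := hU.preimage i
  have : Nonempty (i ⁻¹ᵁ U) := ⟨⟨_, h⟩⟩
  rw [← IsAffineOpen.comap_primeIdealOf_appLE U hU (i ⁻¹ᵁ U) hW le_rfl h,
    Scheme.Hom.ker_apply, Scheme.Hom.appLE_eq_app, PrimeSpectrum.comap_asIdeal]
  have h1 : hW.primeIdealOf ⟨genericPoint X, h⟩ = genericPoint (Spec Γ(X, i ⁻¹ᵁ U)) := by
    apply hW.fromSpec.isOpenEmbedding.injective
    rw [hW.fromSpec_primeIdealOf, genericPoint_eq_of_isOpenImmersion]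
  rw [h1, genericPoint_eq_bot_of_affine]
  exact (RingHom.ker_eq_comap_bot _).symm

/-- Any open set meeting `X` contains its generic point, whose prime on `U` is the ideal `(f)`; that
prime has height `n`. This ties the length of a frame to the codimension, independently of the point
chosen. -/
lemma codim_eq_of_quasiRegular {X S : Sch k} [IsVariety X] [IsFiniteType S] (i : X ⟶ S)
    [IsClosedImmersion i.left] {U : S.left.Opens} (hU : IsAffineOpen U) {n : ℕ}
    {f : Fin n → Γ(S.left, U)} (x : X.left) (hx : i.left x ∈ U)
    (hf : i.left.ker.ideal ⟨U, hU⟩ = Ideal.span (Set.range f)) (hq : IsQuasiRegular f) :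
    codim i = n := by
  have hη : i.left (genericPoint X.left) ∈ U :=
    ((genericPoint_specializes x).map i.left.continuous).mem_open U.2 hx
  have : IsLocallyNoetherian S.left := LocallyOfFiniteType.isLocallyNoetherian S.hom
  have : IsNoetherianRing Γ(S.left, U) := IsLocallyNoetherian.component_noetherian ⟨U, hU⟩
  have h1 := primeIdealOf_genericPoint_image i.left hU hη
  rw [codim, coheight_eq_height_primeIdealOf hU _ hη, h1, hf]
  refine height_eq_of_isQuasiRegular hq ?_
  rw [← hf, ← h1]
  infer_instance

/-- Otherwise the form `X_i`, with coefficient 1, would vanish at `f` and put 1 into a proper ideal.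
-/
lemma IsQuasiRegular.ne_zero {R : Type*} [CommRing R] {σ : Type*} {f : σ → R}
    (hf : IsQuasiRegular f) (h : Ideal.span (Set.range f) ≠ ⊤) (i : σ) : f i ≠ 0 := by
  classical
  intro h0
  have := hf 1 (MvPolynomial.X i) (MvPolynomial.isHomogeneous_X _ _) (by simp [h0]) (Finsupp.single i 1)
  rw [MvPolynomial.coeff_X, if_pos rfl] at this
  exact h ((Ideal.eq_top_iff_one _).mpr this)

end Frames

end Motivic

namespace Motivic

/-! ### Charts of the exceptional divisor -/

section ExceptionalCharts

variable {X S T : Scheme.{u}}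

lemma mem_range_iff_ideal_le_primeIdealOf (i : X ⟶ S) [IsClosedImmersion i] {U : S.Opens}
    (hU : IsAffineOpen U) (y : PrimeSpectrum Γ(S, U)) :
    hU.fromSpec y ∈ Set.range i ↔ i.ker.ideal ⟨U, hU⟩ ≤ y.asIdeal := by
  rw [← mem_support_ker_iff]
  have hy : hU.fromSpec y ∈ U := by
    have : hU.fromSpec y ∈ Set.range hU.fromSpec := ⟨y, rfl⟩
    rwa [hU.range_fromSpec] at this
  have h := Set.ext_iff.mp (i.ker.coe_support_inter ⟨U, hU⟩) (hU.fromSpec y)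
  have h2 := hU.fromSpec_image_zeroLocus (i.ker.ideal ⟨U, hU⟩ : Set _)
  have h3 : hU.fromSpec y ∈ i.ker.support ↔
      hU.fromSpec y ∈ hU.fromSpec '' PrimeSpectrum.zeroLocus (i.ker.ideal ⟨U, hU⟩ : Set _) := by
    rw [h2]
    exact ⟨fun h' => h.mp ⟨h', hy⟩, fun h' => (h.mpr h').1⟩
  refine h3.trans (hU.fromSpec.isOpenEmbedding.injective.mem_set_image.trans ?_)
  exact PrimeSpectrum.mem_zeroLocus y _

/-- The charts of a blow-up with quasi-regular center, and the charts of its exceptional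
divisor. -/
theorem IsBlowUp.exists_exceptional_chart {i : X ⟶ S} [IsClosedImmersion i] {p : T ⟶ S}
    (hp : IsBlowUp p i.ker) {U : S.Opens} (hU : IsAffineOpen U) {n : ℕ} {f : Fin n → Γ(S, U)}
    (hf : i.ker.ideal ⟨U, hU⟩ = Ideal.span (Set.range f)) (hq : IsQuasiRegular f)
    (hz : ∀ j, f j ∈ nonZeroDivisors Γ(S, U)) :
    ∃ (V : Fin n → T.Opens)
      (e : ∀ j : Fin n, Spec (.of (MvPolynomial {l // l ≠ j} Γ(X, i ⁻¹ᵁ U))) ⟶ T),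
      ⨆ j, V j = p ⁻¹ᵁ U ∧ (∀ j, IsCompact (V j : Set T)) ∧ (∀ j, IsImmersion (e j)) ∧
      (∀ j, e j ≫ p = Spec.map (CommRingCat.ofHom MvPolynomial.C) ≫
        (hU.preimage i).fromSpec ≫ i) ∧
      (∀ j, Set.range (e j) = (V j : Set T) ∩ p ⁻¹' Set.range i) ∧
      (∀ (j : Fin n) (l : {l : Fin n // l ≠ j}) (x : PrimeSpectrum (MvPolynomial _ _)),
        e j x ∈ V l ↔ x ∈ PrimeSpectrum.basicOpen (MvPolynomial.X l)) ∧
      ∀ (_ : IsNoetherianRing Γ(S, U)) (_ : IsDomain Γ(X, i ⁻¹ᵁ U)) (j : Fin n),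
        Order.coheight (e j (⊥ : PrimeSpectrum _)) = 1 := by
  obtain ⟨c, hc, hcp, hcU, hcX⟩ := hp.exists_chart hU hf
  let A := Γ(X, i ⁻¹ᵁ U)
  let φ := (i.app U).hom
  have hφ : Function.Surjective φ := i.app_surjective U hU
  have hker : RingHom.ker φ = Ideal.span (Set.range f) := by
    rw [← hf, Scheme.Hom.ker_apply]
  choose π hπ hπk hπC hπX using fun j => blowUpChart.exists_fibre_hom f j hq (hz j) φ hφ hker
  -- The exceptional divisor in chart `j`: the closed subscheme cut out by `f_j`, which is an affine
  -- space over the part of `X` in `U`.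
  let e : ∀ j : Fin n, Spec (.of (MvPolynomial {l // l ≠ j} A)) ⟶ T := fun j =>
    Spec.map (CommRingCat.ofHom (π j)) ≫ c j
  have he : ∀ j, IsClosedImmersion (Spec.map (CommRingCat.ofHom (π j))) := fun j =>
    IsClosedImmersion.spec_of_surjective _ (hπ j)
  have hrange : ∀ j (z : PrimeSpectrum (blowUpChart f j)),
      z ∈ Set.range (Spec.map (CommRingCat.ofHom (π j))) ↔
        algebraMap Γ(S, U) (blowUpChart f j) (f j) ∈ z.asIdeal := by
    intro j z
    have h1 : Set.range (Spec.map (CommRingCat.ofHom (π j))) =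
        PrimeSpectrum.zeroLocus (RingHom.ker (π j)) := range_comap_of_surjective _ (π j) (hπ j)
    have h2 : z ∈ Set.range (Spec.map (CommRingCat.ofHom (π j))) ↔
        RingHom.ker (π j) ≤ z.asIdeal := by
      rw [h1]
      exact PrimeSpectrum.mem_zeroLocus z _
    rw [h2, hπk, Ideal.span_singleton_le_iff_mem]
  have hpc : ∀ j (z : PrimeSpectrum (blowUpChart f j)),
      p (c j z) ∈ Set.range i ↔ algebraMap Γ(S, U) (blowUpChart f j) (f j) ∈ z.asIdeal := by
    intro j z
    have h1 : p (c j z) = hU.fromSpec (PrimeSpectrum.comap (algebraMap Γ(S, U) (blowUpChart f j)) z) :=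
      (Scheme.Hom.comp_apply (c j) p z).symm.trans (congrArg (fun t => t z) (hcp j))
    rw [h1, mem_range_iff_ideal_le_primeIdealOf, hf]
    rw [PrimeSpectrum.comap_asIdeal, ← Ideal.map_le_iff_le_comap, blowUpChart.map_span,
      Ideal.span_singleton_le_iff_mem]
  refine ⟨fun j => (c j).opensRange, e, ?_, ?_, ?_, ?_, ?_, ?_, ?_⟩
  · ext x
    rw [TopologicalSpace.Opens.coe_iSup]
    exact Set.ext_iff.mp hcU x
  · intro j
    exact isCompact_range (c j).continuous
  · intro j
    have := hc j
    exact inferInstanceAs (IsImmersion (Spec.map _ ≫ c j))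
  · intro j
    have h1 : CommRingCat.ofHom (algebraMap Γ(S, U) (blowUpChart f j)) ≫ CommRingCat.ofHom (π j) =
        i.app U ≫ CommRingCat.ofHom MvPolynomial.C := by
      refine CommRingCat.hom_ext (RingHom.ext fun r => ?_)
      exact hπC j r
    have h2 := IsAffineOpen.SpecMap_appLE_fromSpec i hU (hU.preimage i) le_rfl
    rw [Scheme.Hom.appLE_eq_app] at h2
    change (Spec.map _ ≫ c j) ≫ p = _
    rw [Category.assoc, hcp, chartMap, ← h2, ← Category.assoc, ← Spec.map_comp, h1, Spec.map_comp,
      Category.assoc]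
  · intro j
    ext x
    constructor
    · rintro ⟨y, rfl⟩
      exact ⟨⟨_, rfl⟩, (hpc j _).mpr ((hrange j _).mp ⟨y, rfl⟩)⟩
    · rintro ⟨⟨z, rfl⟩, h⟩
      obtain ⟨y, rfl⟩ := (hrange j z).mpr ((hpc j z).mp h)
      exact ⟨y, rfl⟩
  · intro j l x
    have h1 : e j x ∈ (c l).opensRange ↔
        PrimeSpectrum.comap (π j) x ∈ PrimeSpectrum.basicOpen (blowUpChart.frac f j l) :=
      hcX j l _
    rw [h1, PrimeSpectrum.mem_basicOpen, PrimeSpectrum.mem_basicOpen, ← hπX j l]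
    rfl
  · intro _ _ j
    have := hc j
    let z : PrimeSpectrum (blowUpChart f j) := PrimeSpectrum.comap (π j) ⊥
    have h0 : e j (⊥ : PrimeSpectrum _) = c j z := rfl
    have hzI : z.asIdeal = Ideal.span {algebraMap Γ(S, U) (blowUpChart f j) (f j)} := by
      rw [← hπk, PrimeSpectrum.comap_asIdeal]
      exact (RingHom.ker_eq_comap_bot _).symm
    have : IsNoetherianRing (blowUpChart f j) :=
      Algebra.FiniteType.isNoetherianRing Γ(S, U) _
    -- Krull's principal ideal theorem: over a domain `A` the ideal of the exceptional divisor is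
    -- prime, and it is generated by a nonzerodivisor.
    have h1 : z.asIdeal.height = 1 := by
      have hpr := z.isPrime
      have hne : z.asIdeal ≠ ⊤ := hpr.ne_top
      rw [hzI] at hne ⊢
      exact Ideal.height_span_singleton_eq_one_of_mem_nonZeroDivisors
        (blowUpChart.mem_nonZeroDivisors f j) (fun h => hne (Ideal.span_singleton_eq_top.mpr h))
    rw [h0]
    exact (coheight_eq_of_isOpenImmersion (c j)).trans
      ((idealHeight_eq_coheight (.of (blowUpChart f j)) z).symm.trans h1)

end ExceptionalCharts

end Motivic

namespace Motivic

/-! ### The class of a smooth blow-up -/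

section BlowUpClass

variable {k : Type u} [Field k]

/-- The charts of the blow-up of a variety in a subvariety, near a point where both are smooth. -/
theorem IsBlowUp.exists_exceptional_chart_at {X S T : Sch k} [IsVariety X] [IsVariety S] {i : X ⟶ S}
    [IsClosedImmersion i.left] {p : T ⟶ S} (hp : IsBlowUp p.left i.left.ker) {m : ℕ}
    (hm : codim i = m) (x : X.left) (hX : SmoothAt X x) (hS : SmoothAt S (i.left x)) :
    ∃ (U : S.left.Opens) (hU : IsAffineOpen U) (V : Fin m → T.left.Opens)
      (e : ∀ j : Fin m, Spec (.of (MvPolynomial {l // l ≠ j} Γ(X.left, i.left ⁻¹ᵁ U))) ⟶ T.left),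
      i.left x ∈ U ∧
      ⨆ j, V j = p.left ⁻¹ᵁ U ∧ (∀ j, IsCompact (V j : Set T.left)) ∧ (∀ j, IsImmersion (e j)) ∧
      (∀ j, e j ≫ p.left = Spec.map (CommRingCat.ofHom MvPolynomial.C) ≫
        (hU.preimage i.left).fromSpec ≫ i.left) ∧
      (∀ j, Set.range (e j) = (V j : Set T.left) ∩ p.left ⁻¹' Set.range i.left) ∧
      (∀ (j : Fin m) (l : {l : Fin m // l ≠ j}) (x : PrimeSpectrum (MvPolynomial _ _)),
        e j x ∈ V l ↔ x ∈ PrimeSpectrum.basicOpen (MvPolynomial.X l)) ∧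
      ∀ (_ : IsDomain Γ(X.left, i.left ⁻¹ᵁ U)) (j : Fin m),
        Order.coheight (e j (⊥ : PrimeSpectrum _)) = 1 := by
  obtain ⟨U, hU, n, f, hxU, hf, hq⟩ := exists_quasiRegular_frame i x hX hS
  have hn := codim_eq_of_quasiRegular i hU x hxU hf hq
  obtain rfl : n = m := by
    rw [hm] at hn
    exact_mod_cast hn.symm
  have : IsLocallyNoetherian S.left := LocallyOfFiniteType.isLocallyNoetherian S.hom
  have hN : IsNoetherianRing Γ(S.left, U) := IsLocallyNoetherian.component_noetherian ⟨U, hU⟩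
  have : Nonempty U := ⟨⟨_, hxU⟩⟩
  have hη : i.left (genericPoint X.left) ∈ U :=
    ((genericPoint_specializes x).map i.left.continuous).mem_open U.2 hxU
  have htop : Ideal.span (Set.range f) ≠ ⊤ := by
    rw [← hf, ← primeIdealOf_genericPoint_image i.left hU hη]
    exact Ideal.IsPrime.ne_top inferInstance
  -- On the integral scheme `S` nonzero sections over `U` are nonzerodivisors.
  obtain ⟨V, e, h1, h2, h3, h4, h5, h6, h7⟩ := hp.exists_exceptional_chart hU hf hq
    (fun j => mem_nonZeroDivisors_of_ne_zero (hq.ne_zero htop j))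
  exact ⟨U, hU, V, e, hxU, h1, h2, h3, h4, h5, h6, fun hA j => h7 hN hA j⟩

lemma SmoothAt.of_smooth {M : Sch k} [Smooth M.hom] (x : M.left) : SmoothAt M x :=
  ⟨⊤, trivial, inferInstance⟩

/-- The complement of a closed subscheme. -/
noncomputable def centerCompl {X S : Sch k} (i : X ⟶ S) [IsClosedImmersion i.left] : S.left.Opens :=
  ⟨(Set.range i.left)ᶜ, i.left.isClosedEmbedding.isClosed_range.isOpen_compl⟩

lemma IsBlowUp.isIso_centerCompl {X S T : Sch k} {i : X ⟶ S}
    [IsClosedImmersion i.left] {p : T ⟶ S} (hp : IsBlowUp p.left i.left.ker) :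
    IsIso (p.left ∣_ centerCompl i) :=
  hp.isIso_morphismRestrict _ fun x hx => by
    rw [mem_support_ker_iff]
    exact hx

/-- An L-link does not require `T` to be of finite type, which its class presupposes. Finitely many
groups of affine charts cover the part above the center, and the rest is isomorphic to an open
subset of a Noetherian space. -/
lemma IsBlowUp.compactSpace {X S T : Sch k} [IsVariety X] [IsVariety S] {i : X ⟶ S}
    [IsClosedImmersion i.left] [Smooth X.hom] [Smooth S.hom] {p : T ⟶ S}
    (hp : IsBlowUp p.left i.left.ker) {m : ℕ}
    (hm : codim i = m) : CompactSpace T.left := by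
  choose U hU V e hxU hV hc _ using fun x => hp.exists_exceptional_chart_at hm x
    (.of_smooth x) (.of_smooth _)
  have : CompactSpace X.left := QuasiCompact.compactSpace_of_compactSpace X.hom
  have : IsLocallyNoetherian S.left := LocallyOfFiniteType.isLocallyNoetherian S.hom
  have : CompactSpace S.left := QuasiCompact.compactSpace_of_compactSpace S.hom
  have : IsNoetherian S.left := {}
  obtain ⟨t, ht⟩ := isCompact_univ.elim_finite_subcover (fun x => (i.left ⁻¹ᵁ U x : Set X.left))
    (fun x => (i.left ⁻¹ᵁ U x).2) (fun x _ => Set.mem_iUnion.mpr ⟨x, hxU x⟩)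
  have hcU : ∀ x, IsCompact (p.left ⁻¹ᵁ U x : Set T.left) := fun x => by
    rw [← hV, TopologicalSpace.Opens.coe_iSup]
    exact isCompact_iUnion (hc x)
  have h0 : IsCompact (p.left ⁻¹ᵁ centerCompl i : Set T.left) := by
    have := hp.isIso_centerCompl
    have h1 : CompactSpace (centerCompl i).toScheme :=
      isCompact_iff_compactSpace.mp (TopologicalSpace.NoetherianSpace.isCompact _)
    exact isCompact_iff_compactSpace.mpr
      ((p.left ∣_ centerCompl i).homeomorph.symm.compactSpace)
  refine ⟨(h0.union (t.isCompact_biUnion fun x _ => hcU x)).of_isClosed_subset isClosed_univ ?_⟩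
  intro y _
  by_cases hy : p.left y ∈ Set.range i.left
  · right
    obtain ⟨x, hx⟩ := hy
    obtain ⟨x', hx', hxx'⟩ := Set.mem_iUnion₂.mp (ht (Set.mem_univ x))
    refine Set.mem_iUnion₂.mpr ⟨x', hx', ?_⟩
    change p.left y ∈ U x'
    rw [← hx]
    exact hxx'
  · exact Or.inl hy

/-- One step of a covering argument: `d` is the class of the part of `X` in `U` but not in `W`. As
`W` contains the complement of the center, what is added to `T` lies over that part of `X` and is
cut into cells by the restricted charts. -/
lemma k0Class_opn_preimage_sup {X S T : Sch k} [IsFiniteType X] [IsFiniteType T] {i : X ⟶ S}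
    {p : T ⟶ S} {m : ℕ} {U W : S.left.Opens} (hUi : IsAffineOpen (i.left ⁻¹ᵁ U))
    (hW : ∀ s ∉ W, s ∈ Set.range i.left) (V : Fin m → T.left.Opens)
    (e : ∀ j : Fin m, Spec (.of (MvPolynomial {l // l ≠ j} Γ(X.left, i.left ⁻¹ᵁ U))) ⟶ T.left)
    (hV : ⨆ j, V j = p.left ⁻¹ᵁ U) (he : ∀ j, IsImmersion (e j))
    (hep : ∀ j, e j ≫ p.left = Spec.map (CommRingCat.ofHom MvPolynomial.C) ≫
        hUi.fromSpec ≫ i.left)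
    (her : ∀ j, Set.range (e j) = (V j : Set T.left) ∩ p.left ⁻¹' Set.range i.left)
    (hex : ∀ (j : Fin m) (l : {l : Fin m // l ≠ j}) (x : PrimeSpectrum (MvPolynomial _ _)),
        e j x ∈ V l ↔ x ∈ PrimeSpectrum.basicOpen (MvPolynomial.X l)) :
    ∃ d : K0 k, k0Class (opn X (i.left ⁻¹ᵁ (W ⊔ U))) = k0Class (opn X (i.left ⁻¹ᵁ W)) + d ∧
      k0Class (opn T (p.left ⁻¹ᵁ (W ⊔ U))) = k0Class (opn T (p.left ⁻¹ᵁ W)) +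
        (∑ j ∈ Finset.range m, lefschetz k ^ j) * d := by
  let A := Γ(X.left, i.left ⁻¹ᵁ U)
  obtain ⟨α, hα⟩ := Spec.map_surjective (hUi.fromSpec ≫ X.hom)
  let Z : Set (PrimeSpectrum A) := (hUi.fromSpec ⁻¹ᵁ (i.left ⁻¹ᵁ W)).1ᶜ
  have hZ : IsClosed Z := (hUi.fromSpec ⁻¹ᵁ (i.left ⁻¹ᵁ W)).2.isClosed_compl
  -- The new piece of `X` carries its reduced structure as a closed subscheme of an affine open.
  let J : Ideal A := PrimeSpectrum.vanishingIdeal Z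
  have hZJ : PrimeSpectrum.zeroLocus (J : Set A) = Z := by
    rw [PrimeSpectrum.zeroLocus_vanishingIdeal_eq_closure, hZ.closure_eq]
  have hmemZ : ∀ y : PrimeSpectrum A, J ≤ y.asIdeal ↔ i.left (hUi.fromSpec y) ∉ W := by
    intro y
    have h1 : y ∈ PrimeSpectrum.zeroLocus (J : Set A) ↔ y ∈ Z := by rw [hZJ]
    exact (PrimeSpectrum.mem_zeroLocus y _).symm.trans h1
  let μ : A →+* A ⧸ J := Ideal.Quotient.mk J
  let β : k →+* A ⧸ J := μ.comp α.hom
  have hμ : IsClosedImmersion (Spec.map (CommRingCat.ofHom μ)) :=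
    IsClosedImmersion.spec_of_surjective _ Ideal.Quotient.mk_surjective
  have hβ : Spec.map (CommRingCat.ofHom β) = Spec.map (CommRingCat.ofHom μ) ≫ hUi.fromSpec ≫ X.hom := by
    rw [← hα, ← Spec.map_comp]
    rfl
  let s : specOver β ⟶ X := Over.homMk (Spec.map (CommRingCat.ofHom μ) ≫ hUi.fromSpec)
    ((Category.assoc _ _ _).trans hβ.symm)
  have hs : IsImmersion s.left :=
    inferInstanceAs (IsImmersion (Spec.map (CommRingCat.ofHom μ) ≫ hUi.fromSpec))
  have hft : IsFiniteType (specOver β) := isFiniteType_of_immersion s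
  have hμr : ∀ y : PrimeSpectrum A, y ∈ Set.range (Spec.map (CommRingCat.ofHom μ)) ↔ J ≤ y.asIdeal := by
    intro y
    have h1 : Set.range (Spec.map (CommRingCat.ofHom μ)) = PrimeSpectrum.zeroLocus (RingHom.ker μ) :=
      range_comap_of_surjective _ μ Ideal.Quotient.mk_surjective
    rw [h1, Ideal.mk_ker]
    exact PrimeSpectrum.mem_zeroLocus y _
  refine ⟨k0Class (specOver β), k0Class_opn_eq_add s _ _ (fun x hx => Or.inl hx) ?_, ?_⟩
  · ext x
    constructor
    · rintro ⟨y, rfl⟩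
      have h1 : hUi.fromSpec (Spec.map (CommRingCat.ofHom μ) y) ∈ i.left ⁻¹ᵁ U := by
        have : hUi.fromSpec (Spec.map (CommRingCat.ofHom μ) y) ∈ Set.range hUi.fromSpec := ⟨_, rfl⟩
        rwa [hUi.range_fromSpec] at this
      exact ⟨Or.inr h1, (hmemZ _).mp ((hμr _).mp ⟨y, rfl⟩)⟩
    · rintro ⟨h1, h2⟩
      have h3 : x ∈ i.left ⁻¹ᵁ U := h1.resolve_left h2
      rw [← SetLike.mem_coe, ← hUi.range_fromSpec] at h3
      obtain ⟨y, rfl⟩ := h3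
      obtain ⟨z, rfl⟩ := (hμr y).mpr ((hmemZ y).mpr h2)
      exact ⟨z, rfl⟩
  -- The exceptional charts are restricted to the new piece by reducing coefficients modulo `J`.
  · let μ' : ∀ j : Fin m, MvPolynomial {l // l ≠ j} A →+* MvPolynomial {l // l ≠ j} (A ⧸ J) :=
      fun j => MvPolynomial.map μ
    have hμ's : ∀ j, Function.Surjective (μ' j) := fun j =>
      MvPolynomial.map_surjective _ Ideal.Quotient.mk_surjective
    have hμ' : ∀ j, IsClosedImmersion (Spec.map (CommRingCat.ofHom (μ' j))) := fun j =>
      IsClosedImmersion.spec_of_surjective _ (hμ's j)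
    have hμ'r : ∀ j (y : PrimeSpectrum (MvPolynomial {l // l ≠ j} A)),
        y ∈ Set.range (Spec.map (CommRingCat.ofHom (μ' j))) ↔
          J ≤ (PrimeSpectrum.comap MvPolynomial.C y).asIdeal := by
      intro j y
      have h1 : Set.range (Spec.map (CommRingCat.ofHom (μ' j))) =
          PrimeSpectrum.zeroLocus (RingHom.ker (μ' j)) :=
        range_comap_of_surjective _ _ (hμ's j)
      have h2 : y ∈ Set.range (Spec.map (CommRingCat.ofHom (μ' j))) ↔ RingHom.ker (μ' j) ≤ y.asIdeal := by
        rw [h1]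
        exact PrimeSpectrum.mem_zeroLocus y _
      rw [h2, PrimeSpectrum.comap_asIdeal, ← Ideal.map_le_iff_le_comap, MvPolynomial.ker_map,
        Ideal.mk_ker]
    let e' : ∀ j : Fin m, specOver ((MvPolynomial.C (σ := {l : Fin m // l ≠ j})).comp β) ⟶ T :=
      fun j => Over.homMk (Spec.map (CommRingCat.ofHom (μ' j)) ≫ e j) (by
        change (Spec.map (CommRingCat.ofHom (μ' j)) ≫ e j) ≫ T.hom = Spec.map _
        rw [← Over.w p, Category.assoc, reassoc_of% (hep j), Over.w i, ← hα, ← Spec.map_comp,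
          ← Spec.map_comp]
        congr 1
        refine CommRingCat.hom_ext (RingHom.ext fun a => ?_)
        exact MvPolynomial.map_C μ (α.hom a))
    have he' : ∀ j, IsImmersion (e' j).left := fun j =>
      inferInstanceAs (IsImmersion (Spec.map (CommRingCat.ofHom (μ' j)) ≫ e j))
    have hpe : ∀ j (y : PrimeSpectrum (MvPolynomial {l // l ≠ j} A)),
        y ∈ Set.range (Spec.map (CommRingCat.ofHom (μ' j))) ↔ p.left (e j y) ∉ W := fun j y => by
      have h1 : p.left (e j y) = i.left (hUi.fromSpec (PrimeSpectrum.comap MvPolynomial.C y)) :=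
        (Scheme.Hom.comp_apply (e j) p.left y).symm.trans (congrArg (fun t => t y) (hep j))
      rw [hμ'r, hmemZ]
      exact not_congr (Iff.of_eq (congrArg (· ∈ W) h1.symm))
    have key := k0Class_opn_projective_strata β e' (p.left ⁻¹ᵁ W) V (fun j => ?_) (fun j l x => ?_)
    · rw [hV] at key
      exact key
    · ext t
      constructor
      · rintro ⟨y, rfl⟩
        have h1 : e j (Spec.map (CommRingCat.ofHom (μ' j)) y) ∈ Set.range (e j) := ⟨_, rfl⟩
        rw [her] at h1
        exact ⟨h1.1, (hpe j _).mp ⟨y, rfl⟩⟩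
      · rintro ⟨h1, h2⟩
        have h3 : t ∈ Set.range (e j) := by
          rw [her]
          exact ⟨h1, hW _ h2⟩
        obtain ⟨y, rfl⟩ := h3
        obtain ⟨z, rfl⟩ := (hpe j y).mpr h2
        exact ⟨z, rfl⟩
    · have h1 : (e' j).left x ∈ V l ↔ PrimeSpectrum.comap (μ' j) x ∈
          PrimeSpectrum.basicOpen (MvPolynomial.X l) := hex j l _
      rw [h1, PrimeSpectrum.mem_basicOpen, PrimeSpectrum.mem_basicOpen,
        ← MvPolynomial.map_X μ l]
      rfl

/-- The class of a smooth blow-up. -/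
theorem IsBlowUp.k0Class_add {X S T : Sch k} [IsVariety X] [IsVariety S] [IsFiniteType T]
    {i : X ⟶ S} [IsClosedImmersion i.left] [Smooth X.hom] [Smooth S.hom] {p : T ⟶ S}
    (hp : IsBlowUp p.left i.left.ker) {m : ℕ} (hm : codim i = m) :
    k0Class T + k0Class X =
      k0Class S + (∑ j ∈ Finset.range m, lefschetz k ^ j) * k0Class X := by
  classical
  choose U hU V e hxU hV hc he hep her hex _ using fun x => hp.exists_exceptional_chart_at hm x
    (.of_smooth x) (.of_smooth _)
  have : CompactSpace X.left := QuasiCompact.compactSpace_of_compactSpace X.hom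
  obtain ⟨t, ht⟩ := isCompact_univ.elim_finite_subcover (fun x => (i.left ⁻¹ᵁ U x : Set X.left))
    (fun x => (i.left ⁻¹ᵁ U x).2) (fun x _ => Set.mem_iUnion.mpr ⟨x, hxU x⟩)
  let O := centerCompl i
  -- The product formula for projective bundles, without gluing: start from the complement of the
  -- center and add one neighbourhood at a time.
  have key : ∀ s : Finset X.left, k0Class (opn T (p.left ⁻¹ᵁ (O ⊔ s.sup U))) =
      k0Class (opn T (p.left ⁻¹ᵁ O)) +
      (∑ j ∈ Finset.range m, lefschetz k ^ j) * k0Class (opn X (i.left ⁻¹ᵁ (O ⊔ s.sup U))) := by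
    intro s
    induction s using Finset.induction_on with
    | empty =>
      rw [Finset.sup_empty, sup_bot_eq]
      have : IsEmpty (opn X (i.left ⁻¹ᵁ O)).left := ⟨fun x => x.2 ⟨_, rfl⟩⟩
      rw [k0Class_of_isEmpty (opn X (i.left ⁻¹ᵁ O)), mul_zero, add_zero]
    | insert x s hx ih =>
      have hOs : O ⊔ (insert x s).sup U = (O ⊔ s.sup U) ⊔ U x := by
        rw [Finset.sup_insert, sup_comm (U x), sup_assoc]
      obtain ⟨d, hd1, hd2⟩ := k0Class_opn_preimage_sup (W := O ⊔ s.sup U) ((hU x).preimage i.left)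
        (fun y hy => by
          by_contra h
          exact hy (Or.inl h)) (V x) (e x) (hV x) (he x) (hep x) (her x) (hex x)
      rw [hOs, hd1, hd2, ih]
      ring
  have htop : O ⊔ t.sup U = ⊤ := by
    rw [eq_top_iff]
    intro y _
    by_cases hy : y ∈ Set.range i.left
    · right
      obtain ⟨x, rfl⟩ := hy
      obtain ⟨x', hx', hxx'⟩ := Set.mem_iUnion₂.mp (ht (Set.mem_univ x))
      exact (Finset.le_sup (f := U) hx') hxx'
    · exact Or.inl hy
  have h1 := key t
  rw [htop] at h1
  have h2 : k0Class T = k0Class (opn T (p.left ⁻¹ᵁ O)) +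
      (∑ j ∈ Finset.range m, lefschetz k ^ j) * k0Class X := by
    rw [← k0Class_opn_top T, ← k0Class_opn_top X]
    exact h1
  have h3 : k0Class S = k0Class (opn S O) + k0Class X := by
    rw [← k0Class_opn_top S]
    refine k0Class_opn_eq_add i O ⊤ le_top ?_
    change _ = Set.univ \ (Set.range i.left)ᶜ
    simp
  have h4 : k0Class (opn T (p.left ⁻¹ᵁ O)) = k0Class (opn S O) := by
    have : IsIso (p.left ∣_ O) := hp.isIso_centerCompl
    let φ : (p.left ⁻¹ᵁ O).toScheme ≅ O.toScheme := asIso (p.left ∣_ O)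
    refine k0Class_eq_of_iso (Over.isoMk φ ?_)
    change p.left ∣_ O ≫ O.ι ≫ S.hom = (p.left ⁻¹ᵁ O).ι ≫ T.hom
    rw [← Category.assoc, morphismRestrict_ι, Category.assoc, Over.w p]
  rw [h2, h3, h4]
  ring

end BlowUpClass

end Motivic

namespace Motivic

/-! ### The relation given by a smooth link -/

section SmoothLink

variable {k : Type u} [Field k]

/-- With no equations there are no charts, so nothing would lie above the center. Nonvanishing makes
the subtraction in `m - 1` genuine. -/
lemma IsBlowUp.codim_ne_zero {X S T : Sch k} [IsVariety X] [IsVariety S]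
    {i : X ⟶ S} [IsClosedImmersion i.left] [Smooth X.hom] [Smooth S.hom] {p : T ⟶ S}
    (hp : IsBlowUp p.left i.left.ker) {m : ℕ} (hm : codim i = m)
    (hne : (p.left ⁻¹' Set.range i.left).Nonempty) : m ≠ 0 := by
  rintro rfl
  obtain ⟨t, x, hx⟩ := hne
  obtain ⟨U, hU, V, e, hxU, hV, -⟩ := hp.exists_exceptional_chart_at hm x
    (.of_smooth x) (.of_smooth _)
  have h : t ∈ p.left ⁻¹ᵁ U := by
    change p.left t ∈ U
    rwa [← hx]
  rw [← hV, iSup_of_empty] at h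
  exact h

lemma one_add_lefschetz_mul_sum {m : ℕ} (hm : m ≠ 0) :
    ∑ j ∈ Finset.range m, lefschetz k ^ j =
      1 + lefschetz k * ∑ j ∈ Finset.range (m - 1), lefschetz k ^ j := by
  obtain ⟨n, rfl⟩ := Nat.exists_eq_succ_of_ne_zero hm
  rw [Finset.sum_range_succ', pow_zero, add_comm, Nat.succ_sub_one, Finset.mul_sum]
  simp only [pow_succ']

/-- The relation in the Grothendieck ring given by a smooth L-link. -/
theorem LLink.IsSmooth.lefschetz_mul_sub_eq_zero {L : LLink k} (hL : L.IsSmooth) {m m' : ℕ}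
    (hm : codim L.i = m) (hm' : codim L.j = m') :
    lefschetz k * (k0Class (projSpace k (m - 1)) * k0Class L.X -
        k0Class (projSpace k (m' - 1)) * k0Class L.Y) = 0 := by
  have := L.isClosedImmersion_i
  have := L.isClosedImmersion_j
  have := hL.X
  have := hL.Y
  have := hL.source
  have := hL.target
  have := hL.T
  have hc := L.isBlowUp_p.compactSpace hm
  have : IsFiniteType L.T :=
    { locallyOfFiniteType := inferInstance
      quasiCompact := (quasiCompact_iff_compactSpace (f := L.T.hom)).mpr hc }
  have h1 := L.isBlowUp_p.k0Class_add hm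
  have h2 := L.isBlowUp_q.k0Class_add hm'
  rw [one_add_lefschetz_mul_sum (L.isBlowUp_p.codim_ne_zero hm L.irreducible_p.nonempty)] at h1
  rw [one_add_lefschetz_mul_sum (L.isBlowUp_q.codim_ne_zero hm' L.irreducible_q.nonempty)] at h2
  rw [k0Class_projSpace, k0Class_projSpace]
  have h3 := L.class_eq
  linear_combination h2 - h1 - h3

end SmoothLink

end Motivic

namespace Motivic

/-! ### Immersions with a common generic point -/

section Immersions

/-- An immersion into an integral scheme whose image contains the generic point is open. -/
lemma isOpenImmersion_of_genericPoint_mem {P Z : Scheme.{u}} [IsIntegral Z] (f : P ⟶ Z)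
    [IsImmersion f] (h : genericPoint Z ∈ Set.range f) : IsOpenImmersion f := by
  have hd : Dense (Set.range f) := by
    rw [dense_iff_closure_eq, Set.eq_univ_iff_forall]
    intro z
    exact (genericPoint_specializes z).mem_closed isClosed_closure (subset_closure h)
  have hs : Surjective f.liftCoborder := by
    refine ⟨fun y => ?_⟩
    have hy : y.1 ∈ coborder (Set.range f) := y.2
    -- The coborder of a dense set is the set itself, so the closed immersion into the open coborder
    -- is surjective; its target is reduced, hence it is an isomorphism.
    rw [coborder_eq_union_closure_compl, hd.closure_eq, Set.compl_univ, Set.union_empty] at hy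
    obtain ⟨x, hx⟩ := hy
    refine ⟨x, Subtype.ext ?_⟩
    rw [← hx]
    change f.coborderRange.ι (f.liftCoborder x) = _
    rw [← Scheme.Hom.comp_apply, f.liftCoborder_ι]
  have : IsIso f.liftCoborder := isIso_of_isClosedImmersion_of_surjective _
  rw [← f.liftCoborder_ι]
  infer_instance

lemma isDominant_of_isOpenImmersion {P Z : Scheme.{u}} [IsIntegral Z] (f : P ⟶ Z) [IsOpenImmersion f]
    [Nonempty P] : IsDominant f :=
  ⟨f.isOpenEmbedding.isOpen_range.dense (Set.range_nonempty f)⟩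

/-- Two integral locally closed subschemes with the same generic point are birational. -/
lemma birationalOver_of_immersion {Z₁ Z₂ M B : Scheme.{u}} [IsIntegral Z₁] [IsIntegral Z₂] (a : Z₁ ⟶ M)
    (b : Z₂ ⟶ M) [IsImmersion a] [IsImmersion b] (h : a (genericPoint Z₁) = b (genericPoint Z₂))
    (s : M ⟶ B) : Scheme.BirationalOver (a ≫ s) (b ≫ s) := by
  -- The fibre product has a point above both generic points, so it is a nonempty open subscheme of
  -- both sides.
  obtain ⟨z, hz1, hz2⟩ := Scheme.Pullback.exists_preimage_pullback _ _ h
  have : Nonempty (Limits.pullback a b : Scheme) := ⟨z⟩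
  have h1 : IsImmersion (Limits.pullback.fst a b) := inferInstance
  have h2 : IsImmersion (Limits.pullback.snd a b) := inferInstance
  have := isOpenImmersion_of_genericPoint_mem (Limits.pullback.fst a b) ⟨z, hz1⟩
  have := isOpenImmersion_of_genericPoint_mem (Limits.pullback.snd a b) ⟨z, hz2⟩
  have := isDominant_of_isOpenImmersion (Limits.pullback.fst a b)
  have := isDominant_of_isOpenImmersion (Limits.pullback.snd a b)
  exact (Scheme.Hom.birationalOver (Limits.pullback.fst a b) (a ≫ s) _ rfl).symm.trans
    (Scheme.Hom.birationalOver (Limits.pullback.snd a b) (b ≫ s) _ (by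
      rw [← Category.assoc, ← Category.assoc, Limits.pullback.condition]))

end Immersions

/-! ### Separatedness of projective space -/

section ProjectiveSeparated

attribute [local instance] MvPolynomial.gradedAlgebra

lemma isSeparated_projSpace (k : Type u) [Field k] (m : ℕ) : IsSeparated (projSpace k m).hom :=
  inferInstanceAs (IsSeparated (Proj.toSpecZero (MvPolynomial.homogeneousSubmodule (Fin m) k) ≫
    Spec.map (CommRingCat.ofHom
      (algebraMap k (MvPolynomial.homogeneousSubmodule (Fin m) k 0)))))

end ProjectiveSeparated

/-! ### Products with projective space -/

section ProjectiveProducts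

variable {k : Type u} [Field k]

/-- Reducedness is local. For irreducibility, a nonempty open set meeting `V j` also meets the
overlap with `V l`, and inside the irreducible `V l` it meets any nonempty open set. -/
lemma isIntegral_of_iSup_eq_top {P : Scheme.{u}} {ι : Type*} [Nonempty ι] (V : ι → P.Opens)
    (hV : ⨆ j, V j = ⊤) (hi : ∀ j, IsIntegral (V j).toScheme)
    (hne : ∀ j l, ((V j : Set P) ∩ V l).Nonempty) : IsIntegral P := by
  have hcov : ∀ x : P, ∃ j, x ∈ V j := fun x => by
    have : x ∈ ⨆ j, V j := by rw [hV]; trivial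
    exact TopologicalSpace.Opens.mem_iSup.mp this
  have hred : IsReduced P := by
    refine ⟨fun U => ⟨fun s hs => ?_⟩⟩
    refine P.IsSheaf.section_ext fun x hx => ?_
    obtain ⟨j, hj⟩ := hcov x
    refine ⟨U ⊓ V j, inf_le_left, ⟨hx, hj⟩, ?_⟩
    rw [map_zero]
    have h1 : IsReduced (U ⊓ V j).toScheme :=
      isReduced_of_isOpenImmersion (P.homOfLE (inf_le_right : U ⊓ V j ≤ V j))
    have h2 : _root_.IsReduced Γ(P, U ⊓ V j) :=
      isReduced_of_injective (U ⊓ V j).topIso.inv.hom (ConcreteCategory.bijective_of_isIso _).1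
    exact (hs.map (P.presheaf.map (homOfLE inf_le_left).op).hom).eq_zero
  have hirr : ∀ j, IsIrreducible (V j : Set P) := fun j => by
    have h1 := (IrreducibleSpace.isIrreducible_univ (V j).toScheme).image (V j).ι
      (V j).ι.continuous.continuousOn
    rwa [Set.image_univ, Scheme.Opens.range_ι] at h1
  have : IrreducibleSpace P := by
    have j := Classical.arbitrary ι
    have hne' : Nonempty P := ⟨(hirr j).1.choose⟩
    have : PreirreducibleSpace P := by
      refine ⟨fun A B hA hB ⟨a, _, ha⟩ ⟨b, _, hb⟩ => ?_⟩
      obtain ⟨j, hj⟩ := hcov a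
      obtain ⟨l, hl⟩ := hcov b
      obtain ⟨c, hc, hcA, hcl⟩ := (hirr j).2 A (V l) hA (V l).2 ⟨a, hj, ha⟩ (hne j l)
      obtain ⟨d, hd, hdA, hdB⟩ := (hirr l).2 A B hA hB ⟨c, hcl, hcA⟩ ⟨b, hl, hb⟩
      exact ⟨d, trivial, hdA, hdB⟩
    exact ⟨hne'⟩
  exact isIntegral_of_irreducibleSpace_of_isReduced P

lemma isPullback_SpecMap_mvPolynomial (σ : Type) {R A : Type u} [CommRing R] [CommRing A]
    (α : R →+* A) : IsPullback (Spec.map (CommRingCat.ofHom (MvPolynomial.map (σ := σ) α)))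
      (Spec.map (CommRingCat.ofHom (MvPolynomial.C (σ := σ))))
      (Spec.map (CommRingCat.ofHom (MvPolynomial.C (σ := σ)))) (Spec.map (CommRingCat.ofHom α)) := by
  let := α.toAlgebra
  let : Algebra (MvPolynomial σ R) (MvPolynomial σ A) := MvPolynomial.algebraMvPolynomial
  exact isPullback_SpecMap_of_isPushout _ _ _ _
    (CommRingCat.isPushout_of_isPushout R (MvPolynomial σ R) A (MvPolynomial σ A))

instance geometricallyIntegral_SpecMap_C (σ : Type) :
    GeometricallyIntegral (Spec.map (CommRingCat.ofHom (MvPolynomial.C (R := k) (σ := σ)))) := by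
  rw [geometricallyIntegral_iff]
  introv K h
  obtain ⟨a, rfl⟩ := Spec.map_surjective ‹Spec (.of K) ⟶ Spec (.of k)›
  let e := h.isoIsPullback _ _ (isPullback_SpecMap_mvPolynomial σ a.hom)
  have : Nonempty Z := ⟨e.inv (Classical.arbitrary (PrimeSpectrum (MvPolynomial σ K)))⟩
  exact isIntegral_of_isOpenImmersion e.hom

variable (k) in
/-- The underlying morphism of the `j`-th standard chart of projective space. -/
noncomputable def projChartMap {m : ℕ} (j : Fin m) :
    Spec (.of (MvPolynomial {l : Fin m // l ≠ j} k)) ⟶ (projSpace k m).left :=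
  (projChart k j).left

instance {m : ℕ} (j : Fin m) : IsOpenImmersion (projChartMap k j) := isOpenImmersion_projChart k j

lemma range_projChartMap {m : ℕ} (j : Fin m) :
    Set.range (projChartMap k j) = (projOpen k j : Set (projSpace k m).left) := range_projChart k j

lemma projChartMap_hom {m : ℕ} (j : Fin m) :
    projChartMap k j ≫ (projSpace k m).hom = Spec.map (CommRingCat.ofHom MvPolynomial.C) :=
  Over.w (projChart k j)

variable (k) in
/-- The `j`-th standard chart of projective space over a scheme. -/
noncomputable def projChartProd {m : ℕ} (j : Fin m) {Z : Scheme.{u}} (z : Z ⟶ Spec (.of k)) :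
    Limits.pullback (Spec.map (CommRingCat.ofHom
      (MvPolynomial.C (R := k) (σ := {l : Fin m // l ≠ j})))) z ⟶
      Limits.pullback (projSpace k m).hom z :=
  Limits.pullback.map _ _ _ _ (projChartMap k j) (𝟙 _) (𝟙 _)
    ((Category.comp_id _).trans (projChartMap_hom j).symm) (by simp)

instance {m : ℕ} (j : Fin m) {Z : Scheme.{u}} (z : Z ⟶ Spec (.of k)) :
    IsOpenImmersion (projChartProd k j z) := by
  unfold projChartProd
  exact Scheme.pullback_map_isOpenImmersion _ _ _ _ _ _ _ _ _

lemma range_projChartProd {m : ℕ} (j : Fin m) {Z : Scheme.{u}} (z : Z ⟶ Spec (.of k)) :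
    Set.range (projChartProd k j z) =
      Limits.pullback.fst (projSpace k m).hom z ⁻¹' (projOpen k j : Set (projSpace k m).left) := by
  unfold projChartProd
  rw [Scheme.Pullback.range_map, range_projChartMap]
  simp

variable (k) in
lemma nonempty_preimage_projOpen {m : ℕ} (X : Sch k) [Nonempty X.left] (j l : Fin m) :
    ((Limits.pullback.fst (projSpace k m).hom X.hom ⁻¹' (projOpen k j : Set (projSpace k m).left)) ∩
      (Limits.pullback.fst (projSpace k m).hom X.hom ⁻¹'
        (projOpen k l : Set (projSpace k m).left))).Nonempty := by
  have h : ((projOpen k j : Set (projSpace k m).left) ∩ projOpen k l).Nonempty := by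
    let η : PrimeSpectrum (MvPolynomial {l : Fin m // l ≠ j} k) := ⊥
    have h1 : (projChart k j).left η ∈ projOpen k j := by
      have : (projChart k j).left η ∈ Set.range (projChart k j).left := ⟨_, rfl⟩
      rwa [range_projChart] at this
    by_cases hlj : l = j
    · exact ⟨_, h1, hlj ▸ h1⟩
    · exact ⟨_, h1, (projChart_mem_basicOpen k j ⟨l, hlj⟩ η).mpr (MvPolynomial.X_ne_zero _)⟩
  obtain ⟨y, hy⟩ := h
  obtain ⟨z, hz, -⟩ := Scheme.Pullback.exists_preimage_pullback (f := (projSpace k m).hom) (g := X.hom)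
    y (Classical.arbitrary _) (Subsingleton.elim (α := PrimeSpectrum k) _ _)
  exact ⟨z, by rw [← Set.preimage_inter, Set.mem_preimage, hz]; exact hy⟩

/-- Projective space over a nonempty integral scheme is integral. -/
lemma isIntegral_prod_projSpace {m : ℕ} (hm : m ≠ 0) (X : Sch k) [IsFiniteType X] [IsIntegral X.left] :
    IsIntegral (Limits.pullback (projSpace k m).hom X.hom) := by
  have : Nonempty (Fin m) := ⟨⟨0, Nat.pos_of_ne_zero hm⟩⟩
  have : IsLocallyNoetherian X.left := LocallyOfFiniteType.isLocallyNoetherian X.hom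
  let π : Limits.pullback (projSpace k m).hom X.hom ⟶ (projSpace k m).left :=
    Limits.pullback.fst (projSpace k m).hom X.hom
  refine isIntegral_of_iSup_eq_top (fun j => π ⁻¹ᵁ projOpen k j) ?_ (fun j => ?_) (fun j l => ?_)
  · rw [← Scheme.Hom.preimage_iSup, iSup_projOpen]
    rfl
  -- Each piece is an open subscheme of an affine space over `X`, which is integral because affine
  -- space is geometrically integral.
  · let f := projChartProd k j X.hom
    let g := IsOpenImmersion.lift f (π ⁻¹ᵁ projOpen k j).ι (by
      rw [range_projChartProd, Scheme.Opens.range_ι]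
      rfl)
    have hg : g ≫ f = (π ⁻¹ᵁ projOpen k j).ι := IsOpenImmersion.lift_fac _ _ _
    have : IsOpenImmersion (g ≫ f) := by rw [hg]; infer_instance
    have : IsOpenImmersion g := IsOpenImmersion.of_comp g f
    have : Nonempty (π ⁻¹ᵁ projOpen k j).toScheme := by
      obtain ⟨x, hx⟩ := nonempty_preimage_projOpen k X j j
      exact ⟨⟨x, hx.1⟩⟩
    exact isIntegral_of_isOpenImmersion g
  · exact nonempty_preimage_projOpen k X j l

/-- The product of projective space and a variety is a variety. -/
lemma isVariety_prod_projSpace {m : ℕ} (hm : m ≠ 0) (X : Sch k) [IsVariety X] :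
    IsVariety (prod (projSpace k m) X) where
  toIsFiniteType := inferInstance
  isIntegral := isIntegral_prod_projSpace hm X
  isSeparated := by
    have : IsSeparated (projSpace k m).hom := isSeparated_projSpace k m
    exact inferInstanceAs (IsSeparated (Limits.pullback.fst (projSpace k m).hom X.hom ≫ _))

/-- The product of a variety with projective space is birational to affine space over an affine
open subset. -/
lemma birationalOver_prod_projSpace {m : ℕ} (j : Fin m) (X : Sch k) [IsVariety X]
    {W : X.left.Opens} (hW : IsAffineOpen W) [Nonempty W] :
    Scheme.BirationalOver (Spec.map (CommRingCat.ofHom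
      (MvPolynomial.C (R := Γ(X.left, W)) (σ := {l : Fin m // l ≠ j}))) ≫ hW.fromSpec ≫ X.hom)
      (prod (projSpace k m) X).hom := by
  have : IsIntegral (Limits.pullback (projSpace k m).hom X.hom) :=
    isIntegral_prod_projSpace (Nat.ne_zero_of_lt j.2) X
  obtain ⟨α, hα⟩ := Spec.map_surjective (hW.fromSpec ≫ X.hom)
  let h := isPullback_SpecMap_mvPolynomial {l : Fin m // l ≠ j} α.hom
  let g : Limits.pullback (Spec.map (CommRingCat.ofHom
      (MvPolynomial.C (R := k) (σ := {l : Fin m // l ≠ j})))) (Spec.map α) ⟶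
      Limits.pullback (projSpace k m).hom X.hom :=
    Limits.pullback.map _ _ _ _ (projChartMap k j) hW.fromSpec (𝟙 _)
      ((Category.comp_id _).trans (projChartMap_hom j).symm) ((Category.comp_id _).trans hα)
  have hg : IsOpenImmersion g := Scheme.pullback_map_isOpenImmersion _ _ _ _ _ _ _ _ _
  have hgs : g ≫ Limits.pullback.snd (projSpace k m).hom X.hom =
      Limits.pullback.snd _ _ ≫ hW.fromSpec := Limits.pullback.lift_snd _ _ _
  have : Nonempty (Spec (.of (MvPolynomial {l : Fin m // l ≠ j} Γ(X.left, W)))) :=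
    ⟨Classical.arbitrary (PrimeSpectrum _)⟩
  have := isDominant_of_isOpenImmersion (h.isoPullback.hom ≫ g)
  have hgh : h.isoPullback.hom ≫ g ≫ Limits.pullback.fst (projSpace k m).hom X.hom ≫
      (projSpace k m).hom = Spec.map (CommRingCat.ofHom MvPolynomial.C) ≫ hW.fromSpec ≫ X.hom := by
    rw [Limits.pullback.condition, reassoc_of% hgs, ← Category.assoc]
    exact congrArg (· ≫ hW.fromSpec ≫ X.hom) h.isoPullback_hom_snd
  exact Scheme.Hom.birationalOver (h.isoPullback.hom ≫ g)
    (Limits.pullback.fst (projSpace k m).hom X.hom ≫ (projSpace k m).hom) _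
    ((Category.assoc _ _ _).trans hgh)

end ProjectiveProducts

end Motivic

namespace Motivic

/-! ### Geometric reducedness and separable generation -/

section SeparablyGenerated

open TensorProduct

variable {k A : Type*} [Field k] [CommRing A] [Algebra k A]

/-- Half of MacLane's criterion. Given a relation `Σ c_i v_i^p = 0`, take `p`-th roots `b_i` of the
coefficients in the algebraic closure; then `Σ b_i ⊗ v_i` has vanishing `p`-th power, so it is zero
by reducedness, and independence persists under base change. -/
lemma linearIndepOn_pow_of_isReduced_tensor (p : ℕ) [Fact p.Prime] [CharP k p]
    [IsReduced (AlgebraicClosure k ⊗[k] A)] {ι : Type*} (s : Finset ι) {v : ι → A}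
    (hv : LinearIndepOn k v s) : LinearIndepOn k (fun i => v i ^ p) s := by
  classical
  have hA : CharP (AlgebraicClosure k) p := charP_of_injective_algebraMap
    (algebraMap k (AlgebraicClosure k)).injective p
  have hinj : LinearIndependent (AlgebraicClosure k)
      (fun i : (s : Set ι) => (1 : AlgebraicClosure k) ⊗ₜ[k] v i) :=
    Module.Flat.linearIndependent_one_tmul hv
  rw [linearIndepOn_finset_iff] at hv ⊢
  intro f hf
  rcases subsingleton_or_nontrivial (AlgebraicClosure k ⊗[k] A) with hsub | hnt
  · intro i hi
    exact absurd (Subsingleton.elim _ _) (hinj.ne_zero (⟨i, hi⟩ : (s : Set ι)))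
  have hT : CharP (AlgebraicClosure k ⊗[k] A) p := charP_of_injective_algebraMap
    (algebraMap (AlgebraicClosure k) (AlgebraicClosure k ⊗[k] A)).injective p
  have hroot : ∀ c : k, ∃ b : AlgebraicClosure k, b ^ p = algebraMap k _ c := fun c =>
    IsAlgClosed.exists_pow_nat_eq _ (Fact.out : p.Prime).pos
  choose b hb using hroot
  have hsum : ∑ i ∈ s, b (f i) ⊗ₜ[k] v i = 0 := by
    refine eq_zero_of_pow_eq_zero (n := p) ?_
    rw [sum_pow_char]
    have : ∀ i, (b (f i) ⊗ₜ[k] v i) ^ p = (1 : AlgebraicClosure k) ⊗ₜ[k] (f i • v i ^ p) := by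
      intro i
      rw [Algebra.TensorProduct.tmul_pow, hb, Algebra.algebraMap_eq_smul_one, smul_tmul]
    simp_rw [this, ← tmul_sum]
    rw [hf, tmul_zero]
  intro i hi
  have hinj' : LinearIndepOn (AlgebraicClosure k)
      (fun i => (1 : AlgebraicClosure k) ⊗ₜ[k] v i) (s : Set ι) := hinj
  rw [linearIndepOn_finset_iff] at hinj'
  have h : b (f i) = 0 := hinj' (fun i => b (f i)) (by simpa [smul_tmul'] using hsum) i hi
  have h' : algebraMap k (AlgebraicClosure k) (f i) = 0 := by
    rw [← hb, h, zero_pow (Fact.out : p.Prime).ne_zero]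
  exact (map_eq_zero _).mp h'

/-- In characteristic zero the base is perfect. In characteristic `p`, independence of `p`-th powers
gives a separating transcendence basis, and a separable extension of a purely transcendental one is
formally smooth. -/
lemma formallySmooth_of_isFractionRing [IsDomain A] [Algebra.FiniteType k A]
    [IsReduced (AlgebraicClosure k ⊗[k] A)] (K : Type*) [Field K] [Algebra A K] [Algebra k K]
    [IsScalarTower k A K] [IsFractionRing A K] : Algebra.FormallySmooth k K := by
  have hE : Algebra.EssFiniteType k K := by
    have := Algebra.EssFiniteType.of_isLocalization K (nonZeroDivisors A)
    exact Algebra.EssFiniteType.comp k A K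
  rcases CharP.exists' k with h0 | ⟨p, hp, hc⟩
  · exact Algebra.FormallySmooth.of_perfectField
  have := ExpChar.prime (R := k) hp.out
  obtain ⟨s, hs, H⟩ :=
    exists_isTranscendenceBasis_and_isSeparable_of_linearIndepOn_pow_of_essFiniteType (k := k)
      (K := K) p hp.out <| by
    intro s hs
    -- Clearing denominators moves the family into `A`, where reducedness is known; taking `p`-th
    -- powers multiplies it by `d ^ p`.
    obtain ⟨d, hd⟩ := IsLocalization.exist_integer_multiples_of_finset (nonZeroDivisors A) s
    choose! a ha using hd
    have hsm : ∀ (c : k) (x : A), algebraMap A K (c • x) = c • algebraMap A K x := fun c x =>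
      map_smul (IsScalarTower.toAlgHom k A K) c x
    have hd0 : algebraMap A K d ≠ 0 := IsFractionRing.to_map_ne_zero_of_mem_nonZeroDivisors d.2
    have hv : LinearIndepOn k a (s : Set K) := by
      rw [linearIndepOn_finset_iff] at hs ⊢
      intro f hf
      refine hs f ?_
      have h1 := congrArg (algebraMap A K) hf
      rw [map_sum, map_zero] at h1
      refine (mul_eq_zero.mp (?_ : algebraMap A K d * ∑ i ∈ s, f i • id i = 0)).resolve_left hd0
      rw [Finset.mul_sum, ← h1]
      refine Finset.sum_congr rfl fun i hi => ?_
      rw [hsm, mul_smul_comm, ha i hi, Algebra.smul_def (d : A)]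
      rfl
    have hw := linearIndepOn_pow_of_isReduced_tensor p s hv
    rw [linearIndepOn_finset_iff] at hw ⊢
    intro f hf
    refine hw f (IsFractionRing.injective A K ?_)
    rw [map_sum, map_zero]
    have h2 : algebraMap A K d ^ p * ∑ i ∈ s, f i • i ^ p = 0 := by rw [hf, mul_zero]
    rw [← h2, Finset.mul_sum]
    refine Finset.sum_congr rfl fun i hi => ?_
    rw [hsm, mul_smul_comm, map_pow, ha i hi, Algebra.smul_def (d : A), mul_pow]
  have : Algebra.IsSeparable (IntermediateField.adjoin k (Set.range ((↑) : s → K))) K := by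
    convert! H <;> simp
  exact .of_algebraicIndependent_of_isSeparable hs.1

end SeparablyGenerated

/-! ### Generic smoothness -/

section GenericSmoothness

variable {k : Type u} [Field k]

lemma isReduced_tensor_of_geometricallyReduced (X : Sch k) (hX : GeometricallyReduced X.hom)
    {U : X.left.Opens} (hU : IsAffineOpen U) (a : k →+* Γ(X.left, U))
    (ha : Spec.map (CommRingCat.ofHom a) = hU.fromSpec ≫ X.hom) :
    letI := a.toAlgebra
    IsReduced (TensorProduct k (AlgebraicClosure k) Γ(X.left, U)) := by
  let := a.toAlgebra
  have hr : IsReduced (Limits.pullback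
      (Spec.map (CommRingCat.ofHom (algebraMap k (AlgebraicClosure k)))) X.hom) :=
    pullback_of_geometrically' hX.geometrically_isReduced _ _
  let j := Limits.pullback.map
    (Spec.map (CommRingCat.ofHom (algebraMap k (AlgebraicClosure k))))
    (Spec.map (CommRingCat.ofHom (algebraMap k Γ(X.left, U))))
    (Spec.map (CommRingCat.ofHom (algebraMap k (AlgebraicClosure k)))) X.hom
    (𝟙 _) hU.fromSpec (𝟙 _) (by simp) ((Category.comp_id _).trans ha)
  have hj : IsOpenImmersion j := inferInstance
  have h1 := isReduced_of_isOpenImmersion j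
  have h2 := isReduced_of_isOpenImmersion
    (pullbackSpecIso k (AlgebraicClosure k) Γ(X.left, U)).inv
  exact (affine_isReduced_iff _).mp h2

/-- A geometrically reduced variety is smooth at its generic point. -/
theorem smoothAt_genericPoint (X : Sch k) [IsVariety X] (hX : GeometricallyReduced X.hom) :
    SmoothAt X (genericPoint X.left) := by
  obtain ⟨U, hU, hxU, -⟩ := exists_affine_le (O := ⊤) (Set.mem_univ (genericPoint X.left))
  have : Nonempty U := ⟨⟨_, hxU⟩⟩
  obtain ⟨a, ha⟩ := Spec.map_surjective (hU.fromSpec ≫ X.hom)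
  have hred := isReduced_tensor_of_geometricallyReduced X hX hU a.hom ha
  let := a.hom.toAlgebra
  have hft : LocallyOfFiniteType (Spec.map a) := by rw [ha]; infer_instance
  have hft' : Algebra.FiniteType k Γ(X.left, U) :=
    (HasRingHomProperty.Spec_iff (P := @LocallyOfFiniteType)).mp hft
  have hfp : Algebra.FinitePresentation k Γ(X.left, U) :=
    Algebra.FinitePresentation.of_finiteType.mp hft'
  -- The local ring at the zero ideal is the function field, so smoothness at that prime is formal
  -- smoothness of the function field.
  have hfr : IsFractionRing Γ(X.left, U) (Localization.AtPrime (⊥ : Ideal Γ(X.left, U))) := by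
    simpa [Ideal.primeCompl_bot] using
      Localization.isLocalization (M := (⊥ : Ideal Γ(X.left, U)).primeCompl)
  have hfs : Algebra.IsSmoothAt k (⊥ : Ideal Γ(X.left, U)) := by
    let := IsFractionRing.toField Γ(X.left, U)
      (K := Localization.AtPrime (⊥ : Ideal Γ(X.left, U)))
    exact formallySmooth_of_isFractionRing (k := k) (A := Γ(X.left, U))
      (Localization.AtPrime (⊥ : Ideal Γ(X.left, U)))
  -- Smoothness spreads out to a nonempty basic open set.
  obtain ⟨r, hr, hsm⟩ := Algebra.IsSmoothAt.exists_notMem_smooth k (⊥ : Ideal Γ(X.left, U))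
  let c : Spec (.of (Localization.Away r)) ⟶ Spec Γ(X.left, U) :=
    Spec.map (CommRingCat.ofHom (algebraMap Γ(X.left, U) (Localization.Away r)))
  have hc : IsOpenImmersion c := IsOpenImmersion.of_isLocalization r
  let j : Spec (.of (Localization.Away r)) ⟶ X.left := c ≫ hU.fromSpec
  have hj : j ≫ X.hom = Spec.map (CommRingCat.ofHom (algebraMap k (Localization.Away r))) := by
    rw [Category.assoc, ← ha, ← Spec.map_comp]
    rfl
  have hs : Smooth (j ≫ X.hom) := by
    rw [hj]
    exact (HasRingHomProperty.Spec_iff (P := @Smooth)).mpr (RingHom.smooth_algebraMap.mpr hsm)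
  have hne : Nontrivial (Localization.Away r) := by
    refine OreLocalization.nontrivial_of_nonZeroDivisors (S := Submonoid.powers r) ?_
    exact powers_le_nonZeroDivisors_of_noZeroDivisors hr
  obtain ⟨z⟩ : Nonempty (PrimeSpectrum (Localization.Away r)) := inferInstance
  refine ⟨j.opensRange, (genericPoint_specializes (j z)).mem_open j.opensRange.2 ⟨z, rfl⟩, ?_⟩
  have : j.opensRange.ι ≫ X.hom = j.isoOpensRange.inv ≫ j ≫ X.hom := by
    rw [← Category.assoc, Scheme.Hom.isoOpensRange_inv_comp]
  rw [this]
  infer_instance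

end GenericSmoothness

end Motivic

namespace Motivic

/-! ### Partial isomorphisms on points -/

section PartialIsoPoints

variable {X Y Z : Scheme.{u}}

lemma hom_inv_apply {P Q : Scheme.{u}} (e : P ≅ Q) (z : P) : e.inv (e.hom z) = z := by
  rw [← Scheme.Hom.comp_apply, Iso.hom_inv_id]
  rfl

lemma eq_of_ι_eq {U : X.Opens} {a b : U.toScheme} (h : U.ι a = U.ι b) : a = b :=
  U.ι.isOpenEmbedding.injective h

lemma homOfLE_apply_eq {U V : X.Opens} (h : U ≤ V) (u : U.toScheme) (v : V.toScheme) (e : U.ι u = V.ι v) :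
    X.homOfLE h u = v := by
  refine eq_of_ι_eq ?_
  rw [← Scheme.Hom.comp_apply, Scheme.homOfLE_ι, e]

lemma hom_isoOfEq_hom_apply {P R : Scheme.{u}} {U : Y.Opens} (e : U.toScheme ≅ P)
    (i : U.toScheme ⟶ U.toScheme) (hi : i = 𝟙 _) (h : U.toScheme ⟶ R) (v : U.toScheme) :
    (e.inv ≫ i ≫ h) (e.hom v) = h v := by
  subst hi
  rw [Category.id_comp, Scheme.Hom.comp_apply, hom_inv_apply]

lemma exists_trans_apply (f : X.PartialIso Y) (g : Y.PartialIso Z) (a : f.source.toScheme) (b : g.source.toScheme)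
    (hb : g.source.ι b = f.target.ι (f.iso.hom a)) :
    ∃ c : (f.trans g).source.toScheme, (f.trans g).source.ι c = f.source.ι a ∧
      (f.trans g).target.ι ((f.trans g).iso.hom c) = g.target.ι (g.iso.hom b) := by
  have hV := f.dense_target.inter_of_isOpen_right g.dense_source g.source.2
  let V := f.target ⊓ g.source
  have hl : V ≤ f.target := inf_le_left
  have hr : V ≤ g.source := inf_le_right
  let A := f.symm.restrictSource V hV hl
  let B := g.restrictSource V hV hr
  have eA : A.iso.hom ≫ A.target.ι = Y.homOfLE hl ≫ f.iso.inv ≫ f.source.ι :=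
    restrictSource_hom_ι f.symm V hV hl
  have eB : B.iso.hom ≫ B.target.ι = Y.homOfLE hr ≫ g.iso.hom ≫ g.target.ι :=
    restrictSource_hom_ι g V hV hr
  let v : V.toScheme := ⟨f.target.ι (f.iso.hom a), (f.iso.hom a).2, by rw [← hb]; exact b.2⟩
  have hv1 : Y.homOfLE hl v = f.iso.hom a := homOfLE_apply_eq _ _ _ rfl
  have hv2 : Y.homOfLE hr v = b := homOfLE_apply_eq _ _ _ hb.symm
  have h1 : A.target.ι (A.iso.hom v) = f.source.ι a :=
    (congrArg (fun t => t v) eA).trans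
      ((congrArg (fun t => f.source.ι (f.iso.inv t)) hv1).trans
        (congrArg f.source.ι (hom_inv_apply f.iso a)))
  have h2 : B.target.ι (B.iso.hom v) = g.target.ι (g.iso.hom b) :=
    (congrArg (fun t => t v) eB).trans (congrArg (fun t => g.target.ι (g.iso.hom t)) hv2)
  have h3 : (A.iso.inv ≫ (Y.isoOfEq rfl).hom ≫ B.iso.hom) (A.iso.hom v) = B.iso.hom v :=
    hom_isoOfEq_hom_apply A.iso (Y.isoOfEq rfl).hom (by simp) B.iso.hom v
  exact ⟨A.iso.hom v, h1, (congrArg B.target.ι h3).trans h2⟩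

/-- The partial isomorphism between the images of two open immersions. -/
noncomputable def partialIsoOfRoof [IrreducibleSpace X] [IrreducibleSpace Y] {W : Scheme.{u}}
    [Nonempty W] (a : W ⟶ X) (b : W ⟶ Y) [IsOpenImmersion a] [IsOpenImmersion b] :
    X.PartialIso Y where
  source := a.opensRange
  dense_source := a.opensRange.2.dense (Set.range_nonempty a)
  target := b.opensRange
  dense_target := b.opensRange.2.dense (Set.range_nonempty b)
  iso := a.isoOpensRange.symm ≪≫ b.isoOpensRange

lemma partialIsoOfRoof_toRationalMap [IrreducibleSpace X] [IrreducibleSpace Y] {W : Scheme.{u}}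
    [Nonempty W] (a : W ⟶ X) (b : W ⟶ Y) [IsOpenImmersion a] [IsOpenImmersion b]
    (f : X.PartialIso Y) {P : Scheme.{u}} [Nonempty P] (c : P ⟶ f.source)
    (d : P ⟶ W) [IsOpenImmersion d] (h1 : c ≫ f.source.ι = d ≫ a)
    (h2 : c ≫ f.iso.hom ≫ f.target.ι = d ≫ b) :
    (partialIsoOfRoof a b).toRationalMap = f.toRationalMap := by
  refine Scheme.PartialMap.toRationalMap_eq_iff.mpr ?_
  have e1 : (d ≫ a.isoOpensRange.hom) ≫ a.opensRange.ι = d ≫ a := by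
    rw [Category.assoc, Scheme.Hom.isoOpensRange_hom_ι]
  refine equiv_of_roof (partialIsoOfRoof a b).toPartialMap f.toPartialMap
    (d ≫ a.isoOpensRange.hom) c (e1.trans h1.symm) (d ≫ a) e1
    ((d ≫ a).isOpenEmbedding.isOpen_range.dense (Set.range_nonempty _)) ?_
  refine Eq.trans ?_ h2.symm
  change (d ≫ a.isoOpensRange.hom) ≫ (a.isoOpensRange.inv ≫ b.isoOpensRange.hom) ≫
    b.opensRange.ι = _
  simp

end PartialIsoPoints

/-! ### Points matched by a birational map -/

section Correspondence

variable {k : Type u} [Field k] {X Y Z : Sch k}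

/-- `φ` is an isomorphism onto an open subscheme near `x`, and it maps `x` to `y`. -/
def BirMap.Corresponds (φ : BirMap X Y) (x : X.left) (y : Y.left) : Prop :=
  ∃ (f : OverPartialIso X Y) (z : f.1.source.toScheme), Quotient.mk _ f = φ ∧
    f.1.source.ι z = x ∧ f.1.target.ι (f.1.iso.hom z) = y

lemma BirMap.notMem_exceptionalSet_iff (φ : BirMap X Y) (x : X.left) :
    x ∉ φ.exceptionalSet ↔ ∃ y, φ.Corresponds x y := by
  constructor
  · intro h
    obtain ⟨f, hf, hx⟩ := not_not.mp h
    exact ⟨_, f, ⟨x, hx⟩, hf, rfl, rfl⟩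
  · rintro ⟨y, f, z, hf, rfl, -⟩
    exact not_not.mpr ⟨f, hf, z.2⟩

lemma BirMap.symm_symm (φ : BirMap X Y) : φ.symm.symm = φ := by
  obtain ⟨f, rfl⟩ := Quotient.exists_rep φ
  rfl

lemma BirMap.Corresponds.symm {φ : BirMap X Y} {x : X.left} {y : Y.left}
    (h : φ.Corresponds x y) : φ.symm.Corresponds y x := by
  obtain ⟨f, z, rfl, rfl, rfl⟩ := h
  refine ⟨⟨f.1.symm, f.2.symm⟩, f.1.iso.hom z, rfl, rfl, ?_⟩
  change f.1.source.ι (f.1.iso.inv (f.1.iso.hom z)) = _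
  exact congrArg _ (hom_inv_apply f.1.iso z)

lemma BirMap.corresponds_symm_iff {φ : BirMap X Y} {x : X.left} {y : Y.left} :
    φ.symm.Corresponds y x ↔ φ.Corresponds x y :=
  ⟨fun h => φ.symm_symm ▸ h.symm, fun h => h.symm⟩

/-- Two representatives agree on a dense open set, hence on the whole intersection of their sources,
because the source is reduced and the target separated. -/
lemma BirMap.Corresponds.right_unique [IsReduced X.left] [IsSeparated Y.hom] {φ : BirMap X Y}
    {x : X.left} {y y' : Y.left} (h : φ.Corresponds x y) (h' : φ.Corresponds x y') : y = y' := by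
  obtain ⟨f, z, rfl, rfl, rfl⟩ := h
  obtain ⟨g, z', hgf, hz, rfl⟩ := h'
  have e : f.1.toRationalMap = g.1.toRationalMap := (Quotient.exact hgf).symm
  rw [Scheme.PartialMap.toRationalMap_eq_iff] at e
  obtain ⟨W, hW, hf, hg, e⟩ := e
  have hf' : W ≤ f.1.source := hf
  have hg' : W ≤ g.1.source := hg
  have e' : X.left.homOfLE hf' ≫ f.1.iso.hom ≫ f.1.target.ι =
    X.left.homOfLE hg' ≫ g.1.iso.hom ≫ g.1.target.ι := e
  let V := f.1.source ⊓ g.1.source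
  have hl : V ≤ f.1.source := inf_le_left
  have hr : V ≤ g.1.source := inf_le_right
  have hWV : W ≤ V := le_inf hf' hg'
  have := Opens.isDominant_homOfLE hW hWV
  have key : X.left.homOfLE hl ≫ f.1.iso.hom ≫ f.1.target.ι =
      X.left.homOfLE hr ≫ g.1.iso.hom ≫ g.1.target.ι := by
    refine ext_of_isDominant_of_isSeparated Y.hom ?_ (X.left.homOfLE hWV) ?_
    · have h1 := f.2
      have h2 := g.2
      simp only [Scheme.PartialIso.IsOver] at h1 h2
      simp only [Category.assoc, h1, h2]
      simp
    · simpa using e'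
  let v : V.toScheme := ⟨f.1.source.ι z, z.2, by rw [← hz]; exact z'.2⟩
  have hv1 : X.left.homOfLE hl v = z := homOfLE_apply_eq _ _ _ rfl
  have hv2 : X.left.homOfLE hr v = z' := homOfLE_apply_eq _ _ _ hz.symm
  exact (congrArg (fun t => f.1.target.ι (f.1.iso.hom t)) hv1).symm.trans
    ((congrArg (fun t => t v) key).trans
      (congrArg (fun t => g.1.target.ι (g.1.iso.hom t)) hv2))

lemma BirMap.Corresponds.left_unique [IsReduced Y.left] [IsSeparated X.hom] {φ : BirMap X Y}
    {x x' : X.left} {y : Y.left} (h : φ.Corresponds x y) (h' : φ.Corresponds x' y) : x = x' :=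
  h.symm.right_unique h'.symm

lemma BirMap.Corresponds.comp [IsVariety X] [IsVariety Y] {φ : BirMap X Y} {ψ : BirMap Y Z}
    {x : X.left} {y : Y.left} {z : Z.left} (h : φ.Corresponds x y) (h' : ψ.Corresponds y z) :
    (φ.comp ψ).Corresponds x z := by
  obtain ⟨f, a, rfl, rfl, rfl⟩ := h
  obtain ⟨g, b, rfl, hb, rfl⟩ := h'
  obtain ⟨c, h1, h2⟩ := exists_trans_apply f.1 g.1 a b hb
  exact ⟨⟨f.1.trans g.1, f.2.trans g.2⟩, c, rfl, h1, h2⟩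

lemma BirMap.Corresponds.coheight_eq {φ : BirMap X Y} {x : X.left} {y : Y.left}
    (h : φ.Corresponds x y) : Order.coheight x = Order.coheight y := by
  obtain ⟨f, z, -, rfl, rfl⟩ := h
  exact (coheight_eq_of_isOpenImmersion f.1.source.ι).trans
    (coheight_eq_of_isOpenImmersion (f.1.iso.hom ≫ f.1.target.ι)).symm

/-- Two open immersions that agree with `φ` on a nonempty open subscheme give representatives. -/
lemma BirMap.corresponds_of_openImmersion [IsVariety X] [IsVariety Y] (f : OverPartialIso X Y)
    {W : Scheme.{u}} (a : W ⟶ X.left) (b : W ⟶ Y.left) [IsOpenImmersion a] [IsOpenImmersion b]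
    (hab : a ≫ X.hom = b ≫ Y.hom) {P : Scheme.{u}} [Nonempty P] (c : P ⟶ f.1.source)
    (d : P ⟶ W) [IsOpenImmersion d] (h1 : c ≫ f.1.source.ι = d ≫ a)
    (h2 : c ≫ f.1.iso.hom ≫ f.1.target.ι = d ≫ b) (w : W) :
    BirMap.Corresponds (Quotient.mk _ f : BirMap X Y) (a w) (b w) := by
  have : Nonempty W := ⟨w⟩
  have hg : (partialIsoOfRoof a b).IsOver X.hom Y.hom := by
    simp [Scheme.PartialIso.IsOver, partialIsoOfRoof, ← hab]
  refine ⟨⟨partialIsoOfRoof a b, hg⟩, a.isoOpensRange.hom w,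
    Quotient.sound (partialIsoOfRoof_toRationalMap a b f.1 c d h1 h2), ?_, ?_⟩
  · change a.opensRange.ι (a.isoOpensRange.hom w) = _
    rw [← Scheme.Hom.comp_apply, Scheme.Hom.isoOpensRange_hom_ι]
  · change b.opensRange.ι (b.isoOpensRange.hom (a.isoOpensRange.inv (a.isoOpensRange.hom w))) = _
    rw [hom_inv_apply, ← Scheme.Hom.comp_apply, Scheme.Hom.isoOpensRange_hom_ι]

end Correspondence

end Motivic

namespace Motivic

/-! ### Birational classes of closures of points -/

section PointClosures

variable {k : Type u} [Field k]

instance isIntegral_pointClosure_image (X : Sch k) [IsVariety X] (x : X.left) :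
    IsIntegral (X.left.fromSpecResidueField x).image :=
  (pointClosure_isVariety X x).isIntegral

lemma imageι_genericPoint {M : Scheme.{u}} (x : M) [IsIntegral (M.fromSpecResidueField x).image] :
    (M.fromSpecResidueField x).imageι (genericPoint (M.fromSpecResidueField x).image) = x := by
  set f := M.fromSpecResidueField x
  obtain ⟨z⟩ : Nonempty (Spec (M.residueField x)) := inferInstance
  have hsub : Subsingleton (Spec (M.residueField x)) :=
    inferInstanceAs (Subsingleton (PrimeSpectrum (M.residueField x)))
  have h : IsGenericPoint (f.toImage z) Set.univ := by
    rw [IsGenericPoint, ← f.toImage.denseRange.closure_range]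
    congr 1
    ext y
    constructor
    · rintro rfl
      exact ⟨z, rfl⟩
    · rintro ⟨w, rfl⟩
      rw [Subsingleton.elim w z]
      rfl
  have h' := h.eq (genericPoint_spec f.image)
  have h2 : f.imageι (f.toImage z) = f z := by rw [← Scheme.Hom.comp_apply, f.toImage_imageι]
  exact (congrArg f.imageι h'.symm).trans (h2.trans (M.fromSpecResidueField_apply x z))

lemma isVariety_opn (X : Sch k) [IsVariety X] (V : X.left.Opens) [Nonempty V.toScheme] :
    IsVariety (opn X V) :=
  have : IsIntegral V.toScheme := isIntegral_of_isOpenImmersion V.ι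
  { opn_isFiniteType X V with
    isIntegral := this
    isSeparated := inferInstanceAs (IsSeparated (V.ι ≫ X.hom)) }

lemma birClass_eq {V W : Sch k} [IsVariety V] [IsVariety W]
    (h : Scheme.BirationalOver V.hom W.hom) : birClass V = birClass W :=
  congrArg FreeAbelianGroup.of (Quotient.sound h)

lemma birClass_eq_iff {V W : Sch k} [IsVariety V] [IsVariety W] :
    birClass V = birClass W ↔ Scheme.BirationalOver V.hom W.hom :=
  ⟨fun h => Quotient.exact (FreeAbelianGroup.of_injective h), birClass_eq⟩

lemma birationalOver_pointClosure (X : Sch k) [IsVariety X] {Z : Scheme.{u}} [IsIntegral Z]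
    (a : Z ⟶ X.left) [IsImmersion a] (x : X.left) (h : a (genericPoint Z) = x) :
    Scheme.BirationalOver (pointClosure X x).hom (a ≫ X.hom) :=
  birationalOver_of_immersion (X.left.fromSpecResidueField x).imageι a
    ((imageι_genericPoint x).trans h.symm) X.hom

/-- The closure of the point inside the source of a representative immerses into both varieties,
compatibly with the structure maps, and its generic point goes to `x` and `y`. -/
lemma BirMap.Corresponds.birClass_eq {X Y : Sch k} [IsVariety X] [IsVariety Y] {φ : BirMap X Y}
    {x : X.left} {y : Y.left} (h : φ.Corresponds x y) :
    birClass (pointClosure X x) = birClass (pointClosure Y y) := by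
  obtain ⟨f, z, -, hz, rfl⟩ := h
  have : Nonempty f.1.source.toScheme := ⟨z⟩
  have := isVariety_opn X f.1.source
  have hi : IsIntegral (f.1.source.toScheme.fromSpecResidueField z).image :=
    isIntegral_pointClosure_image (opn X f.1.source) z
  refine Motivic.birClass_eq ?_
  have h1 := birationalOver_pointClosure X
    ((f.1.source.toScheme.fromSpecResidueField z).imageι ≫ f.1.source.ι) x
    ((congrArg f.1.source.ι (imageι_genericPoint z)).trans hz)
  have h2 := birationalOver_pointClosure Y
    ((f.1.source.toScheme.fromSpecResidueField z).imageι ≫ f.1.iso.hom ≫ f.1.target.ι) _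
    (congrArg (f.1.iso.hom ≫ f.1.target.ι) (imageι_genericPoint z))
  refine h1.trans ?_
  have e : ((f.1.source.toScheme.fromSpecResidueField z).imageι ≫ f.1.source.ι) ≫ X.hom =
    ((f.1.source.toScheme.fromSpecResidueField z).imageι ≫ f.1.iso.hom ≫ f.1.target.ι) ≫ Y.hom := by
    have := f.2
    simp only [Scheme.PartialIso.IsOver] at this
    simp only [Category.assoc, this]
  rw [e]
  exact h2.symm

end PointClosures

/-! ### Additivity of the invariant -/

section Invariant

variable {k : Type u} [Field k] {X Y Z : Sch k} [IsVariety X] [IsVariety Y] [IsVariety Z]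

/-- The exceptional divisors in the definition of `c` may be replaced by larger sets that
correspond to each other. -/
lemma BirMap.c_eq_of_subset (φ : BirMap X Y) {A : Set X.left} {B : Set Y.left} (hA : A.Finite)
    (hB : B.Finite) (hA1 : ∀ x ∈ A, Order.coheight x = 1) (hB1 : ∀ y ∈ B, Order.coheight y = 1)
    (hEA : φ.exceptionalDivisors ⊆ A) (hEB : φ.symm.exceptionalDivisors ⊆ B)
    (hAB : ∀ x y, φ.Corresponds x y → (x ∈ A ↔ y ∈ B)) :
    φ.c = (∑ᶠ y ∈ B, birClass (pointClosure Y y)) - ∑ᶠ x ∈ A, birClass (pointClosure X x) := by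
  have h1 : ∀ x ∈ A \ φ.exceptionalDivisors, ∃ y, φ.Corresponds x y := by
    rintro x ⟨hxA, hx⟩
    rw [← BirMap.notMem_exceptionalSet_iff]
    exact fun h => hx ⟨h, hA1 x hxA⟩
  have : Nonempty Y.left := inferInstance
  choose! e he using h1
  -- The superfluous divisors on the two sides are matched by `φ`, with equal classes, so they
  -- cancel in the difference.
  have hbij : Set.BijOn e (A \ φ.exceptionalDivisors) (B \ φ.symm.exceptionalDivisors) := by
    refine ⟨fun x hx => ⟨(hAB _ _ (he x hx)).mp hx.1, fun h =>
      (φ.symm.notMem_exceptionalSet_iff _).mpr ⟨x, (he x hx).symm⟩ h.1⟩, fun x hx x' hx' h => ?_,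
      fun y hy => ?_⟩
    · exact (he x hx).left_unique (h ▸ he x' hx')
    · obtain ⟨x, hx⟩ := (φ.symm.notMem_exceptionalSet_iff y).mp fun h => hy.2 ⟨h, hB1 y hy.1⟩
      have hx' := BirMap.corresponds_symm_iff.mp hx
      have hxA : x ∈ A \ φ.exceptionalDivisors := ⟨(hAB _ _ hx').mpr hy.1, fun h =>
        (φ.notMem_exceptionalSet_iff x).mpr ⟨y, hx'⟩ h.1⟩
      exact ⟨x, hxA, (he x hxA).right_unique hx'⟩
  have h2 := finsum_mem_eq_of_bijOn (f := fun x => birClass (pointClosure X x))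
    (g := fun y => birClass (pointClosure Y y)) e hbij fun x hx => (he x hx).birClass_eq
  rw [BirMap.c, ← finsum_mem_add_sdiff hEA hA, ← finsum_mem_add_sdiff hEB hB, h2]
  abel

lemma BirMap.finite_setOf_corresponds (φ : BirMap X Y) {B : Set Y.left} (hB : B.Finite) :
    {x | ∃ y ∈ B, φ.Corresponds x y}.Finite := by
  have : {x | ∃ y ∈ B, φ.Corresponds x y} = ⋃ y ∈ B, {x | φ.Corresponds x y} := by
    ext x
    simp
  rw [this]
  refine hB.biUnion fun y _ => Set.Subsingleton.finite fun x hx x' hx' => ?_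
  exact BirMap.Corresponds.left_unique hx hx'

theorem BirMap.c_symm (φ : BirMap X Y) : φ.symm.c = -φ.c := by
  rw [BirMap.c, BirMap.c, φ.symm_symm, neg_sub]

/-- Divisors of `Y` that are exceptional for `φ⁻¹` or for `ψ` form `B`. Adding to the exceptional
divisors on `X` and `Z` those matched with `B` gives `A` and `D`. All three invariants can be
computed from these sets, and the sum over `B` telescopes away. -/
theorem BirMap.c_comp (φ : BirMap X Y) (ψ : BirMap Y Z) : (φ.comp ψ).c = φ.c + ψ.c := by
  let B : Set Y.left := φ.symm.exceptionalDivisors ∪ ψ.exceptionalDivisors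
  let A : Set X.left := φ.exceptionalDivisors ∪ {x | ∃ y ∈ B, φ.Corresponds x y}
  let D : Set Z.left := ψ.symm.exceptionalDivisors ∪ {z | ∃ y ∈ B, ψ.symm.Corresponds z y}
  have hB : B.Finite := φ.symm.finite_exceptionalDivisors.union ψ.finite_exceptionalDivisors
  have hA : A.Finite := φ.finite_exceptionalDivisors.union (φ.finite_setOf_corresponds hB)
  have hD : D.Finite :=
    ψ.symm.finite_exceptionalDivisors.union (ψ.symm.finite_setOf_corresponds hB)
  have hB1 : ∀ y ∈ B, Order.coheight y = 1 := by rintro y (h | h) <;> exact h.2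
  have hA1 : ∀ x ∈ A, Order.coheight x = 1 := by
    rintro x (h | ⟨y, hy, h⟩)
    · exact h.2
    · exact h.coheight_eq.trans (hB1 y hy)
  have hD1 : ∀ z ∈ D, Order.coheight z = 1 := by
    rintro x (h | ⟨y, hy, h⟩)
    · exact h.2
    · exact h.coheight_eq.trans (hB1 y hy)
  have hAB : ∀ x y, φ.Corresponds x y → (x ∈ A ↔ y ∈ B) := by
    refine fun x y h => ⟨?_, fun hy => Or.inr ⟨y, hy, h⟩⟩
    rintro (hx | ⟨y', hy', h'⟩)
    · exact absurd hx.1 ((φ.notMem_exceptionalSet_iff x).mpr ⟨y, h⟩)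
    · exact h.right_unique h' ▸ hy'
  have hDB : ∀ z y, ψ.symm.Corresponds z y → (z ∈ D ↔ y ∈ B) := by
    refine fun x y h => ⟨?_, fun hy => Or.inr ⟨y, hy, h⟩⟩
    rintro (hx | ⟨y', hy', h'⟩)
    · exact absurd hx.1 ((ψ.symm.notMem_exceptionalSet_iff x).mpr ⟨y, h⟩)
    · exact h.right_unique h' ▸ hy'
  -- Off `A`, codimension-one points pass through both maps without meeting `B` or `D`; hence `A`
  -- contains the exceptional divisors of the composite.
  have hAD : ∀ x, Order.coheight x = 1 → x ∉ A →
      ∃ y z, φ.Corresponds x y ∧ ψ.Corresponds y z ∧ z ∉ D := by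
    intro x hx hxA
    obtain ⟨y, hy⟩ := (φ.notMem_exceptionalSet_iff x).mp fun h => hxA (Or.inl ⟨h, hx⟩)
    have hyB : y ∉ B := fun h => hxA ((hAB x y hy).mpr h)
    obtain ⟨z, hz⟩ := (ψ.notMem_exceptionalSet_iff y).mp fun h =>
      hyB (Or.inr ⟨h, hy.coheight_eq.symm.trans hx⟩)
    exact ⟨y, z, hy, hz, fun h => hyB ((hDB z y hz.symm).mp h)⟩
  have hDA : ∀ z, Order.coheight z = 1 → z ∉ D →
      ∃ x y, φ.Corresponds x y ∧ ψ.Corresponds y z ∧ x ∉ A := by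
    intro z hz hzD
    obtain ⟨y, hy⟩ := (ψ.symm.notMem_exceptionalSet_iff z).mp fun h => hzD (Or.inl ⟨h, hz⟩)
    have hyB : y ∉ B := fun h => hzD ((hDB z y hy).mpr h)
    obtain ⟨x, hx⟩ := (φ.symm.notMem_exceptionalSet_iff y).mp fun h =>
      hyB (Or.inl ⟨h, hy.coheight_eq.symm.trans hz⟩)
    have hx' := BirMap.corresponds_symm_iff.mp hx
    exact ⟨x, y, hx', BirMap.corresponds_symm_iff.mp hy, fun h => hyB ((hAB x y hx').mp h)⟩
  rw [φ.c_eq_of_subset hA hB hA1 hB1 Set.subset_union_left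
      (Set.subset_union_left) hAB,
    ψ.c_eq_of_subset hB hD hB1 hD1 Set.subset_union_right Set.subset_union_left
      (fun y z h => (hDB z y h.symm).symm),
    (φ.comp ψ).c_eq_of_subset hA hD hA1 hD1 ?_ ?_ ?_]
  · abel
  · intro x hx
    by_contra hxA
    obtain ⟨y, z, h1, h2, -⟩ := hAD x hx.2 hxA
    exact ((φ.comp ψ).notMem_exceptionalSet_iff x).mpr ⟨z, h1.comp h2⟩ hx.1
  · intro z hz
    by_contra hzD
    obtain ⟨x, y, h1, h2, -⟩ := hDA z hz.2 hzD
    exact ((φ.comp ψ).symm.notMem_exceptionalSet_iff z).mpr ⟨x, (h1.comp h2).symm⟩ hz.1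
  · intro x z h
    constructor
    · intro hx
      by_contra hz
      obtain ⟨x', y, h1, h2, hx'⟩ := hDA z (h.coheight_eq.symm.trans (hA1 x hx)) hz
      exact hx' (h.left_unique (h1.comp h2) ▸ hx)
    · intro hz
      by_contra hx
      obtain ⟨y, z', h1, h2, hz'⟩ := hAD x (h.coheight_eq.trans (hD1 z hz)) hx
      exact hz' (h.right_unique (h1.comp h2) ▸ hz)

end Invariant

end Motivic

/-! ### Comparison of codimensions -/

namespace Motivic

lemma coheight_le_of_specializes {M : Scheme.{u}} {x y : M} (h : x ⤳ y) :
    Order.coheight x ≤ Order.coheight y :=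
  Order.coheight_anti (show y ≤ x from h)

lemma eq_of_specializes_of_coheight_eq {M : Scheme.{u}} {x y : M} (h : x ⤳ y) {n : ℕ}
    (hx : Order.coheight x = n) (hy : Order.coheight y = n) : x = y := by
  by_contra hne
  have h1 : y < x := ⟨h, fun h' => hne (h.antisymm h').eq⟩
  have h2 := Order.coheight_add_one_le h1
  rw [hx, hy] at h2
  exact absurd (Nat.cast_le.mp (by exact_mod_cast h2 : ((n + 1 : ℕ) : ℕ∞) ≤ n)) (by omega)

/-- Points of the center have codimension at least that of its generic point. Thus every
codimension-one point of `S` lies where the blow-up is an isomorphism. -/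
lemma coheight_ne_one_of_mem_range {k : Type u} [Field k] {X S : Sch k} {i : X ⟶ S}
    [IsVariety X] {m : ℕ} (hm : codim i = m) (hm2 : 2 ≤ m) {x : S.left}
    (hx : x ∈ Set.range i.left) : Order.coheight x ≠ 1 := by
  obtain ⟨x, rfl⟩ := hx
  intro h
  have h1 := coheight_le_of_specializes
    ((genericPoint_specializes x).map i.left.continuous)
  have h2 : Order.coheight (i.left (genericPoint X.left)) = m := hm
  rw [h, h2] at h1
  exact absurd (Nat.cast_le.mp (by exact_mod_cast h1 : (m : ℕ∞) ≤ (1 : ℕ))) (by omega)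

/-! ### Points of a blow-up and its exceptional divisor -/

section BlowUpPoints

variable {k : Type u} [Field k] {X S T : Sch k} {i : X ⟶ S} [IsClosedImmersion i.left] {p : T ⟶ S}

lemma IsBlowUp.isOpenImmersion_preimage_centerCompl (hp : IsBlowUp p.left i.left.ker) :
    IsOpenImmersion ((p.left ⁻¹ᵁ centerCompl i).ι ≫ p.left) := by
  have := hp.isIso_centerCompl
  rw [← morphismRestrict_ι]
  infer_instance

lemma IsBlowUp.isOpenImmersion_ι_comp (hp : IsBlowUp p.left i.left.ker) {O : T.left.Opens}
    (hO : O ≤ p.left ⁻¹ᵁ centerCompl i) : IsOpenImmersion (O.ι ≫ p.left) := by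
  have := hp.isOpenImmersion_preimage_centerCompl
  rw [← T.left.homOfLE_ι hO, Category.assoc]
  infer_instance

lemma IsBlowUp.coheight_eq (hp : IsBlowUp p.left i.left.ker) {t : T.left}
    (ht : p.left t ∉ Set.range i.left) : Order.coheight (p.left t) = Order.coheight t := by
  have := hp.isOpenImmersion_preimage_centerCompl
  let t' : (p.left ⁻¹ᵁ centerCompl i).toScheme := ⟨t, ht⟩
  exact (coheight_eq_of_isOpenImmersion (x := t') ((p.left ⁻¹ᵁ centerCompl i).ι ≫ p.left)).trans
    (coheight_eq_of_isOpenImmersion (p.left ⁻¹ᵁ centerCompl i).ι).symm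

lemma IsBlowUp.eq_of_apply_eq (hp : IsBlowUp p.left i.left.ker) {t t' : T.left}
    (ht : p.left t ∉ Set.range i.left) (h : p.left t = p.left t') : t = t' := by
  have := hp.isOpenImmersion_preimage_centerCompl
  let s : (p.left ⁻¹ᵁ centerCompl i).toScheme := ⟨t, ht⟩
  let s' : (p.left ⁻¹ᵁ centerCompl i).toScheme := ⟨t', fun h' => ht (h ▸ h')⟩
  have : s = s' := ((p.left ⁻¹ᵁ centerCompl i).ι ≫ p.left).isOpenEmbedding.injective h
  exact congrArg (p.left ⁻¹ᵁ centerCompl i).ι this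

lemma IsBlowUp.exists_apply_eq (hp : IsBlowUp p.left i.left.ker) {x : S.left}
    (hx : x ∉ Set.range i.left) : ∃ t, p.left t = x := by
  have := hp.isIso_centerCompl
  obtain ⟨t, ht⟩ := (p.left ∣_ centerCompl i).surjective ⟨x, hx⟩
  refine ⟨(p.left ⁻¹ᵁ centerCompl i).ι t, ?_⟩
  have h := congrArg (fun f => f t) (morphismRestrict_ι p.left (centerCompl i))
  exact h.symm.trans (congrArg (centerCompl i).ι ht)

/-- The generic point of an irreducible exceptional divisor, and its birational class. -/
theorem IsBlowUp.exists_genericPoint_exceptional [IsVariety X] [IsVariety S]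
    (hp : IsBlowUp p.left i.left.ker) {m : ℕ} (hm : codim i = m) (hm0 : m ≠ 0)
    (hX : SmoothAt X (genericPoint X.left)) (hS : SmoothAt S (i.left (genericPoint X.left)))
    (hirr : IsIrreducible (p.left ⁻¹' Set.range i.left)) :
    ∃ t : T.left, IsGenericPoint t (p.left ⁻¹' Set.range i.left) ∧ Order.coheight t = 1 ∧
      ∃ (Z : Scheme.{u}) (_ : IsIntegral Z) (e : Z ⟶ T.left) (_ : IsImmersion e),
        e (genericPoint Z) = t ∧
          Scheme.BirationalOver (e ≫ T.hom) (prod (projSpace k m) X).hom := by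
  obtain ⟨U, hU, V, e, hxU, hV, -, hei, hep, her, hex, h1⟩ :=
    hp.exists_exceptional_chart_at hm _ hX hS
  let j : Fin m := ⟨0, Nat.pos_of_ne_zero hm0⟩
  have hne : Nonempty (i.left ⁻¹ᵁ U) := ⟨⟨_, hxU⟩⟩
  have hdom : IsDomain Γ(X.left, i.left ⁻¹ᵁ U) := inferInstance
  have := hei j
  have hgen : genericPoint (Spec (.of (MvPolynomial {l // l ≠ j} Γ(X.left, i.left ⁻¹ᵁ U)))) =
    (⊥ : PrimeSpectrum _) := genericPoint_eq_bot_of_affine _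
  refine ⟨_, ?_, h1 hdom j, _, inferInstance, e j, hei j, congrArg (e j) hgen, ?_⟩
  · have ht : e j (⊥ : PrimeSpectrum _) ∈ (V j : Set T.left) ∩ p.left ⁻¹' Set.range i.left := by
      rw [← her j]
      exact ⟨_, rfl⟩
    have hcl : IsClosed (p.left ⁻¹' Set.range i.left) :=
      i.left.isClosedEmbedding.isClosed_range.preimage p.left.continuous
    refine (hcl.closure_subset_iff.mpr (Set.singleton_subset_iff.mpr ht.2)).antisymm ?_
    -- A nonempty open part of the irreducible exceptional divisor is dense in it; one chart is such
    -- a part, and it is an integral affine space with generic point `⊥`.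
    refine (subset_closure_inter_of_isPreirreducible_of_isOpen hirr.isPreirreducible (V j).2
      ⟨_, ht.2, ht.1⟩).trans (closure_minimal ?_ isClosed_closure)
    rw [Set.inter_comm]
    refine (her j).ge.trans ?_
    rintro _ ⟨z, rfl⟩
    refine specializes_iff_mem_closure.mp (Specializes.map ?_ (e j).continuous)
    rw [← hgen]
    exact genericPoint_specializes z
  · have h2 := birationalOver_prod_projSpace j X (hU.preimage i.left)
    have h3 : e j ≫ T.hom = Spec.map (CommRingCat.ofHom (MvPolynomial.C
        (R := Γ(X.left, i.left ⁻¹ᵁ U)) (σ := {l : Fin m // l ≠ j}))) ≫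
        (hU.preimage i.left).fromSpec ≫ X.hom := by
      rw [← Over.w p, ← Category.assoc, hep j, Category.assoc, Category.assoc, Over.w i]
    rw [h3]
    exact h2

/-- The class of the image of an exceptional divisor that is not contracted by `p`. -/
lemma IsBlowUp.birationalOver_pointClosure [IsVariety S] (hp : IsBlowUp p.left i.left.ker)
    {Z : Scheme.{u}} [IsIntegral Z] (e : Z ⟶ T.left) [IsImmersion e]
    (he : p.left (e (genericPoint Z)) ∉ Set.range i.left) :
    Scheme.BirationalOver (pointClosure S (p.left (e (genericPoint Z)))).hom (e ≫ T.hom) := by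
  let O := p.left ⁻¹ᵁ centerCompl i
  have := hp.isOpenImmersion_preimage_centerCompl
  let W : Z.Opens := e ⁻¹ᵁ O
  have hne : Nonempty W.toScheme := ⟨⟨_, he⟩⟩
  have hW : IsIntegral W.toScheme := isIntegral_of_isOpenImmersion W.ι
  have hgen : W.ι (genericPoint W.toScheme) = genericPoint Z :=
    genericPoint_eq_of_isOpenImmersion W.ι
  have hfac : (e ∣_ O) ≫ O.ι = W.ι ≫ e := morphismRestrict_ι e O
  have himm : IsImmersion (e ∣_ O) := inferInstance
  have himm' : IsImmersion ((e ∣_ O) ≫ O.ι ≫ p.left) := inferInstance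
  have hfac' : (e ∣_ O) ≫ O.ι ≫ p.left = W.ι ≫ e ≫ p.left := by
    rw [← Category.assoc, hfac, Category.assoc]
  have h1 := Motivic.birationalOver_pointClosure S ((e ∣_ O) ≫ O.ι ≫ p.left) _
    (congrArg (fun t => t (genericPoint W.toScheme)) hfac')
  have h2 : (W.ι ≫ e ≫ p.left) (genericPoint W.toScheme) = p.left (e (genericPoint Z)) :=
    congrArg (fun z => p.left (e z)) hgen
  have h3 : ((e ∣_ O) ≫ O.ι ≫ p.left) ≫ S.hom = (W.ι ≫ e) ≫ T.hom := by
    rw [hfac', Category.assoc, Category.assoc, Category.assoc, Over.w p]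
  have h4 : Scheme.BirationalOver ((W.ι ≫ e) ≫ T.hom) (e ≫ T.hom) :=
    birationalOver_of_immersion (W.ι ≫ e) e (congrArg e hgen) T.hom
  rw [h3] at h1
  exact (h2 ▸ h1).trans h4

end BlowUpPoints

/-! ### The birational map of a link on points -/

section Link

variable {k : Type u} [Field k]

/-- Off both exceptional divisors `p` and `q` are open immersions. They form a roof which agrees
with a representative of `ψ` on a nonempty open set, hence represents `ψ`. -/
lemma LLink.corresponds (L : LLink k) [IsClosedImmersion L.i.left] [IsClosedImmersion L.j.left]
    {t : L.T.left} (ht : L.p.left t ∉ Set.range L.i.left)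
    (ht' : L.q.left t ∉ Set.range L.j.left) : L.ψ.Corresponds (L.p.left t) (L.q.left t) := by
  obtain ⟨f, hf, hcomm⟩ := L.comm
  rw [← hf]
  let O : L.T.left.Opens := L.p.left ⁻¹ᵁ centerCompl L.i ⊓ L.q.left ⁻¹ᵁ centerCompl L.j
  have ha : IsOpenImmersion (O.ι ≫ L.p.left) := L.isBlowUp_p.isOpenImmersion_ι_comp inf_le_left
  have hb : IsOpenImmersion (O.ι ≫ L.q.left) := L.isBlowUp_q.isOpenImmersion_ι_comp inf_le_right
  -- The part of the roof where the given representative is defined; it is nonempty since the source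
  -- of the representative is dense.
  let N : L.T.left.Opens := O ⊓ L.p.left ⁻¹ᵁ f.1.source
  have hl : N ≤ O := inf_le_left
  have hr : N ≤ L.p.left ⁻¹ᵁ f.1.source := inf_le_right
  let w : O.toScheme := ⟨t, ht, ht'⟩
  have hne : Nonempty N.toScheme := by
    obtain ⟨_, ⟨z, rfl⟩, hz⟩ := f.1.dense_source.inter_open_nonempty _
      (O.ι ≫ L.p.left).isOpenEmbedding.isOpen_range ⟨_, w, rfl⟩
    exact ⟨⟨O.ι z, z.2, hz⟩⟩
  refine BirMap.corresponds_of_openImmersion f (O.ι ≫ L.p.left) (O.ι ≫ L.q.left) ?_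
    (L.T.left.homOfLE hr ≫ L.p.left ∣_ f.1.source) (L.T.left.homOfLE hl) ?_ ?_ w
  · rw [Category.assoc, Category.assoc, Over.w, Over.w]
  · rw [Category.assoc, morphismRestrict_ι, ← Category.assoc, ← Category.assoc,
      Scheme.homOfLE_ι, Scheme.homOfLE_ι]
  · rw [Category.assoc, hcomm, ← Category.assoc, ← Category.assoc, Scheme.homOfLE_ι,
      Scheme.homOfLE_ι]

end Link

end Motivic

namespace Motivic

/-! ### The invariant of a link -/

section LinkInvariant

variable {k : Type u} [Field k]

lemma IsGenericPoint.eq_of_coheight_eq_one {M : Scheme.{u}} {E : Set M} {e t : M}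
    (he : IsGenericPoint e E) (he1 : Order.coheight e = 1) (ht : t ∈ E)
    (ht1 : Order.coheight t = 1) : t = e :=
  (eq_of_specializes_of_coheight_eq (n := 1) (he.specializes ht) (by exact_mod_cast he1)
    (by exact_mod_cast ht1)).symm

lemma IsBlowUp.exists_apply_eq_of_coheight_eq_one {X S T : Sch k} [IsVariety X] {i : X ⟶ S}
    [IsClosedImmersion i.left] {p : T ⟶ S} (hp : IsBlowUp p.left i.left.ker) {m : ℕ}
    (hm : codim i = m) (hm2 : 2 ≤ m) {x : S.left} (hx : Order.coheight x = 1) :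
    ∃ t, p.left t = x ∧ p.left t ∉ Set.range i.left ∧ Order.coheight t = 1 := by
  have hx' : x ∉ Set.range i.left := fun h => coheight_ne_one_of_mem_range hm hm2 h hx
  obtain ⟨t, rfl⟩ := hp.exists_apply_eq hx'
  exact ⟨t, rfl, hx', (hp.coheight_eq hx').symm.trans hx⟩

/-- A point of codimension one at which `φ = q ∘ p⁻¹` is not an isomorphism is the image of the
exceptional divisor of `q`. -/
lemma BirMap.exceptionalDivisors_subset_image {X Y S S' T : Sch k} [IsVariety X]
    {i : X ⟶ S} {j : Y ⟶ S'} [IsClosedImmersion i.left] {p : T ⟶ S} {q : T ⟶ S'}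
    (hp : IsBlowUp p.left i.left.ker) {m : ℕ}
    (hm : codim i = m) (hm2 : 2 ≤ m) {φ : BirMap S S'}
    (hφ : ∀ t, p.left t ∉ Set.range i.left → q.left t ∉ Set.range j.left →
      φ.Corresponds (p.left t) (q.left t)) {e e' : T.left}
    (he : IsGenericPoint e (p.left ⁻¹' Set.range i.left))
    (he' : IsGenericPoint e' (q.left ⁻¹' Set.range j.left)) (he'1 : Order.coheight e' = 1) :
    φ.exceptionalDivisors ⊆ p.left '' ({e'} \ {e}) := by
  rintro x ⟨hx, hx1⟩
  obtain ⟨t, rfl, ht, ht1⟩ := hp.exists_apply_eq_of_coheight_eq_one hm hm2 hx1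
  have ht' : t ∈ q.left ⁻¹' Set.range j.left := by
    by_contra h
    exact (φ.notMem_exceptionalSet_iff _).mpr ⟨_, hφ t ht h⟩ hx
  obtain rfl := IsGenericPoint.eq_of_coheight_eq_one he' he'1 ht' ht1
  exact ⟨t, ⟨rfl, fun h => ht (show t ∈ p.left ⁻¹' Set.range i.left from h ▸ he.mem)⟩, rfl⟩

/-- The map may be an isomorphism at `p(e')` although its roof is not defined there; this shows that
it must then match `p(e')` with `q(e)`. Indeed the partner lifts along `q` to a codimension-one
point `t ≠ e'`, and if `t` were off the exceptional divisor of `p`, then `p(t) = p(e')` would force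
`t = e'`. -/
lemma BirMap.Corresponds.mem_image {X Y S S' T : Sch k} [IsVariety X] [IsVariety Y] [IsVariety S]
    [IsVariety S'] {i : X ⟶ S} {j : Y ⟶ S'} [IsClosedImmersion i.left] [IsClosedImmersion j.left]
    {p : T ⟶ S} {q : T ⟶ S'} (hp : IsBlowUp p.left i.left.ker) (hq : IsBlowUp q.left j.left.ker)
    {m' : ℕ} (hm' : codim j = m') (hm2' : 2 ≤ m') {φ : BirMap S S'}
    (hφ : ∀ t, p.left t ∉ Set.range i.left → q.left t ∉ Set.range j.left →
      φ.Corresponds (p.left t) (q.left t)) {e e' : T.left}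
    (he : IsGenericPoint e (p.left ⁻¹' Set.range i.left)) (he1 : Order.coheight e = 1)
    (he' : IsGenericPoint e' (q.left ⁻¹' Set.range j.left)) (he'1 : Order.coheight e' = 1)
    (h0 : p.left e' ∉ Set.range i.left) {y : S'.left} (h : φ.Corresponds (p.left e') y) :
    y ∈ q.left '' ({e} \ {e'}) := by
  have hy1 : Order.coheight y = 1 := h.coheight_eq.symm.trans ((hp.coheight_eq h0).trans he'1)
  obtain ⟨t, rfl, ht, ht1⟩ := hq.exists_apply_eq_of_coheight_eq_one hm' hm2' hy1
  have hte' : t ≠ e' := fun h => ht (show t ∈ q.left ⁻¹' Set.range j.left from h ▸ he'.mem)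
  have ht' : t ∈ p.left ⁻¹' Set.range i.left := by
    by_contra h'
    exact hte' (hp.eq_of_apply_eq h' ((hφ t h' ht).left_unique h))
  obtain rfl := IsGenericPoint.eq_of_coheight_eq_one he he1 ht' ht1
  exact ⟨t, ⟨rfl, hte'⟩, rfl⟩

/-- The points `p(e')` and `q(e)` need not be exceptional, since `ψ` might match them with each
other. `BirMap.c_eq_of_subset` covers this case too, as the two classes would then cancel. -/
theorem LLink.c_eq (L : LLink k) {m m' : ℕ} (hm : codim L.i = m) (hm' : codim L.j = m')
    (hm2 : 2 ≤ m) (hm2' : 2 ≤ m') (hS : SmoothAt L.𝒳 (L.i.left (genericPoint L.X.left)))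
    (hS' : SmoothAt L.𝒳' (L.j.left (genericPoint L.Y.left)))
    [IsVariety (prod (projSpace k m) L.X)] [IsVariety (prod (projSpace k m') L.Y)] :
    L.ψ.c = birClass (prod (projSpace k m) L.X) - birClass (prod (projSpace k m') L.Y) := by
  have := L.isClosedImmersion_i
  have := L.isClosedImmersion_j
  have hp := L.isBlowUp_p
  have hq := L.isBlowUp_q
  obtain ⟨e, he, he1, Z, _, z, _, rfl, hZb⟩ := hp.exists_genericPoint_exceptional hm (by omega)
    (smoothAt_genericPoint L.X L.geometricallyReduced_X) hS L.irreducible_p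
  obtain ⟨e', he', he'1, Z', _, z', _, rfl, hZb'⟩ := hq.exists_genericPoint_exceptional hm'
    (by omega) (smoothAt_genericPoint L.Y L.geometricallyReduced_Y) hS' L.irreducible_q
  set e := z (genericPoint Z) with hez
  set e' := z' (genericPoint Z') with hez'
  have hφ : ∀ t, L.p.left t ∉ Set.range L.i.left → L.q.left t ∉ Set.range L.j.left →
      L.ψ.Corresponds (L.p.left t) (L.q.left t) := fun t h h' => L.corresponds h h'
  have hφ' : ∀ t, L.q.left t ∉ Set.range L.j.left → L.p.left t ∉ Set.range L.i.left →
      L.ψ.symm.Corresponds (L.q.left t) (L.p.left t) := fun t h h' => (hφ t h' h).symm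
  have hnp : e' ≠ e → L.p.left e' ∉ Set.range L.i.left := fun hne h =>
    hne (IsGenericPoint.eq_of_coheight_eq_one he he1 h he'1)
  have hnq : e ≠ e' → L.q.left e ∉ Set.range L.j.left := fun hne h =>
    hne (IsGenericPoint.eq_of_coheight_eq_one he' he'1 h he1)
  rw [L.ψ.c_eq_of_subset (A := L.p.left '' ({e'} \ {e})) (B := L.q.left '' ({e} \ {e'}))
    (((Set.finite_singleton _).sdiff).image _) (((Set.finite_singleton _).sdiff).image _) ?_ ?_
    (BirMap.exceptionalDivisors_subset_image hp hm hm2 hφ he he' he'1)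
    (BirMap.exceptionalDivisors_subset_image hq hm' hm2' hφ' he' he he1) ?_]
  -- If the exceptional divisors coincide, both sets are empty and the two products are birational
  -- to the same divisor. Otherwise neither divisor is contracted by the opposite blow-up.
  · by_cases hee : e = e'
    · have : birClass (prod (projSpace k m) L.X) = birClass (prod (projSpace k m') L.Y) :=
        birClass_eq ((hZb.symm.trans (birationalOver_of_immersion z z' hee L.T.hom)).trans hZb')
      rw [hee, Set.sdiff_self, Set.image_empty, Set.image_empty, finsum_mem_empty,
        finsum_mem_empty, this, sub_self, sub_self]
    · have h1 : ({e} \ {e'} : Set L.T.left) = {e} := by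
        rw [sdiff_eq_left, Set.disjoint_singleton]
        exact hee
      have h2 : ({e'} \ {e} : Set L.T.left) = {e'} := by
        rw [sdiff_eq_left, Set.disjoint_singleton]
        exact Ne.symm hee
      rw [h1, h2, Set.image_singleton, Set.image_singleton, finsum_mem_singleton,
        finsum_mem_singleton]
      congr 1
      · exact birClass_eq ((hq.birationalOver_pointClosure z (hnq hee)).trans hZb)
      · exact birClass_eq ((hp.birationalOver_pointClosure z' (hnp (Ne.symm hee))).trans hZb')
  · rintro _ ⟨t, ⟨rfl, hne⟩, rfl⟩
    exact (hp.coheight_eq (hnp hne)).trans he'1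
  · rintro _ ⟨t, ⟨rfl, hne⟩, rfl⟩
    exact (hq.coheight_eq (hnq hne)).trans he1
  · intro x y h
    constructor
    · rintro ⟨t, ⟨rfl, hne⟩, rfl⟩
      exact h.mem_image hp hq hm' hm2' hφ he he1 he' he'1 (hnp hne)
    · rintro ⟨t, ⟨rfl, hne⟩, rfl⟩
      exact h.symm.mem_image hq hp hm hm2 hφ' he' he'1 he he1 (hnq hne)

lemma stablyBirational_of_birationalOver {X Y : Sch k} {m m' : ℕ} (hm : m ≠ 0) (hm' : m' ≠ 0)
    (h : Scheme.BirationalOver (prod (projSpace k m) X).hom (prod (projSpace k m') Y).hom) :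
    StablyBirational X Y := by
  have key : ∀ (Z : Sch k) (n : ℕ), Scheme.BirationalOver (prod Z (projSpace k n)).hom
      (prod (projSpace k n) Z).hom := fun Z n =>
    Scheme.Hom.birationalOver (Limits.pullbackSymmetry Z.hom (projSpace k n).hom).hom
      _ _ (by
        change _ ≫ Limits.pullback.fst _ _ ≫ _ = Limits.pullback.fst _ _ ≫ _
        rw [Limits.pullbackSymmetry_hom_comp_fst_assoc, Limits.pullback.condition])
  obtain ⟨a, rfl⟩ := Nat.exists_eq_succ_of_ne_zero hm
  obtain ⟨b, rfl⟩ := Nat.exists_eq_succ_of_ne_zero hm'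
  exact ⟨a, b, ((key X _).trans h).trans (key Y _).symm⟩

end LinkInvariant

end Motivic

theorem mainTheorem11 {k : Type u} [Field k] (L : LLink k) (m m' : ℕ)
    (hm : codim L.i = m) (hm' : codim L.j = m') :
    (L.IsSmooth →
      lefschetz k * (k0Class (projSpace k (m - 1)) * k0Class L.X -
        k0Class (projSpace k (m' - 1)) * k0Class L.Y) = 0) ∧
    (∀ γ : BirMap L.𝒳 L.𝒳', γ.c = 0 →
      (L.ψ.comp γ.symm).c = L.ψ.c ∧ (L.ψ.c ≠ 0 → (L.ψ.comp γ.symm).c ≠ 0)) ∧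
    (2 ≤ m → 2 ≤ m' →
      SmoothAt L.𝒳 (L.i.left (genericPoint L.X.left)) →
      SmoothAt L.𝒳' (L.j.left (genericPoint L.Y.left)) →
      (∃ (_ : IsVariety (prod (projSpace k m) L.X)) (_ : IsVariety (prod (projSpace k m') L.Y)),
        L.ψ.c = birClass (prod (projSpace k m) L.X) - birClass (prod (projSpace k m') L.Y) ∧
        ∀ γ : BirMap L.𝒳 L.𝒳', γ.c = 0 →
          (L.ψ.comp γ.symm).c =
            birClass (prod (projSpace k m) L.X) - birClass (prod (projSpace k m') L.Y)) ∧
      (¬ StablyBirational L.X L.Y →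
        L.ψ.c ≠ 0 ∧ ∀ γ : BirMap L.𝒳 L.𝒳', γ.c = 0 → (L.ψ.comp γ.symm).c ≠ 0)) := by
  -- Additivity gives `c(γ⁻¹ ∘ ψ) = c(ψ) - c(γ)`.
  have hγ : ∀ γ : BirMap L.𝒳 L.𝒳', γ.c = 0 → (L.ψ.comp γ.symm).c = L.ψ.c := fun γ h => by
    rw [BirMap.c_comp, BirMap.c_symm, h, neg_zero, add_zero]
  refine ⟨fun hL => hL.lefschetz_mul_sub_eq_zero hm hm', fun γ h =>
    ⟨hγ γ h, fun hψ => (hγ γ h).symm ▸ hψ⟩, fun h2 h2' hS hS' => ?_⟩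
  have hX := isVariety_prod_projSpace (m := m) (by omega) L.X
  have hY := isVariety_prod_projSpace (m := m') (by omega) L.Y
  have hc := L.c_eq hm hm' h2 h2' hS hS'
  refine ⟨⟨hX, hY, hc, fun γ h => (hγ γ h).trans hc⟩, fun hst => ?_⟩
  -- Classes of varieties are basis elements of a free group, so a vanishing difference means that
  -- the two products are birational.
  have hc0 : L.ψ.c ≠ 0 := fun h0 => hst <| stablyBirational_of_birationalOver
    (by omega) (by omega) (birClass_eq_iff.mp (sub_eq_zero.mp (hc.symm.trans h0)))
  exact ⟨hc0, fun γ h => (hγ γ h).symm ▸ hc0⟩
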